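/- **Setting.** All algebras are over $\mathbb C$, possibly without unit. For an algebra $A$ let $M(A)$ be its multiplier algebra. Let $(A,\Delta)$ be a *regular weak multiplier Hopf algebra* (Van Daele–Wang). This means the following. - $A$ is non-degenerate and idempotent ($A^2=A$). The coproduct $\Delta:A\to M(A\otimes A)$ is a homomorphism such that $T_1(a\otimes b)=\Delta(a)(1\otimes b)$ and $T_2(c\otimes a)=(c\otimes 1)\Delta(a)$ lie in $A\otimes A$. It is coassociative, it is full (its legs are all of $A$), and it has a counit $\varepsilon$. - There is an idempotent $E\in M(A\otimes A)$ with $T_1(A\otimes A)=E(A\otimes A)$, $T_2(A\otimes A)=(A\otimes A)E$ and $(\Delta\otimes\iota)E=(\iota\otimes\Delta)E=(E\otimes1)(1\otimes E)=(1\otimes E)(E\otimes 1)$. - $\ker T_i=(1-G_i)(A\otimes A)$ for $i=1,2$, where $G_1,G_2$ are the linear maps on $A\otimes A$ with $(G_1\otimes\iota)(\Delta_{13}(a)(1\otimes b\otimes c))=\Delta_{13}(a)(1\otimes E)(1\otimes b\otimes c)$ and $(\iota\otimes G_2)((a\otimes b\otimes1)\Delta_{13}(c))=(a\otimes b\otimes1)(E\otimes1)\Delta_{13}(c)$.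 - The antipode $S$ is a bijection of $A$. It is the map for which $R_1(a\otimes b)=\sum a_{(1)}\otimes S(a_{(2)})b$ and $R_2(b\otimes a)=\sum bS(a_{(1)})\otimes a_{(2)}$ are the generalized inverses of $T_1,T_2$ with $T_1R_1=E(\,\cdot\,)$, $R_1T_1=G_1$, $T_2R_2=(\,\cdot\,)E$, $R_2T_2=G_2$. Put $\varepsilon_s(a)=\sum S(a_{(1)})a_{(2)}$ and $\varepsilon_t(a)=\sum a_{(1)}S(a_{(2)})$ in $M(A)$. Let $A_s,A_t\subseteq M(A)$ be the multiplier algebras of the subalgebras $\varepsilon_s(A)$ and $\varepsilon_t(A)$, i.e. the sets of $x\in M(A)$ that multiply $\varepsilon_s(A)$, respectively $\varepsilon_t(A)$, into itself from both sides. A *left integral* is a non-zero linear functional $\varphi$ on $A$ with $(\iota\otimes\varphi)\Delta(a)\in A_t$ for all $a$. A *right integral* is a non-zero linear functional $\psi$ with $(\psi\otimes\iota)\Delta(a)\in A_s$ for all $a$. A functional $\omega$ is *faithful* if each of the conditions "$\omega(ab)=0$ for all $b$" and "$\omega(ba)=0$ for all $b$" implies $a=0$. For a multiplier $m$ of $A\otimes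 A$ for which $m(1\otimes b)$ and $(1\otimes b)m$ lie in $A\otimes A$ for all $b\in A$, the multiplier $x=(\omega\otimes\iota)m\in M(A)$ is given by $xb=(\omega\otimes\iota)(m(1\otimes b))$ and $bx=(\omega\otimes\iota)((1\otimes b)m)$; $(\iota\otimes\omega)m$ is defined likewise on the other leg. **Proposition.** For every linear functional $f$ on $A$ and every $a\in A$ the multipliers $(f\otimes\iota)((a\otimes1)E)$, $(f\otimes\iota)(E(a\otimes1))$, $(\iota\otimes f)((1\otimes a)E)$ and $(\iota\otimes f)(E(1\otimes a))$ are well-defined elements of $M(A)$, and the following hold. 1. A left integral $\varphi$ on $A$ is faithful if and only if $$\{(\varphi\otimes\iota)((a\otimes 1)E)\mid a\in A\}=\varepsilon_t(A)\quad\text{and}\quad \{(\varphi\otimes\iota)(E(a\otimes 1))\mid a\in A\}=\varepsilon_t(A).\qquad (L)$$ 2. A right integral $\psi$ on $A$ is faithful if and only if $$\{(\iota\otimes\psi)((1\otimes a)E)\mid a\in A\}=\varepsilon_s(A)\quad\text{and}\quad \{(\iota\otimes\psi)(E(1\otimes a))\mid a\in A\}=\varepsilon_s(A).\qquad (R)$$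 3. Consequently the following are equivalent: (i) there is a faithful left integral; (ii) there is a left integral satisfying $(L)$; (iii) there is a non-zero functional $\varphi$ satisfying $(L)$ that is left invariant in the sense of Timmermann, that is, $(\iota\otimes\varphi)\Delta(a)=(\iota\otimes\varphi)(F_2(1\otimes a))$ for all $a$, where $F_2=(S\otimes\iota)E$; (iv) there is a faithful right integral; (v) there is a right integral satisfying $(R)$; (vi) there is a non-zero functional $\psi$ satisfying $(R)$ that is right invariant in the sense of Timmermann, that is, $(\psi\otimes\iota)\Delta(a)=(\psi\otimes\iota)((a\otimes1)F_1)$ for all $a$, where $F_1=(\iota\otimes S)E$. -/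

import Mathlib

open scoped TensorProduct

set_option linter.unusedSectionVars false
set_option linter.unusedSimpArgs false

section Multipliers

variable (A : Type*) [NonUnitalRing A] [Module ℂ A] [IsScalarTower ℂ A A] [SMulCommClass ℂ A A]

/-- The multiplier algebra `M(A)` of an algebra `A` over `ℂ`, not necessarily unital: pairs `m` of
linear maps `b ↦ m b` and `a ↦ a m` from `A` to `A` such that `a (m b) = (a m) b`.  The product is
`(m n) b = m (n b)` and `a (m n) = (a m) n`. -/
def multiplierSubalgebra : Subalgebra ℂ (Module.End ℂ A × (Module.End ℂ A)ᵐᵒᵖ) where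
  carrier := {m | ∀ a b : A, a * m.1 b = m.2.unop a * b}
  mul_mem' := by
    intro m n hm hn a b
    have h1 := hm a (n.1 b)
    have h2 := hn (m.2.unop a) b
    simpa using h1.trans h2
  add_mem' := by
    intro m n hm hn a b
    simp only [Prod.fst_add, Prod.snd_add, MulOpposite.unop_add, LinearMap.add_apply, mul_add,
      add_mul]
    rw [hm a b, hn a b]
  algebraMap_mem' := by
    intro r a b
    simp [Algebra.algebraMap_eq_smul_one, mul_smul_comm, smul_mul_assoc]

/-- The multiplier algebra `M(A)`. -/
def MultiplierAlgebra : Type _ := multiplierSubalgebra A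

instance : Ring (MultiplierAlgebra A) := inferInstanceAs (Ring (multiplierSubalgebra A))

instance : Algebra ℂ (MultiplierAlgebra A) :=
  inferInstanceAs (Algebra ℂ (multiplierSubalgebra A))

variable {A}

namespace MultiplierAlgebra

/-- The map `b ↦ m b`. -/
def left (m : MultiplierAlgebra A) : A →ₗ[ℂ] A := m.1.1

/-- The map `a ↦ a m`. -/
def right (m : MultiplierAlgebra A) : A →ₗ[ℂ] A := m.1.2.unop

/-- The multiplier with prescribed left and right actions. -/
def ofPair (l r : A →ₗ[ℂ] A) (h : ∀ a b : A, a * l b = r a * b) : MultiplierAlgebra A :=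
  ⟨(l, MulOpposite.op r), h⟩

theorem compat (m : MultiplierAlgebra A) (a b : A) : a * m.left b = m.right a * b := m.2 a b

@[ext] theorem ext {m n : MultiplierAlgebra A} (hl : ∀ b, m.left b = n.left b)
    (hr : ∀ a, m.right a = n.right a) : m = n := by
  apply Subtype.ext
  apply Prod.ext
  · exact LinearMap.ext hl
  · exact MulOpposite.unop_injective (LinearMap.ext hr)

@[simp] theorem left_ofPair (l r : A →ₗ[ℂ] A) (h) : (ofPair l r h).left = l := rfl
@[simp] theorem right_ofPair (l r : A →ₗ[ℂ] A) (h) : (ofPair l r h).right = r := rfl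
@[simp] theorem left_mul (m n : MultiplierAlgebra A) (b : A) :
    (m * n).left b = m.left (n.left b) := rfl
@[simp] theorem right_mul (m n : MultiplierAlgebra A) (a : A) :
    (m * n).right a = n.right (m.right a) := rfl
@[simp] theorem left_one (b : A) : (1 : MultiplierAlgebra A).left b = b := rfl
@[simp] theorem right_one (a : A) : (1 : MultiplierAlgebra A).right a = a := rfl
@[simp] theorem left_add (m n : MultiplierAlgebra A) : (m + n).left = m.left + n.left := rfl
@[simp] theorem right_add (m n : MultiplierAlgebra A) : (m + n).right = m.right + n.right := rfl
@[simp] theorem left_smul (c : ℂ) (m : MultiplierAlgebra A) : (c • m).left = c • m.left := rfl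
@[simp] theorem right_smul (c : ℂ) (m : MultiplierAlgebra A) : (c • m).right = c • m.right := rfl

/-- The canonical map `A → M(A)`. -/
def incl : A →ₗ[ℂ] MultiplierAlgebra A where
  toFun a := ofPair (LinearMap.mulLeft ℂ a) (LinearMap.mulRight ℂ a)
    (fun x y => by simp [mul_assoc])
  map_add' a b := ext (fun x => add_mul a b x) (fun x => mul_add x a b)
  map_smul' c a := ext (fun x => smul_mul_assoc c a x) (fun x => mul_smul_comm c x a)

@[simp] theorem left_incl (a b : A) : (incl a).left b = a * b := rfl
@[simp] theorem right_incl (a b : A) : (incl a).right b = b * a := rfl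

variable {B : Type*} [NonUnitalRing B] [Module ℂ B] [IsScalarTower ℂ B B] [SMulCommClass ℂ B B]

/-- The multiplier `m ⊗ n` of `A ⊗ B`, as a bilinear map in `(m, n)`. -/
def tmul : MultiplierAlgebra A →ₗ[ℂ] MultiplierAlgebra B →ₗ[ℂ] MultiplierAlgebra (A ⊗[ℂ] B) :=
  LinearMap.mk₂ ℂ
    (fun m n => ofPair (TensorProduct.map m.left n.left) (TensorProduct.map m.right n.right) (by
      intro x y
      induction x with
      | zero => simp
      | add x₁ x₂ h₁ h₂ => simp only [add_mul, map_add, h₁, h₂]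
      | tmul a b =>
        induction y with
        | zero => simp
        | add y₁ y₂ h₁ h₂ => simp only [mul_add, map_add, h₁, h₂]
        | tmul c d =>
          simp only [TensorProduct.map_tmul, Algebra.TensorProduct.tmul_mul_tmul, compat]))
    (fun _ _ _ => by ext x <;> simp [TensorProduct.map_add_left])
    (fun _ _ _ => by ext x <;> simp [TensorProduct.map_smul_left])
    (fun _ _ _ => by ext x <;> simp [TensorProduct.map_add_right])
    (fun _ _ _ => by ext x <;> simp [TensorProduct.map_smul_right])

@[simp] theorem left_tmul (m : MultiplierAlgebra A) (n : MultiplierAlgebra B) :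
    (tmul m n).left = TensorProduct.map m.left n.left := rfl
@[simp] theorem right_tmul (m : MultiplierAlgebra A) (n : MultiplierAlgebra B) :
    (tmul m n).right = TensorProduct.map m.right n.right := rfl

/-- Transport of multipliers along a linear bijection that respects products. -/
def comap (e : A ≃ₗ[ℂ] B) (he : ∀ x y, e (x * y) = e x * e y) :
    MultiplierAlgebra B →ₗ[ℂ] MultiplierAlgebra A where
  toFun m := ofPair (e.symm.toLinearMap ∘ₗ m.left ∘ₗ e.toLinearMap)
    (e.symm.toLinearMap ∘ₗ m.right ∘ₗ e.toLinearMap) (fun x y => by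
      apply e.injective
      simp [he, compat])
  map_add' m n := by ext <;> simp
  map_smul' c m := by ext <;> simp

theorem assoc_mul (x y : (A ⊗[ℂ] A) ⊗[ℂ] A) :
    TensorProduct.assoc ℂ A A A (x * y) =
      TensorProduct.assoc ℂ A A A x * TensorProduct.assoc ℂ A A A y := by
  induction x with
  | zero => simp
  | add x₁ x₂ h₁ h₂ => simp only [add_mul, map_add, h₁, h₂]
  | tmul p c =>
    induction p with
    | zero => simp
    | add p₁ p₂ h₁ h₂ => simp only [TensorProduct.add_tmul, add_mul, map_add, h₁, h₂]
    | tmul a b =>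
      induction y with
      | zero => simp
      | add y₁ y₂ h₁ h₂ => simp only [mul_add, map_add, h₁, h₂]
      | tmul q f =>
        induction q with
        | zero => simp
        | add q₁ q₂ h₁ h₂ =>
          simp only [TensorProduct.add_tmul, mul_add, map_add, h₁, h₂]
        | tmul d e => simp

/-- The identification of `M(A ⊗ (A ⊗ A))` with `M((A ⊗ A) ⊗ A)`. -/
def reassoc : MultiplierAlgebra (A ⊗[ℂ] (A ⊗[ℂ] A)) →ₗ[ℂ] MultiplierAlgebra ((A ⊗[ℂ] A) ⊗[ℂ] A) :=
  comap (TensorProduct.assoc ℂ A A A) assoc_mul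

/-- `y` is the value at the multiplier `m` of the extension to `M(A)` of the homomorphism
`F : A → M(B)`, normalised by `1 ↦ p`:
`y F(u) = F(m u)`, `F(u) y = F(u m)` for all `u`, and `y p = y = p y`. -/
def IsExtensionAt (F : A →ₗ[ℂ] MultiplierAlgebra B) (p : MultiplierAlgebra B)
    (m : MultiplierAlgebra A) (y : MultiplierAlgebra B) : Prop :=
  (∀ u, y * F u = F (m.left u)) ∧ (∀ u, F u * y = F (m.right u)) ∧ y * p = y ∧ p * y = y

end MultiplierAlgebra

end Multipliers

open MultiplierAlgebra

section Slices

variable {A : Type*} [NonUnitalRing A] [Module ℂ A] [IsScalarTower ℂ A A] [SMulCommClass ℂ A A]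

/-- `ω ⊗ ι : A ⊗ A → A`. -/
noncomputable def sliceFst (ω : A →ₗ[ℂ] ℂ) : A ⊗[ℂ] A →ₗ[ℂ] A :=
  (TensorProduct.lid ℂ A).toLinearMap ∘ₗ TensorProduct.map ω LinearMap.id

/-- `ι ⊗ ω : A ⊗ A → A`. -/
noncomputable def sliceSnd (ω : A →ₗ[ℂ] ℂ) : A ⊗[ℂ] A →ₗ[ℂ] A :=
  (TensorProduct.rid ℂ A).toLinearMap ∘ₗ TensorProduct.map LinearMap.id ω

/-- `x = (ω ⊗ ι) m` in `M(A)`, for a multiplier `m` of `A ⊗ A` such that `m (1 ⊗ b)` and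
`(1 ⊗ b) m` lie in `A ⊗ A` for all `b`:
`x b = (ω ⊗ ι)(m (1 ⊗ b))` and `b x = (ω ⊗ ι)((1 ⊗ b) m)`. -/
def IsSliceFst (ω : A →ₗ[ℂ] ℂ) (m : MultiplierAlgebra (A ⊗[ℂ] A)) (x : MultiplierAlgebra A) :
    Prop :=
  ∀ b : A,
    (∃ u, incl u = m * tmul 1 (incl b) ∧ x.left b = sliceFst ω u) ∧
    (∃ v, incl v = tmul 1 (incl b) * m ∧ x.right b = sliceFst ω v)

/-- `x = (ι ⊗ ω) m` in `M(A)`, for a multiplier `m` of `A ⊗ A` such that `m (b ⊗ 1)` and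
`(b ⊗ 1) m` lie in `A ⊗ A` for all `b`:
`x b = (ι ⊗ ω)(m (b ⊗ 1))` and `b x = (ι ⊗ ω)((b ⊗ 1) m)`. -/
def IsSliceSnd (ω : A →ₗ[ℂ] ℂ) (m : MultiplierAlgebra (A ⊗[ℂ] A)) (x : MultiplierAlgebra A) :
    Prop :=
  ∀ b : A,
    (∃ u, incl u = m * tmul (incl b) 1 ∧ x.left b = sliceSnd ω u) ∧
    (∃ v, incl v = tmul (incl b) 1 * m ∧ x.right b = sliceSnd ω v)

/-- A linear functional `ω` is faithful if `a = 0` as soon as `ω(ab) = 0` for all `b`, and also as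
soon as `ω(ba) = 0` for all `b`. -/
def IsFaithfulFunctional (ω : A →ₗ[ℂ] ℂ) : Prop :=
  (∀ a, (∀ b, ω (a * b) = 0) → a = 0) ∧ (∀ a, (∀ b, ω (b * a) = 0) → a = 0)

/-- For a linear map `f` on `A ⊗ A`, the map `ι ⊗ f` on `(A ⊗ A) ⊗ A`. -/
noncomputable def onLegs23 (f : A ⊗[ℂ] A →ₗ[ℂ] A ⊗[ℂ] A) :
    (A ⊗[ℂ] A) ⊗[ℂ] A →ₗ[ℂ] (A ⊗[ℂ] A) ⊗[ℂ] A :=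
  (TensorProduct.assoc ℂ A A A).symm.toLinearMap ∘ₗ LinearMap.lTensor A f ∘ₗ
    (TensorProduct.assoc ℂ A A A).toLinearMap

/-- For a linear map `f` on `A ⊗ A`, the map `f ⊗ ι` on `(A ⊗ A) ⊗ A`. -/
noncomputable def onLegs12 (f : A ⊗[ℂ] A →ₗ[ℂ] A ⊗[ℂ] A) :
    (A ⊗[ℂ] A) ⊗[ℂ] A →ₗ[ℂ] (A ⊗[ℂ] A) ⊗[ℂ] A :=
  LinearMap.rTensor A f

/-- For a linear map `f` on `A ⊗ A`, the map on `(A ⊗ A) ⊗ A` that acts as `f` on the first and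
third tensor factors. -/
noncomputable def onLegs13 (f : A ⊗[ℂ] A →ₗ[ℂ] A ⊗[ℂ] A) :
    (A ⊗[ℂ] A) ⊗[ℂ] A →ₗ[ℂ] (A ⊗[ℂ] A) ⊗[ℂ] A :=
  (TensorProduct.rightComm ℂ A A A).toLinearMap ∘ₗ LinearMap.rTensor A f ∘ₗ
    (TensorProduct.rightComm ℂ A A A).toLinearMap

/-- For `Δ : A → M(A ⊗ A)`, the map `Δ ⊗ ι : A ⊗ A → M(A ⊗ A ⊗ A)`. -/
noncomputable def extendFst (Δ : A →ₗ[ℂ] MultiplierAlgebra (A ⊗[ℂ] A)) :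
    A ⊗[ℂ] A →ₗ[ℂ] MultiplierAlgebra ((A ⊗[ℂ] A) ⊗[ℂ] A) :=
  TensorProduct.lift (tmul.compl₁₂ Δ incl)

/-- For `Δ : A → M(A ⊗ A)`, the map `ι ⊗ Δ : A ⊗ A → M(A ⊗ A ⊗ A)`. -/
noncomputable def extendSnd (Δ : A →ₗ[ℂ] MultiplierAlgebra (A ⊗[ℂ] A)) :
    A ⊗[ℂ] A →ₗ[ℂ] MultiplierAlgebra ((A ⊗[ℂ] A) ⊗[ℂ] A) :=
  reassoc ∘ₗ TensorProduct.lift (tmul.compl₁₂ incl Δ)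

end Slices

section WeakMultiplierHopf

/-- A weak multiplier Hopf algebra `(A, Δ)`, in the sense of Van Daele and Wang: a non-degenerate
idempotent algebra `A` with a full coproduct `Δ : A → M(A ⊗ A)` that admits a counit `ε` and a
canonical idempotent `E`.  The canonical maps are `T₁(a ⊗ b) = Δ(a)(1 ⊗ b)` and
`T₂(c ⊗ a) = (c ⊗ 1)Δ(a)`.  All the data other than `Δ` is uniquely determined by `(A, Δ)`. -/
structure WeakMultiplierHopfAlgebra (A : Type*) [NonUnitalRing A] [Module ℂ A]
    [IsScalarTower ℂ A A] [SMulCommClass ℂ A A] where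
  /-- The product is non-degenerate. -/
  nondegenerate_left : ∀ a : A, (∀ b, a * b = 0) → a = 0
  nondegenerate_right : ∀ a : A, (∀ b, b * a = 0) → a = 0
  /-- `A² = A`. -/
  idempotent : LinearMap.range (LinearMap.mul' ℂ A) = ⊤
  /-- The coproduct, a homomorphism. -/
  Δ : A →ₙₐ[ℂ] MultiplierAlgebra (A ⊗[ℂ] A)
  /-- `Δ(a)(1 ⊗ b)` lies in `A ⊗ A`. -/
  T₁ : A ⊗[ℂ] A →ₗ[ℂ] A ⊗[ℂ] A
  T₁_spec : ∀ a b : A, incl (T₁ (a ⊗ₜ b)) = Δ a * tmul 1 (incl b)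
  /-- `(c ⊗ 1)Δ(a)` lies in `A ⊗ A`. -/
  T₂ : A ⊗[ℂ] A →ₗ[ℂ] A ⊗[ℂ] A
  T₂_spec : ∀ c a : A, incl (T₂ (c ⊗ₜ a)) = tmul (incl c) 1 * Δ a
  /-- Coassociativity:
  `(c ⊗ 1 ⊗ 1)(Δ ⊗ ι)(Δ(a)(1 ⊗ b)) = (ι ⊗ Δ)((c ⊗ 1)Δ(a))(1 ⊗ 1 ⊗ b)`. -/
  coassoc : onLegs12 T₂ ∘ₗ onLegs23 T₁ = onLegs23 T₁ ∘ₗ onLegs12 T₂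
  /-- The coproduct is full: `A` is the smallest subspace `V` such that
  `Δ(a)(1 ⊗ b) ∈ V ⊗ A` for all `a, b`, and the smallest subspace `W` such that
  `(c ⊗ 1)Δ(a) ∈ A ⊗ W` for all `a, c`. -/
  full_left : ∀ V : Submodule ℂ A,
    (∀ a b : A, T₁ (a ⊗ₜ b) ∈ LinearMap.range (TensorProduct.map V.subtype LinearMap.id :
      V ⊗[ℂ] A →ₗ[ℂ] A ⊗[ℂ] A)) → V = ⊤
  full_right : ∀ W : Submodule ℂ A,
    (∀ c a : A, T₂ (c ⊗ₜ a) ∈ LinearMap.range (TensorProduct.map LinearMap.id W.subtype :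
      A ⊗[ℂ] W →ₗ[ℂ] A ⊗[ℂ] A)) → W = ⊤
  /-- The counit: `(ε ⊗ ι)(Δ(a)(1 ⊗ b)) = ab` and `(ι ⊗ ε)((c ⊗ 1)Δ(a)) = ca`. -/
  ε : A →ₗ[ℂ] ℂ
  counit_left : ∀ a b : A, sliceFst ε (T₁ (a ⊗ₜ b)) = a * b
  counit_right : ∀ c a : A, sliceSnd ε (T₂ (c ⊗ₜ a)) = c * a
  /-- The canonical idempotent. -/
  E : MultiplierAlgebra (A ⊗[ℂ] A)
  E_mul_E : E * E = E
  /-- `T₁(A ⊗ A) = E(A ⊗ A)` and `T₂(A ⊗ A) = (A ⊗ A)E`. -/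
  range_T₁ : LinearMap.range T₁ = LinearMap.range E.left
  range_T₂ : LinearMap.range T₂ = LinearMap.range E.right
  /-- `(Δ ⊗ ι)E = (ι ⊗ Δ)E = (E ⊗ 1)(1 ⊗ E) = (1 ⊗ E)(E ⊗ 1)`, where the homomorphisms `Δ ⊗ ι`
  and `ι ⊗ Δ` are extended to `M(A ⊗ A)` by `1 ↦ E ⊗ 1` and `1 ↦ 1 ⊗ E` respectively. -/
  E_comm : tmul E 1 * reassoc (tmul 1 E) = reassoc (tmul 1 E) * tmul E 1
  extend_fst_E : IsExtensionAt (extendFst (Δ : A →ₗ[ℂ] MultiplierAlgebra (A ⊗[ℂ] A)))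
    (tmul E 1) E (tmul E 1 * reassoc (tmul 1 E))
  extend_snd_E : IsExtensionAt (extendSnd (Δ : A →ₗ[ℂ] MultiplierAlgebra (A ⊗[ℂ] A)))
    (reassoc (tmul 1 E)) E (tmul E 1 * reassoc (tmul 1 E))
  /-- The projection maps `G₁`, `G₂` of `A ⊗ A` associated with `E`:
  `(G₁ ⊗ ι)(Δ₁₃(a)(1 ⊗ b ⊗ c)) = Δ₁₃(a)(1 ⊗ E)(1 ⊗ b ⊗ c)` and
  `(ι ⊗ G₂)((a ⊗ b ⊗ 1)Δ₁₃(c)) = (a ⊗ b ⊗ 1)(E ⊗ 1)Δ₁₃(c)`. -/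
  G₁ : A ⊗[ℂ] A →ₗ[ℂ] A ⊗[ℂ] A
  G₁_spec : onLegs12 G₁ ∘ₗ onLegs13 T₁ = onLegs13 T₁ ∘ₗ onLegs23 E.left
  G₂ : A ⊗[ℂ] A →ₗ[ℂ] A ⊗[ℂ] A
  G₂_spec : onLegs23 G₂ ∘ₗ onLegs13 T₂ = onLegs13 T₂ ∘ₗ onLegs12 E.right
  /-- The kernels of the canonical maps are `(1 - G₁)(A ⊗ A)` and `(1 - G₂)(A ⊗ A)`. -/
  ker_T₁ : LinearMap.ker T₁ = LinearMap.range (LinearMap.id - G₁)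
  ker_T₂ : LinearMap.ker T₂ = LinearMap.range (LinearMap.id - G₂)

/-- A regular weak multiplier Hopf algebra: the antipode `S` is a bijection from `A` to itself.
The antipode is the map such that `R₁(a ⊗ b) = ∑ a₍₁₎ ⊗ S(a₍₂₎)b` and
`R₂(b ⊗ a) = ∑ b S(a₍₁₎) ⊗ a₍₂₎`, where `R₁` and `R₂` are the generalized inverses of the canonical
maps `T₁` and `T₂` given by the projections on ranges and along kernels:
`T₁R₁ = E(·)`, `R₁T₁ = G₁`, `T₂R₂ = (·)E`, `R₂T₂ = G₂`. -/
structure RegularWeakMultiplierHopfAlgebra (A : Type*) [NonUnitalRing A] [Module ℂ A]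
    [IsScalarTower ℂ A A] [SMulCommClass ℂ A A] extends WeakMultiplierHopfAlgebra A where
  /-- The antipode. -/
  S : A ≃ₗ[ℂ] A
  R₁ : A ⊗[ℂ] A →ₗ[ℂ] A ⊗[ℂ] A
  T₁_comp_R₁ : T₁ ∘ₗ R₁ = E.left
  R₁_comp_T₁ : R₁ ∘ₗ T₁ = G₁
  R₁_T₁_R₁ : R₁ ∘ₗ T₁ ∘ₗ R₁ = R₁
  /-- `(c ⊗ 1)R₁(a ⊗ b) = (ι ⊗ S)((c ⊗ 1)Δ(a))(1 ⊗ b)`. -/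
  R₁_spec : ∀ a b c : A, (tmul (incl c) 1).left (R₁ (a ⊗ₜ b)) =
    (tmul 1 (incl b)).right (TensorProduct.map LinearMap.id S.toLinearMap (T₂ (c ⊗ₜ a)))
  R₂ : A ⊗[ℂ] A →ₗ[ℂ] A ⊗[ℂ] A
  T₂_comp_R₂ : T₂ ∘ₗ R₂ = E.right
  R₂_comp_T₂ : R₂ ∘ₗ T₂ = G₂
  R₂_T₂_R₂ : R₂ ∘ₗ T₂ ∘ₗ R₂ = R₂
  /-- `R₂(b ⊗ a)(1 ⊗ c) = (b ⊗ 1)(S ⊗ ι)(Δ(a)(1 ⊗ c))`. -/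
  R₂_spec : ∀ a b c : A, (tmul 1 (incl c)).right (R₂ (b ⊗ₜ a)) =
    (tmul (incl b) 1).left (TensorProduct.map S.toLinearMap LinearMap.id (T₁ (a ⊗ₜ c)))

namespace RegularWeakMultiplierHopfAlgebra

variable {A : Type*} [NonUnitalRing A] [Module ℂ A] [IsScalarTower ℂ A A] [SMulCommClass ℂ A A]

theorem mul'_left_tmul (c : A) (u : A ⊗[ℂ] A) :
    LinearMap.mul' ℂ A ((tmul (incl c) 1).left u) = c * LinearMap.mul' ℂ A u := by
  induction u with
  | zero => simp
  | add u v hu hv => simp only [map_add, mul_add, hu, hv]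
  | tmul p q => simp [mul_assoc]

theorem mul'_right_tmul (b : A) (u : A ⊗[ℂ] A) :
    LinearMap.mul' ℂ A ((tmul 1 (incl b)).right u) = LinearMap.mul' ℂ A u * b := by
  induction u with
  | zero => simp
  | add u v hu hv => simp only [map_add, add_mul, hu, hv]
  | tmul p q => simp [mul_assoc]

/-- The target map `ε_t(a) = ∑ a₍₁₎S(a₍₂₎)` in `M(A)`: the products `ε_t(a)b` and `cε_t(a)` are
obtained by multiplying the two factors of `R₁(a ⊗ b)` and of `(ι ⊗ S)((c ⊗ 1)Δ(a))`. -/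
noncomputable def targetMap (H : RegularWeakMultiplierHopfAlgebra A) :
    A →ₗ[ℂ] MultiplierAlgebra A where
  toFun a := MultiplierAlgebra.ofPair
    (LinearMap.mul' ℂ A ∘ₗ H.R₁ ∘ₗ TensorProduct.mk ℂ A A a)
    (LinearMap.mul' ℂ A ∘ₗ TensorProduct.map LinearMap.id H.S.toLinearMap ∘ₗ H.T₂ ∘ₗ
      (TensorProduct.mk ℂ A A).flip a)
    (fun c b => by
      have h := congrArg (LinearMap.mul' ℂ A) (H.R₁_spec a b c)
      rw [mul'_left_tmul, mul'_right_tmul] at h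
      simpa using h)
  map_add' a b := by
    ext x
    · simp only [left_ofPair, left_add, LinearMap.comp_apply, map_add, LinearMap.add_apply,
        LinearMap.flip_apply]
    · simp only [right_ofPair, right_add, LinearMap.comp_apply, map_add, LinearMap.add_apply,
        LinearMap.flip_apply]
  map_smul' c a := by
    ext x
    · simp only [left_ofPair, left_smul, LinearMap.comp_apply, map_smul, LinearMap.smul_apply,
        LinearMap.flip_apply, RingHom.id_apply]
    · simp only [right_ofPair, right_smul, LinearMap.comp_apply, map_smul, LinearMap.smul_apply,
        LinearMap.flip_apply, RingHom.id_apply]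

/-- The source map `ε_s(a) = ∑ S(a₍₁₎)a₍₂₎` in `M(A)`: the products `ε_s(a)c` and `bε_s(a)` are
obtained by multiplying the two factors of `(S ⊗ ι)(Δ(a)(1 ⊗ c))` and of `R₂(b ⊗ a)`. -/
noncomputable def sourceMap (H : RegularWeakMultiplierHopfAlgebra A) :
    A →ₗ[ℂ] MultiplierAlgebra A where
  toFun a := MultiplierAlgebra.ofPair
    (LinearMap.mul' ℂ A ∘ₗ TensorProduct.map H.S.toLinearMap LinearMap.id ∘ₗ H.T₁ ∘ₗ
      TensorProduct.mk ℂ A A a)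
    (LinearMap.mul' ℂ A ∘ₗ H.R₂ ∘ₗ (TensorProduct.mk ℂ A A).flip a)
    (fun b c => by
      have h := congrArg (LinearMap.mul' ℂ A) (H.R₂_spec a b c)
      rw [mul'_left_tmul, mul'_right_tmul] at h
      simpa using h.symm)
  map_add' a b := by
    ext x
    · simp only [left_ofPair, left_add, LinearMap.comp_apply, map_add, LinearMap.add_apply,
        LinearMap.flip_apply]
    · simp only [right_ofPair, right_add, LinearMap.comp_apply, map_add, LinearMap.add_apply,
        LinearMap.flip_apply]
  map_smul' c a := by
    ext x
    · simp only [left_ofPair, left_smul, LinearMap.comp_apply, map_smul, LinearMap.smul_apply,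
        LinearMap.flip_apply, RingHom.id_apply]
    · simp only [right_ofPair, right_smul, LinearMap.comp_apply, map_smul, LinearMap.smul_apply,
        LinearMap.flip_apply, RingHom.id_apply]

/-- The target algebra `ε_t(A)`, a subspace of `M(A)`. -/
noncomputable def targetAlgebra (H : RegularWeakMultiplierHopfAlgebra A) :
    Submodule ℂ (MultiplierAlgebra A) := LinearMap.range H.targetMap

/-- The source algebra `ε_s(A)`, a subspace of `M(A)`. -/
noncomputable def sourceAlgebra (H : RegularWeakMultiplierHopfAlgebra A) :
    Submodule ℂ (MultiplierAlgebra A) := LinearMap.range H.sourceMap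

/-- `A_t`, the multiplier algebra of `ε_t(A)` inside `M(A)`. -/
def targetMultipliers (H : RegularWeakMultiplierHopfAlgebra A) : Set (MultiplierAlgebra A) :=
  {x | ∀ y ∈ H.targetAlgebra, x * y ∈ H.targetAlgebra ∧ y * x ∈ H.targetAlgebra}

/-- `A_s`, the multiplier algebra of `ε_s(A)` inside `M(A)`. -/
def sourceMultipliers (H : RegularWeakMultiplierHopfAlgebra A) : Set (MultiplierAlgebra A) :=
  {x | ∀ y ∈ H.sourceAlgebra, x * y ∈ H.sourceAlgebra ∧ y * x ∈ H.sourceAlgebra}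

/-- A left integral: a non-zero linear functional `φ` such that `(ι ⊗ φ)Δ(a) ∈ A_t` for all
`a`. -/
def IsLeftIntegral (H : RegularWeakMultiplierHopfAlgebra A) (φ : A →ₗ[ℂ] ℂ) : Prop :=
  φ ≠ 0 ∧ ∀ a, ∃ x ∈ H.targetMultipliers, IsSliceSnd φ (H.Δ a) x

/-- A right integral: a non-zero linear functional `ψ` such that `(ψ ⊗ ι)Δ(a) ∈ A_s` for all
`a`. -/
def IsRightIntegral (H : RegularWeakMultiplierHopfAlgebra A) (ψ : A →ₗ[ℂ] ℂ) : Prop :=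
  ψ ≠ 0 ∧ ∀ a, ∃ x ∈ H.sourceMultipliers, IsSliceFst ψ (H.Δ a) x

/-- Both `{(φ ⊗ ι)((a ⊗ 1)E) | a ∈ A}` and `{(φ ⊗ ι)(E(a ⊗ 1)) | a ∈ A}` are equal to
`ε_t(A)`. -/
def SlicesFillTarget (H : RegularWeakMultiplierHopfAlgebra A) (φ : A →ₗ[ℂ] ℂ) : Prop :=
  {x | ∃ a : A, IsSliceFst φ (tmul (incl a) 1 * H.E) x} = (H.targetAlgebra : Set _) ∧
  {x | ∃ a : A, IsSliceFst φ (H.E * tmul (incl a) 1) x} = (H.targetAlgebra : Set _)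

/-- Both `{(ι ⊗ ψ)((1 ⊗ a)E) | a ∈ A}` and `{(ι ⊗ ψ)(E(1 ⊗ a)) | a ∈ A}` are equal to
`ε_s(A)`. -/
def SlicesFillSource (H : RegularWeakMultiplierHopfAlgebra A) (ψ : A →ₗ[ℂ] ℂ) : Prop :=
  {x | ∃ a : A, IsSliceSnd ψ (tmul 1 (incl a) * H.E) x} = (H.sourceAlgebra : Set _) ∧
  {x | ∃ a : A, IsSliceSnd ψ (H.E * tmul 1 (incl a)) x} = (H.sourceAlgebra : Set _)

/-- Timmermann's form of left invariance: `(ι ⊗ φ)Δ(a) = (ι ⊗ φ)(F₂(1 ⊗ a))` for all `a`, with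
`F₂ = (S ⊗ ι)E`.  Both sides are multiplied from the left with `S(d)`, where
`(S(d) ⊗ 1)F₂(1 ⊗ a) = (S ⊗ ι)(E(d ⊗ a))` since `S` reverses products. -/
def IsTimmermannLeftIntegral (H : RegularWeakMultiplierHopfAlgebra A) (φ : A →ₗ[ℂ] ℂ) : Prop :=
  φ ≠ 0 ∧ ∀ a d : A, sliceSnd φ (H.T₂ (H.S d ⊗ₜ a)) =
    sliceSnd φ (TensorProduct.map H.S.toLinearMap LinearMap.id (H.E.left (d ⊗ₜ a)))

/-- Timmermann's form of right invariance: `(ψ ⊗ ι)Δ(a) = (ψ ⊗ ι)((a ⊗ 1)F₁)` for all `a`, with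
`F₁ = (ι ⊗ S)E`.  Both sides are multiplied from the right with `S(d)`, where
`(a ⊗ 1)F₁(1 ⊗ S(d)) = (ι ⊗ S)((a ⊗ d)E)` since `S` reverses products. -/
def IsTimmermannRightIntegral (H : RegularWeakMultiplierHopfAlgebra A) (ψ : A →ₗ[ℂ] ℂ) : Prop :=
  ψ ≠ 0 ∧ ∀ a d : A, sliceFst ψ (H.T₁ (a ⊗ₜ H.S d)) =
    sliceFst ψ (TensorProduct.map LinearMap.id H.S.toLinearMap (H.E.right (a ⊗ₜ d)))

end RegularWeakMultiplierHopfAlgebra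

end WeakMultiplierHopf

/-! Everything rests on Sweedler formulas for E. By `tmul_mul_E` and `E_mul_tmul_one`, (ea ⊗ 1)E = ∑
ea₍₁₎ ⊗ ε_t(S⁻¹(a₍₂₎)) and E(ae ⊗ 1) = ∑ a₍₁₎e ⊗ ε_t(a₍₂₎), so all slices in (L) exist and lie in
ε_t(A). If φ is faithful, the functionals φ(k ·), and likewise φ(· k), separate points, hence on any
one tensor they realise every functional (`exists_evalFst_eq`). Since Δ is full, the second legs
obtained in this way span A, and the slices fill ε_t(A).

Conversely, let φ be a left integral with (L) and let φ(bn) = 0 for all b. Left invariance makes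
this condition pass to all second legs of Δ(n) (`mul_leftSlice_eq_zero`), so φ(qε_s(n)) = ∑
φ(qS(n₍₁₎)n₍₂₎) = 0. As (ι ⊗ ε)((q ⊗ n)E) = qε_s(n), this number is ε(nx) for x = (φ ⊗ ι)((q ⊗ 1)E),
and by (L) such x exhaust ε_t(A). Hence ε(nε_t(b)) = 0, also with n replaced by any second leg of
Δ(n). The rule E(y ⊗ 1) = E(1 ⊗ S(y)) for y in ε_s(A) converts this into nε_s(b) = 0 for all b,
which forces n = 0. The condition φ(nb) = 0 is treated in mirrored form.

Left integrals and Timmermann's left integrals coincide: (ι ⊗ φ)Δ(a) and (ι ⊗ φ)(F₂(1 ⊗ a)) both lie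
in ε_t(A), where x is determined by the numbers ε(bx), and these numbers agree. The statements about
right integrals follow by composing functionals with S, because the flip of S ⊗ S fixes E and
carries Δ to Δ ∘ S, while S exchanges ε_s and ε_t (`flipSM_E`, `Δ_S`, `SM_targetMap`,
`SM_sourceMap`).

Deriving these properties of S from the axioms is the bulk of the work. The method is uniform: by
fullness, linear maps on A agree once they agree on the slices (f ⊗ ι)((c ⊗ 1)Δ(a)), and the slice
map applied to the first leg commutes with T₁, E, G₁ and therefore R₁. -/

section Evaluation

-- Slices of tensors by functionals

universe u

variable {V W V' W' : Type*} [AddCommGroup V] [Module ℂ V] [AddCommGroup W] [Module ℂ W]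
  [AddCommGroup V'] [Module ℂ V'] [AddCommGroup W'] [Module ℂ W']

/-- Evaluation `ω ⊗ ι : V ⊗ W → W` of a functional on the first tensor factor. -/
noncomputable def evalFst (ω : V →ₗ[ℂ] ℂ) : V ⊗[ℂ] W →ₗ[ℂ] W :=
  (TensorProduct.lid ℂ W).toLinearMap ∘ₗ TensorProduct.map ω LinearMap.id

/-- Evaluation `ι ⊗ ω : V ⊗ W → V` of a functional on the second tensor factor. -/
noncomputable def evalSnd (ω : W →ₗ[ℂ] ℂ) : V ⊗[ℂ] W →ₗ[ℂ] V :=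
  (TensorProduct.rid ℂ V).toLinearMap ∘ₗ TensorProduct.map LinearMap.id ω

@[simp] theorem evalFst_tmul (ω : V →ₗ[ℂ] ℂ) (v : V) (w : W) : evalFst ω (v ⊗ₜ w) = ω v • w := by
  simp [evalFst]

@[simp] theorem evalSnd_tmul (ω : W →ₗ[ℂ] ℂ) (v : V) (w : W) : evalSnd ω (v ⊗ₜ w) = ω w • v := by
  simp [evalSnd]

/-- Two linear maps on `V ⊗ W` agree at `u` if they agree on pure tensors. -/
theorem tensor_hom_congr {X : Type*} [AddCommGroup X] [Module ℂ X] (f g : V ⊗[ℂ] W →ₗ[ℂ] X)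
    (h : ∀ v w, f (v ⊗ₜ w) = g (v ⊗ₜ w)) (u : V ⊗[ℂ] W) : f u = g u := by
  rw [TensorProduct.ext' h]

theorem evalFst_map (ω : V' →ₗ[ℂ] ℂ) (g : V →ₗ[ℂ] V') (h : W →ₗ[ℂ] W') (u : V ⊗[ℂ] W) :
    evalFst ω (TensorProduct.map g h u) = h (evalFst (ω ∘ₗ g) u) :=
  tensor_hom_congr (evalFst ω ∘ₗ TensorProduct.map g h) (h ∘ₗ evalFst (ω ∘ₗ g))
    (fun v w => by simp) u

theorem evalSnd_map (ω : W' →ₗ[ℂ] ℂ) (g : V →ₗ[ℂ] V') (h : W →ₗ[ℂ] W') (u : V ⊗[ℂ] W) :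
    evalSnd ω (TensorProduct.map g h u) = g (evalSnd (ω ∘ₗ h) u) :=
  tensor_hom_congr (evalSnd ω ∘ₗ TensorProduct.map g h) (g ∘ₗ evalSnd (ω ∘ₗ h))
    (fun v w => by simp) u

theorem eval_comm (f : V →ₗ[ℂ] ℂ) (g : W →ₗ[ℂ] ℂ) (u : V ⊗[ℂ] W) :
    g (evalFst f u) = f (evalSnd g u) :=
  tensor_hom_congr (g ∘ₗ evalFst f) (f ∘ₗ evalSnd g) (fun v w => by simp [mul_comm]) u

/-- The coordinate functionals of a basis of `V` already separate tensors. -/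
theorem evalFst_ext {u v : V ⊗[ℂ] W} (h : ∀ ω : V →ₗ[ℂ] ℂ, evalFst ω u = evalFst ω v) :
    u = v := by
  classical
  apply (TensorProduct.equivFinsuppOfBasisLeft (Module.Basis.ofVectorSpace ℂ V)).injective
  ext i
  rw [TensorProduct.equivFinsuppOfBasisLeft_apply, TensorProduct.equivFinsuppOfBasisLeft_apply]
  exact h _

theorem evalSnd_ext {u v : V ⊗[ℂ] W} (h : ∀ ω : W →ₗ[ℂ] ℂ, evalSnd ω u = evalSnd ω v) :
    u = v := by
  apply evalFst_ext
  intro f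
  rw [← sub_eq_zero, ← Module.forall_dual_apply_eq_zero_iff ℂ]
  intro g
  rw [map_sub, eval_comm, eval_comm, h g, sub_self]

/-- A tensor is a finite sum of pure tensors in which the second components are evaluations. -/
theorem exists_eq_sum_evalFst {V : Type u} [AddCommGroup V] [Module ℂ V] (u : V ⊗[ℂ] W) :
    ∃ (ι : Type u) (s : Finset ι) (e : ι → V) (f : ι → (V →ₗ[ℂ] ℂ)),
      u = ∑ i ∈ s, e i ⊗ₜ evalFst (f i) u := by
  classical
  let b := Module.Basis.ofVectorSpace ℂ V
  refine ⟨_, ((TensorProduct.equivFinsuppOfBasisLeft b) u).support, b, b.coord, ?_⟩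
  have h := (TensorProduct.equivFinsuppOfBasisLeft b (N := W)).symm_apply_apply u
  rw [TensorProduct.equivFinsuppOfBasisLeft_symm_apply] at h
  conv_lhs => rw [← h]
  refine Finset.sum_congr rfl fun i _ => ?_
  rw [TensorProduct.equivFinsuppOfBasisLeft_apply]
  rfl

theorem exists_eq_sum_evalSnd {W : Type u} [AddCommGroup W] [Module ℂ W] (u : V ⊗[ℂ] W) :
    ∃ (ι : Type u) (s : Finset ι) (e : ι → W) (f : ι → (W →ₗ[ℂ] ℂ)),
      u = ∑ i ∈ s, evalSnd (f i) u ⊗ₜ e i := by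
  obtain ⟨ι, s, e, f, h⟩ := exists_eq_sum_evalFst (TensorProduct.comm ℂ V W u)
  refine ⟨ι, s, e, f, ?_⟩
  have key : ∀ ω : W →ₗ[ℂ] ℂ, evalFst ω (TensorProduct.comm ℂ V W u) = evalSnd ω u := fun ω =>
    tensor_hom_congr (evalFst ω ∘ₗ (TensorProduct.comm ℂ V W).toLinearMap) (evalSnd ω)
      (fun v w => by simp) u
  apply (TensorProduct.comm ℂ V W).injective
  rw [h]
  simp [map_sum, key]

/-- This is how the fullness axioms are met: it suffices to look at slices, not at a representation
of the tensor. -/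
theorem mem_range_map_subtype_of_evalFst (P : Submodule ℂ W) (u : V ⊗[ℂ] W)
    (h : ∀ ω : V →ₗ[ℂ] ℂ, evalFst ω u ∈ P) :
    u ∈ LinearMap.range (TensorProduct.map LinearMap.id P.subtype :
      V ⊗[ℂ] P →ₗ[ℂ] V ⊗[ℂ] W) := by
  obtain ⟨ι, s, e, f, hu⟩ := exists_eq_sum_evalFst u
  refine ⟨∑ i ∈ s, e i ⊗ₜ ⟨evalFst (f i) u, h _⟩, ?_⟩
  conv_rhs => rw [hu]
  simp [map_sum]

theorem mem_range_map_subtype_of_evalSnd (P : Submodule ℂ V) (u : V ⊗[ℂ] W)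
    (h : ∀ ω : W →ₗ[ℂ] ℂ, evalSnd ω u ∈ P) :
    u ∈ LinearMap.range (TensorProduct.map P.subtype LinearMap.id :
      P ⊗[ℂ] W →ₗ[ℂ] V ⊗[ℂ] W) := by
  obtain ⟨ι, s, e, f, hu⟩ := exists_eq_sum_evalSnd u
  refine ⟨∑ i ∈ s, ⟨evalSnd (f i) u, h _⟩ ⊗ₜ e i, ?_⟩
  conv_rhs => rw [hu]
  simp [map_sum]

/-- If a bilinear form `β` vanishes on `V × ` (all evaluations of `u`), then `β u = 0`. -/
theorem bilin_eq_zero_of_evalFst (β : V ⊗[ℂ] W →ₗ[ℂ] ℂ) (u : V ⊗[ℂ] W)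
    (h : ∀ (v : V) (ω : V →ₗ[ℂ] ℂ), β (v ⊗ₜ evalFst ω u) = 0) : β u = 0 := by
  obtain ⟨ι, s, e, f, hu⟩ := exists_eq_sum_evalFst u
  rw [hu, map_sum]
  exact Finset.sum_eq_zero fun i _ => h _ _

end Evaluation

/-! ### Non-degenerate products and their multipliers -/

section Nondegenerate

/-- The product of `X` is non-degenerate. -/
structure NondegenerateProduct (X : Type*) [NonUnitalRing X] : Prop where
  left : ∀ a : X, (∀ b, a * b = 0) → a = 0
  right : ∀ a : X, (∀ b, b * a = 0) → a = 0

variable {X : Type*} [NonUnitalRing X]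

theorem NondegenerateProduct.left_ext (hX : NondegenerateProduct X) {a a' : X}
    (h : ∀ b, a * b = a' * b) : a = a' :=
  sub_eq_zero.1 (hX.left _ fun b => by rw [sub_mul, h, sub_self])

theorem NondegenerateProduct.right_ext (hX : NondegenerateProduct X) {a a' : X}
    (h : ∀ b, b * a = b * a') : a = a' :=
  sub_eq_zero.1 (hX.right _ fun b => by rw [mul_sub, h, sub_self])

variable [Module ℂ X] [IsScalarTower ℂ X X] [SMulCommClass ℂ X X]
variable {Y : Type*} [NonUnitalRing Y] [Module ℂ Y] [IsScalarTower ℂ Y Y] [SMulCommClass ℂ Y Y]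

theorem evalFst_mul_tmul (ω : X →ₗ[ℂ] ℂ) (u : X ⊗[ℂ] Y) (b : X) (c : Y) :
    evalFst ω (u * b ⊗ₜ c) = evalFst (ω ∘ₗ LinearMap.mulRight ℂ b) u * c :=
  tensor_hom_congr (evalFst ω ∘ₗ LinearMap.mulRight ℂ (b ⊗ₜ c))
    (LinearMap.mulRight ℂ c ∘ₗ evalFst (ω ∘ₗ LinearMap.mulRight ℂ b))
    (fun v w => by simp [smul_mul_assoc]) u

theorem evalFst_tmul_mul (ω : X →ₗ[ℂ] ℂ) (u : X ⊗[ℂ] Y) (b : X) (c : Y) :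
    evalFst ω (b ⊗ₜ c * u) = c * evalFst (ω ∘ₗ LinearMap.mulLeft ℂ b) u :=
  tensor_hom_congr (evalFst ω ∘ₗ LinearMap.mulLeft ℂ (b ⊗ₜ c))
    (LinearMap.mulLeft ℂ c ∘ₗ evalFst (ω ∘ₗ LinearMap.mulLeft ℂ b))
    (fun v w => by simp [mul_smul_comm]) u

/-- Tensors are separated by the evaluations of their products with elements of the first
factor. -/
theorem evalFst_mulLeft_ext (hX : NondegenerateProduct X) {W : Type*} [AddCommGroup W] [Module ℂ W]
    {u v : X ⊗[ℂ] W} (h : ∀ (f : X →ₗ[ℂ] ℂ) (c : X), evalFst (f ∘ₗ LinearMap.mulLeft ℂ c) u =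
      evalFst (f ∘ₗ LinearMap.mulLeft ℂ c) v) : u = v := by
  apply evalSnd_ext
  intro g
  refine hX.right_ext fun c => ?_
  rw [← sub_eq_zero, ← Module.forall_dual_apply_eq_zero_iff ℂ]
  intro f
  have := congrArg g (h f c)
  rw [eval_comm, eval_comm] at this
  simpa [sub_eq_zero] using this

theorem evalFst_mulRight_ext (hX : NondegenerateProduct X) {W : Type*} [AddCommGroup W]
    [Module ℂ W] {u v : X ⊗[ℂ] W} (h : ∀ (f : X →ₗ[ℂ] ℂ) (c : X),
      evalFst (f ∘ₗ LinearMap.mulRight ℂ c) u = evalFst (f ∘ₗ LinearMap.mulRight ℂ c) v) :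
    u = v := by
  apply evalSnd_ext
  intro g
  refine hX.left_ext fun c => ?_
  rw [← sub_eq_zero, ← Module.forall_dual_apply_eq_zero_iff ℂ]
  intro f
  have := congrArg g (h f c)
  rw [eval_comm, eval_comm] at this
  simpa [sub_eq_zero] using this

theorem NondegenerateProduct.tensor (hX : NondegenerateProduct X) (hY : NondegenerateProduct Y) :
    NondegenerateProduct (X ⊗[ℂ] Y) where
  left u hu := by
    apply evalFst_mulRight_ext hX
    intro f b
    refine hY.left_ext fun c => ?_
    rw [← evalFst_mul_tmul, hu]
    simp
  right u hu := by
    apply evalFst_mulLeft_ext hX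
    intro f b
    refine hY.right_ext fun c => ?_
    rw [← evalFst_tmul_mul, hu]
    simp

namespace MultiplierAlgebra

theorem incl_injective (hX : NondegenerateProduct X) :
    Function.Injective (incl : X →ₗ[ℂ] MultiplierAlgebra X) := by
  intro a b h
  refine hX.left_ext fun c => ?_
  have := congrArg (fun m => left m c) h
  simpa using this

theorem incl_mul (a b : X) : (incl (a * b) : MultiplierAlgebra X) = incl a * incl b := by
  ext x <;> simp [mul_assoc]

theorem left_mul_right (hX : NondegenerateProduct X) (m : MultiplierAlgebra X) (a b : X) :
    m.left (a * b) = m.left a * b :=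
  hX.right_ext fun c => by rw [m.compat, ← mul_assoc, ← mul_assoc, m.compat]

theorem right_mul_left (hX : NondegenerateProduct X) (m : MultiplierAlgebra X) (a b : X) :
    m.right (a * b) = a * m.right b :=
  hX.left_ext fun c => by rw [← m.compat, mul_assoc, mul_assoc, m.compat]

theorem incl_left (hX : NondegenerateProduct X) (m : MultiplierAlgebra X) (a : X) :
    incl (m.left a) = m * incl a := by
  ext x
  · simp [left_mul_right hX]
  · simp [compat]

theorem incl_right (hX : NondegenerateProduct X) (m : MultiplierAlgebra X) (a : X) :
    incl (m.right a) = incl a * m := by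
  ext x
  · simp [compat]
  · simp [right_mul_left hX]

theorem left_right (hX : NondegenerateProduct X) (m n : MultiplierAlgebra X) (a : X) :
    m.left (n.right a) = n.right (m.left a) := by
  apply incl_injective hX
  simp only [incl_left hX, incl_right hX, mul_assoc]

theorem ext_left (hX : NondegenerateProduct X) {m n : MultiplierAlgebra X}
    (h : ∀ b, m.left b = n.left b) : m = n :=
  ext h fun a => hX.left_ext fun b => by rw [← m.compat, h, n.compat]

theorem ext_right (hX : NondegenerateProduct X) {m n : MultiplierAlgebra X}
    (h : ∀ b, m.right b = n.right b) : m = n :=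
  ext (fun a => hX.right_ext fun b => by rw [m.compat, h, n.compat]) h

@[simp] theorem left_zero : (0 : MultiplierAlgebra X).left = 0 := rfl
@[simp] theorem right_zero : (0 : MultiplierAlgebra X).right = 0 := rfl
theorem left_one_eq : (1 : MultiplierAlgebra X).left = LinearMap.id := rfl
theorem right_one_eq : (1 : MultiplierAlgebra X).right = LinearMap.id := rfl
theorem left_incl_eq (a : X) : (incl a).left = LinearMap.mulLeft ℂ a := rfl
theorem tmul_mul (m m' : MultiplierAlgebra X) (n n' : MultiplierAlgebra Y) :
    tmul (m * m') (n * n') = tmul m n * tmul m' n' := by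
  ext x
  · exact tensor_hom_congr (tmul (m * m') (n * n')).left (tmul m n * tmul m' n').left
      (fun _ _ => by simp) x
  · exact tensor_hom_congr (tmul (m * m') (n * n')).right (tmul m n * tmul m' n').right
      (fun _ _ => by simp) x

theorem tmul_incl (a : X) (b : Y) : tmul (incl a) (incl b) = incl (a ⊗ₜ[ℂ] b) := by
  ext x
  · exact tensor_hom_congr (tmul (incl a) (incl b)).left (incl (a ⊗ₜ[ℂ] b)).left
      (fun _ _ => by simp) x
  · exact tensor_hom_congr (tmul (incl a) (incl b)).right (incl (a ⊗ₜ[ℂ] b)).right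
      (fun _ _ => by simp) x

theorem evalFst_left (ω : X →ₗ[ℂ] ℂ) (m : MultiplierAlgebra X) (n : MultiplierAlgebra Y)
    (u : X ⊗[ℂ] Y) : evalFst ω ((tmul m n).left u) = n.left (evalFst (ω ∘ₗ m.left) u) :=
  evalFst_map _ _ _ _

theorem evalFst_right (ω : X →ₗ[ℂ] ℂ) (m : MultiplierAlgebra X) (n : MultiplierAlgebra Y)
    (u : X ⊗[ℂ] Y) : evalFst ω ((tmul m n).right u) = n.right (evalFst (ω ∘ₗ m.right) u) :=
  evalFst_map _ _ _ _

theorem evalSnd_left (ω : Y →ₗ[ℂ] ℂ) (m : MultiplierAlgebra X) (n : MultiplierAlgebra Y)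
    (u : X ⊗[ℂ] Y) : evalSnd ω ((tmul m n).left u) = m.left (evalSnd (ω ∘ₗ n.left) u) :=
  evalSnd_map _ _ _ _

theorem evalSnd_right (ω : Y →ₗ[ℂ] ℂ) (m : MultiplierAlgebra X) (n : MultiplierAlgebra Y)
    (u : X ⊗[ℂ] Y) : evalSnd ω ((tmul m n).right u) = m.right (evalSnd (ω ∘ₗ n.right) u) :=
  evalSnd_map _ _ _ _

end MultiplierAlgebra

end Nondegenerate

section

variable {X : Type*} [NonUnitalRing X] [Module ℂ X] [IsScalarTower ℂ X X] [SMulCommClass ℂ X X]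
theorem MultiplierAlgebra.reassoc_mul
    (m n : MultiplierAlgebra (X ⊗[ℂ] (X ⊗[ℂ] X))) : reassoc (m * n) = reassoc m * reassoc n := by
  ext x <;> simp [reassoc, comap]

theorem MultiplierAlgebra.reassoc_left (m : MultiplierAlgebra (X ⊗[ℂ] (X ⊗[ℂ] X)))
    (x : (X ⊗[ℂ] X) ⊗[ℂ] X) : (reassoc m).left x =
      (TensorProduct.assoc ℂ X X X).symm (m.left (TensorProduct.assoc ℂ X X X x)) := rfl

theorem MultiplierAlgebra.reassoc_right (m : MultiplierAlgebra (X ⊗[ℂ] (X ⊗[ℂ] X)))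
    (x : (X ⊗[ℂ] X) ⊗[ℂ] X) : (reassoc m).right x =
      (TensorProduct.assoc ℂ X X X).symm (m.right (TensorProduct.assoc ℂ X X X x)) := rfl

end

/-! ### Slices of the coproduct and the maps that commute with them -/

namespace WeakMultiplierHopfAlgebra

variable {A : Type*} [NonUnitalRing A] [Module ℂ A] [IsScalarTower ℂ A A] [SMulCommClass ℂ A A]
variable (H : WeakMultiplierHopfAlgebra A)

include H in
theorem nondegenerate : NondegenerateProduct A := ⟨H.nondegenerate_left, H.nondegenerate_right⟩

include H in
theorem nondegenerate₂ : NondegenerateProduct (A ⊗[ℂ] A) := H.nondegenerate.tensor H.nondegenerate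

/-- The slice map `a ↦ (f ⊗ ι)((c ⊗ 1)Δ(a))`. -/
noncomputable def leftSlice (f : A →ₗ[ℂ] ℂ) (c : A) : A →ₗ[ℂ] A :=
  evalFst f ∘ₗ H.T₂ ∘ₗ TensorProduct.mk ℂ A A c

/-- The slice map `a ↦ (ι ⊗ g)(Δ(a)(1 ⊗ b))`. -/
noncomputable def rightSlice (g : A →ₗ[ℂ] ℂ) (b : A) : A →ₗ[ℂ] A :=
  evalSnd g ∘ₗ H.T₁ ∘ₗ (TensorProduct.mk ℂ A A).flip b

theorem leftSlice_apply (f : A →ₗ[ℂ] ℂ) (c a : A) :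
    H.leftSlice f c a = evalFst f (H.T₂ (c ⊗ₜ a)) := rfl

theorem rightSlice_apply (g : A →ₗ[ℂ] ℂ) (b a : A) :
    H.rightSlice g b a = evalSnd g (H.T₁ (a ⊗ₜ b)) := rfl

-- The equalizer of the two maps is a subspace containing every second leg of Δ, hence all of `A` by
-- fullness.
variable {H} in
theorem leftSlice_hom_ext {X : Type*} [AddCommGroup X] [Module ℂ X] {L₁ L₂ : A →ₗ[ℂ] X}
    (h : ∀ f c a, L₁ (H.leftSlice f c a) = L₂ (H.leftSlice f c a)) : L₁ = L₂ := by
  have := H.full_right (LinearMap.eqLocus L₁ L₂) fun c a =>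
    mem_range_map_subtype_of_evalFst _ _ fun ω => h ω c a
  ext a
  exact (this ▸ Submodule.mem_top : a ∈ LinearMap.eqLocus L₁ L₂)

variable {H} in
theorem rightSlice_hom_ext {X : Type*} [AddCommGroup X] [Module ℂ X] {L₁ L₂ : A →ₗ[ℂ] X}
    (h : ∀ g b a, L₁ (H.rightSlice g b a) = L₂ (H.rightSlice g b a)) : L₁ = L₂ := by
  have := H.full_left (LinearMap.eqLocus L₁ L₂) fun a b =>
    mem_range_map_subtype_of_evalSnd _ _ fun ω => h ω b a
  ext a
  exact (this ▸ Submodule.mem_top : a ∈ LinearMap.eqLocus L₁ L₂)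

theorem T₂_right (a b c : A) : (tmul 1 (incl b)).right (H.T₂ (c ⊗ₜ a)) =
    (tmul (incl c) 1).left (H.T₁ (a ⊗ₜ b)) := by
  apply incl_injective H.nondegenerate₂
  rw [incl_right H.nondegenerate₂, incl_left H.nondegenerate₂, T₁_spec, T₂_spec, mul_assoc]

theorem Δ_left_tmul (a b c : A) :
    (H.Δ a).left (b ⊗ₜ c) = (tmul (incl b) 1).right (H.T₁ (a ⊗ₜ c)) := by
  apply incl_injective H.nondegenerate₂
  rw [incl_right H.nondegenerate₂, incl_left H.nondegenerate₂, T₁_spec, mul_assoc, ← tmul_mul,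
    one_mul, mul_one, tmul_incl]

theorem Δ_right_tmul (a c d : A) :
    (H.Δ a).right (c ⊗ₜ d) = (tmul 1 (incl d)).left (H.T₂ (c ⊗ₜ a)) := by
  apply incl_injective H.nondegenerate₂
  rw [incl_right H.nondegenerate₂, incl_left H.nondegenerate₂, T₂_spec, ← mul_assoc, ← tmul_mul,
    one_mul, mul_one, tmul_incl]

theorem evalFst_T₁ (f : A →ₗ[ℂ] ℂ) (c a b : A) :
    evalFst (f ∘ₗ LinearMap.mulLeft ℂ c) (H.T₁ (a ⊗ₜ b)) = H.leftSlice f c a * b := by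
  have := congrArg (evalFst f) (H.T₂_right a b c)
  rw [evalFst_left, evalFst_right] at this
  exact this.symm

theorem evalSnd_T₂ (g : A →ₗ[ℂ] ℂ) (b a c : A) :
    evalSnd (g ∘ₗ LinearMap.mulRight ℂ b) (H.T₂ (c ⊗ₜ a)) = c * H.rightSlice g b a := by
  have := congrArg (evalSnd g) (H.T₂_right a b c)
  rw [evalSnd_left, evalSnd_right] at this
  exact this

theorem eval_leftSlice (f g : A →ₗ[ℂ] ℂ) (a b c : A) :
    g (H.leftSlice f c a * b) = f (c * H.rightSlice g b a) := by
  rw [← evalFst_T₁, eval_comm]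
  rfl

/-- Coassociativity with the first of the three legs sliced off. -/
theorem T₁_map_leftSlice (f : A →ₗ[ℂ] ℂ) (c : A) (u : A ⊗[ℂ] A) :
    H.T₁ (TensorProduct.map (H.leftSlice f c) LinearMap.id u) =
      TensorProduct.map (H.leftSlice f c) LinearMap.id (H.T₁ u) := by
  have h1 : ∀ v, evalFst f (TensorProduct.assoc ℂ A A A
      (onLegs12 H.T₂ ((TensorProduct.assoc ℂ A A A).symm (c ⊗ₜ v)))) =
      TensorProduct.map (H.leftSlice f c) LinearMap.id v := fun v =>
    tensor_hom_congr (evalFst f ∘ₗ (TensorProduct.assoc ℂ A A A).toLinearMap ∘ₗ onLegs12 H.T₂ ∘ₗ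
      (TensorProduct.assoc ℂ A A A).symm.toLinearMap ∘ₗ TensorProduct.mk ℂ A (A ⊗[ℂ] A) c)
      (TensorProduct.map (H.leftSlice f c) LinearMap.id) (fun a b => by
        have h2 : ∀ (w : A ⊗[ℂ] A), evalFst f (TensorProduct.assoc ℂ A A A (w ⊗ₜ b)) =
            evalFst f w ⊗ₜ b := fun w =>
          tensor_hom_congr (evalFst f ∘ₗ (TensorProduct.assoc ℂ A A A).toLinearMap ∘ₗ
            (TensorProduct.mk ℂ (A ⊗[ℂ] A) A).flip b)
            ((TensorProduct.mk ℂ A A).flip b ∘ₗ evalFst f)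
            (fun x y => by simp [TensorProduct.smul_tmul']) w
        simp [onLegs12, h2, leftSlice_apply]) v
  have h3 : ∀ v, evalFst f (TensorProduct.assoc ℂ A A A (onLegs23 H.T₁ v)) =
      H.T₁ (evalFst f (TensorProduct.assoc ℂ A A A v)) := fun v => by
    simp only [onLegs23, LinearMap.comp_apply, LinearEquiv.coe_coe, LinearEquiv.apply_symm_apply]
    exact evalFst_map _ _ _ _
  have h4 : ∀ v, onLegs23 H.T₁ ((TensorProduct.assoc ℂ A A A).symm (c ⊗ₜ v)) =
      (TensorProduct.assoc ℂ A A A).symm (c ⊗ₜ H.T₁ v) := fun v => by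
    simp [onLegs23]
  have key := congrArg (fun w => evalFst f (TensorProduct.assoc ℂ A A A w))
    (LinearMap.congr_fun H.coassoc ((TensorProduct.assoc ℂ A A A).symm (c ⊗ₜ u)))
  simp only [LinearMap.comp_apply] at key
  rw [h4, h1, h3, h1] at key
  exact key.symm

theorem T₁_leftSlice (f : A →ₗ[ℂ] ℂ) (c a b : A) : H.T₁ (H.leftSlice f c a ⊗ₜ b) =
    TensorProduct.map (H.leftSlice f c) LinearMap.id (H.T₁ (a ⊗ₜ b)) := by
  rw [← T₁_map_leftSlice, TensorProduct.map_tmul, LinearMap.id_apply]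

theorem leftSlice_rightSlice (f g : A →ₗ[ℂ] ℂ) (a b c : A) :
    H.rightSlice g b (H.leftSlice f c a) = H.leftSlice f c (H.rightSlice g b a) := by
  rw [rightSlice_apply, T₁_leftSlice, evalSnd_map, LinearMap.comp_id]
  rfl

theorem E_left_E_left (u : A ⊗[ℂ] A) : H.E.left (H.E.left u) = H.E.left u := by
  rw [← left_mul, H.E_mul_E]

theorem E_right_E_right (u : A ⊗[ℂ] A) : H.E.right (H.E.right u) = H.E.right u := by
  rw [← right_mul, H.E_mul_E]

theorem E_left_T₁ (u : A ⊗[ℂ] A) : H.E.left (H.T₁ u) = H.T₁ u := by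
  have : H.T₁ u ∈ LinearMap.range H.E.left := H.range_T₁ ▸ LinearMap.mem_range_self _ u
  obtain ⟨w, hw⟩ := this
  rw [← hw, E_left_E_left]

theorem E_right_T₂ (u : A ⊗[ℂ] A) : H.E.right (H.T₂ u) = H.T₂ u := by
  have : H.T₂ u ∈ LinearMap.range H.E.right := H.range_T₂ ▸ LinearMap.mem_range_self _ u
  obtain ⟨w, hw⟩ := this
  rw [← hw, E_right_E_right]

/-- E is the identity on its range, which is the range of T₁; tested on b ⊗ c, Δ(a) acts through
T₁(a ⊗ c). -/
theorem E_mul_Δ (a : A) : H.E * H.Δ a = H.Δ a := by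
  apply ext_left H.nondegenerate₂
  intro u
  refine tensor_hom_congr (H.E * H.Δ a).left (H.Δ a).left (fun b c => ?_) u
  rw [left_mul, Δ_left_tmul, left_right H.nondegenerate₂, E_left_T₁]

theorem Δ_mul_E (a : A) : H.Δ a * H.E = H.Δ a := by
  apply ext_right H.nondegenerate₂
  intro u
  refine tensor_hom_congr (H.Δ a * H.E).right (H.Δ a).right (fun b c => ?_) u
  rw [right_mul, Δ_right_tmul, ← left_right H.nondegenerate₂, E_right_T₂]

theorem Δ_left_E_left (a : A) (u : A ⊗[ℂ] A) : (H.Δ a).left (H.E.left u) = (H.Δ a).left u := by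
  rw [← left_mul, Δ_mul_E]

theorem Δ_left_T₁ (a b c : A) : (H.Δ a).left (H.T₁ (b ⊗ₜ c)) = H.T₁ ((a * b) ⊗ₜ c) := by
  apply incl_injective H.nondegenerate₂
  rw [incl_left H.nondegenerate₂, T₁_spec, T₁_spec, map_mul, mul_assoc]

theorem Δ_right_T₂ (a b c : A) : (H.Δ a).right (H.T₂ (c ⊗ₜ b)) = H.T₂ (c ⊗ₜ (b * a)) := by
  apply incl_injective H.nondegenerate₂
  rw [incl_right H.nondegenerate₂, T₂_spec, T₂_spec, map_mul, mul_assoc]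

/-- Evaluating the first leg turns the axioms on (Δ ⊗ ι)E, which live in M(A ⊗ A ⊗ A), into
identities on A ⊗ A. -/
theorem evalFst_extendFst_right (f : A →ₗ[ℂ] ℂ) (c : A) (u v : A ⊗[ℂ] A) :
    evalFst f (TensorProduct.assoc ℂ A A A
      ((extendFst (H.Δ : A →ₗ[ℂ] MultiplierAlgebra (A ⊗[ℂ] A)) u).right
        ((TensorProduct.assoc ℂ A A A).symm (c ⊗ₜ v)))) =
      v * TensorProduct.map (H.leftSlice f c) LinearMap.id u := by
  induction u with
  | zero => simp
  | add x y hx hy => simp only [map_add, mul_add, right_add, LinearMap.add_apply, hx, hy]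
  | tmul a b =>
    induction v with
    | zero => simp
    | add x y hx hy => simp only [TensorProduct.tmul_add, map_add, add_mul, hx, hy]
    | tmul d e =>
      have h2 : ∀ (w : A ⊗[ℂ] A), evalFst f (TensorProduct.assoc ℂ A A A (w ⊗ₜ (e * b))) =
            evalFst f w ⊗ₜ (e * b) := fun w =>
          tensor_hom_congr (evalFst f ∘ₗ (TensorProduct.assoc ℂ A A A).toLinearMap ∘ₗ
            (TensorProduct.mk ℂ (A ⊗[ℂ] A) A).flip (e * b))
            ((TensorProduct.mk ℂ A A).flip (e * b) ∘ₗ evalFst f)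
            (fun x y => by simp [TensorProduct.smul_tmul']) w
      simp only [TensorProduct.assoc_symm_tmul, extendFst, TensorProduct.lift.tmul,
        LinearMap.compl₁₂_apply, right_tmul, TensorProduct.map_tmul, right_incl]
      rw [h2]
      change evalFst f ((H.Δ a).right (c ⊗ₜ d)) ⊗ₜ[ℂ] (e * b) = _
      rw [Δ_right_tmul, evalFst_left, Algebra.TensorProduct.tmul_mul_tmul]
      rfl

theorem evalSnd_extendSnd_left (g : A →ₗ[ℂ] ℂ) (z : A) (u w : A ⊗[ℂ] A) :
    evalSnd g ((extendSnd (H.Δ : A →ₗ[ℂ] MultiplierAlgebra (A ⊗[ℂ] A)) u).left (w ⊗ₜ z)) =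
      TensorProduct.map LinearMap.id (H.rightSlice g z) u * w := by
  induction u with
  | zero => simp
  | add x y hx hy => simp only [map_add, add_mul, left_add, LinearMap.add_apply, hx, hy]
  | tmul a b =>
    induction w with
    | zero => simp
    | add x y hx hy => simp only [TensorProduct.add_tmul, map_add, mul_add, hx, hy]
    | tmul x y =>
      have h2 : ∀ (w : A ⊗[ℂ] A), evalSnd g ((TensorProduct.assoc ℂ A A A).symm ((a * x) ⊗ₜ w)) =
            (a * x) ⊗ₜ evalSnd g w := fun w =>
          tensor_hom_congr (evalSnd g ∘ₗ (TensorProduct.assoc ℂ A A A).symm.toLinearMap ∘ₗ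
            TensorProduct.mk ℂ A (A ⊗[ℂ] A) (a * x))
            (TensorProduct.mk ℂ A A (a * x) ∘ₗ evalSnd g)
            (fun x y => by simp [TensorProduct.smul_tmul']) w
      simp only [extendSnd, LinearMap.comp_apply, TensorProduct.lift.tmul,
        LinearMap.compl₁₂_apply, reassoc_left, TensorProduct.assoc_tmul, left_tmul,
        TensorProduct.map_tmul, left_incl]
      rw [h2]
      change (a * x) ⊗ₜ[ℂ] evalSnd g ((H.Δ b).left (y ⊗ₜ z)) = _
      rw [Δ_left_tmul, evalSnd_right, Algebra.TensorProduct.tmul_mul_tmul]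
      rfl

theorem tmul_E_mul_extendFst (u : A ⊗[ℂ] A) :
    tmul H.E 1 * extendFst (H.Δ : A →ₗ[ℂ] MultiplierAlgebra (A ⊗[ℂ] A)) u =
      extendFst (H.Δ : A →ₗ[ℂ] MultiplierAlgebra (A ⊗[ℂ] A)) u := by
  induction u with
  | zero => simp
  | add x y hx hy => simp only [map_add, mul_add, hx, hy]
  | tmul a b =>
    change tmul H.E 1 * tmul (H.Δ a) (incl b) = tmul (H.Δ a) (incl b)
    rw [← tmul_mul, E_mul_Δ, one_mul]

theorem extendFst_mul_tmul_E (u : A ⊗[ℂ] A) :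
    extendFst (H.Δ : A →ₗ[ℂ] MultiplierAlgebra (A ⊗[ℂ] A)) u * tmul H.E 1 =
      extendFst (H.Δ : A →ₗ[ℂ] MultiplierAlgebra (A ⊗[ℂ] A)) u := by
  induction u with
  | zero => simp
  | add x y hx hy => simp only [map_add, add_mul, hx, hy]
  | tmul a b =>
    change tmul (H.Δ a) (incl b) * tmul H.E 1 = tmul (H.Δ a) (incl b)
    rw [← tmul_mul, Δ_mul_E, mul_one]

theorem reassoc_E_mul_extendSnd (u : A ⊗[ℂ] A) :
    reassoc (tmul 1 H.E) * extendSnd (H.Δ : A →ₗ[ℂ] MultiplierAlgebra (A ⊗[ℂ] A)) u =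
      extendSnd (H.Δ : A →ₗ[ℂ] MultiplierAlgebra (A ⊗[ℂ] A)) u := by
  induction u with
  | zero => simp
  | add x y hx hy => simp only [map_add, mul_add, hx, hy]
  | tmul a b =>
    change reassoc (tmul 1 H.E) * reassoc (tmul (incl a) (H.Δ b)) =
      reassoc (tmul (incl a) (H.Δ b))
    rw [← reassoc_mul, ← tmul_mul, E_mul_Δ, one_mul]

theorem extendSnd_mul_reassoc_E (u : A ⊗[ℂ] A) :
    extendSnd (H.Δ : A →ₗ[ℂ] MultiplierAlgebra (A ⊗[ℂ] A)) u * reassoc (tmul 1 H.E) =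
      extendSnd (H.Δ : A →ₗ[ℂ] MultiplierAlgebra (A ⊗[ℂ] A)) u := by
  induction u with
  | zero => simp
  | add x y hx hy => simp only [map_add, add_mul, hx, hy]
  | tmul a b =>
    change reassoc (tmul (incl a) (H.Δ b)) * reassoc (tmul 1 H.E) =
      reassoc (tmul (incl a) (H.Δ b))
    rw [← reassoc_mul, ← tmul_mul, Δ_mul_E, mul_one]

/-- (Δ ⊗ ι)(Eu) = (1 ⊗ E)(E ⊗ 1)(Δ ⊗ ι)(u), and E ⊗ 1 is absorbed because EΔ(a) = Δ(a). What remains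
is 1 ⊗ E, which is untouched by slicing the first leg. The three variants below use uE in place of
Eu, or ι ⊗ Δ in place of Δ ⊗ ι. -/
theorem E_left_map_leftSlice (f : A →ₗ[ℂ] ℂ) (c : A) (u : A ⊗[ℂ] A) :
    H.E.left (TensorProduct.map (H.leftSlice f c) LinearMap.id u) =
      TensorProduct.map (H.leftSlice f c) LinearMap.id (H.E.left u) := by
  refine H.nondegenerate₂.right_ext fun v => ?_
  have h := congrArg (fun m => evalFst f (TensorProduct.assoc ℂ A A A
    (m.right ((TensorProduct.assoc ℂ A A A).symm (c ⊗ₜ v))))) (H.extend_fst_E.1 u)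
  beta_reduce at h
  rw [H.E_comm, mul_assoc, tmul_E_mul_extendFst, right_mul, reassoc_right,
    LinearEquiv.apply_symm_apply, right_tmul, TensorProduct.map_tmul, right_one,
    evalFst_extendFst_right, evalFst_extendFst_right] at h
  rw [← h, compat]

theorem E_right_map_leftSlice (f : A →ₗ[ℂ] ℂ) (c : A) (u : A ⊗[ℂ] A) :
    H.E.right (TensorProduct.map (H.leftSlice f c) LinearMap.id u) =
      TensorProduct.map (H.leftSlice f c) LinearMap.id (H.E.right u) := by
  refine H.nondegenerate₂.right_ext fun v => ?_
  have h := congrArg (fun m => evalFst f (TensorProduct.assoc ℂ A A A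
    (m.right ((TensorProduct.assoc ℂ A A A).symm (c ⊗ₜ v))))) (H.extend_fst_E.2.1 u)
  beta_reduce at h
  rw [← mul_assoc, extendFst_mul_tmul_E, right_mul, reassoc_right,
    LinearEquiv.apply_symm_apply, evalFst_right, evalFst_extendFst_right, right_one_eq,
    LinearMap.comp_id, evalFst_extendFst_right] at h
  rw [← h, right_mul_left H.nondegenerate₂]

theorem E_left_map_rightSlice (g : A →ₗ[ℂ] ℂ) (z : A) (u : A ⊗[ℂ] A) :
    H.E.left (TensorProduct.map LinearMap.id (H.rightSlice g z) u) =
      TensorProduct.map LinearMap.id (H.rightSlice g z) (H.E.left u) := by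
  refine H.nondegenerate₂.left_ext fun w => ?_
  have h := congrArg (fun m => evalSnd g (m.left (w ⊗ₜ z))) (H.extend_snd_E.1 u)
  beta_reduce at h
  rw [mul_assoc, reassoc_E_mul_extendSnd, left_mul, evalSnd_left, left_one_eq,
    LinearMap.comp_id, evalSnd_extendSnd_left, evalSnd_extendSnd_left] at h
  rw [← h, left_mul_right H.nondegenerate₂]

theorem E_right_map_rightSlice (g : A →ₗ[ℂ] ℂ) (z : A) (u : A ⊗[ℂ] A) :
    H.E.right (TensorProduct.map LinearMap.id (H.rightSlice g z) u) =
      TensorProduct.map LinearMap.id (H.rightSlice g z) (H.E.right u) := by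
  refine H.nondegenerate₂.left_ext fun w => ?_
  have h := congrArg (fun m => evalSnd g (m.left (w ⊗ₜ z))) (H.extend_snd_E.2.1 u)
  beta_reduce at h
  rw [H.E_comm, ← mul_assoc, extendSnd_mul_reassoc_E, left_mul, left_tmul, TensorProduct.map_tmul,
    left_one, evalSnd_extendSnd_left, evalSnd_extendSnd_left] at h
  rw [← h, compat]

/-- The map `b ⊗ c ↦ (ι ⊗ h)(Δ(a)(1 ⊗ c)) ⊗ b`. -/
noncomputable def sliceTensor (h : A →ₗ[ℂ] ℂ) (a : A) : A ⊗[ℂ] A →ₗ[ℂ] A ⊗[ℂ] A :=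
  evalSnd h ∘ₗ onLegs13 H.T₁ ∘ₗ (TensorProduct.assoc ℂ A A A).symm.toLinearMap ∘ₗ
    TensorProduct.mk ℂ A (A ⊗[ℂ] A) a

theorem sliceTensor_tmul (h : A →ₗ[ℂ] ℂ) (a b c : A) :
    H.sliceTensor h a (b ⊗ₜ c) = H.rightSlice h c a ⊗ₜ b := by
  have h2 : ∀ (w : A ⊗[ℂ] A), evalSnd h (TensorProduct.rightComm ℂ A A A (w ⊗ₜ b)) =
      evalSnd h w ⊗ₜ b := fun w =>
    tensor_hom_congr (evalSnd h ∘ₗ (TensorProduct.rightComm ℂ A A A).toLinearMap ∘ₗ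
      (TensorProduct.mk ℂ (A ⊗[ℂ] A) A).flip b) ((TensorProduct.mk ℂ A A).flip b ∘ₗ evalSnd h)
      (fun x y => by simp [TensorProduct.smul_tmul']) w
  simp [sliceTensor, onLegs13, h2, rightSlice_apply]

theorem G₁_rightSlice (h : A →ₗ[ℂ] ℂ) (a b c : A) :
    H.G₁ (H.rightSlice h c a ⊗ₜ b) = H.sliceTensor h a (H.E.left (b ⊗ₜ c)) := by
  have key := congrArg (evalSnd h) (LinearMap.congr_fun H.G₁_spec ((a ⊗ₜ b) ⊗ₜ c))
  simp only [LinearMap.comp_apply] at key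
  have h1 : ∀ w, evalSnd h (onLegs12 H.G₁ w) = H.G₁ (evalSnd h w) := fun w => evalSnd_map _ _ _ _
  rw [h1] at key
  have h2 : evalSnd h (onLegs13 H.T₁ ((a ⊗ₜ b) ⊗ₜ c)) = H.rightSlice h c a ⊗ₜ b :=
    H.sliceTensor_tmul h a b c
  rw [h2] at key
  rw [key]
  simp [sliceTensor, onLegs23]

/-- On right slices, `G₁` is given by E acting on the other legs. Right slices span A by fullness
and commute with left slices by coassociativity. -/
theorem G₁_map_leftSlice (f : A →ₗ[ℂ] ℂ) (c : A) (u : A ⊗[ℂ] A) :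
    H.G₁ (TensorProduct.map (H.leftSlice f c) LinearMap.id u) =
      TensorProduct.map (H.leftSlice f c) LinearMap.id (H.G₁ u) := by
  refine tensor_hom_congr (H.G₁ ∘ₗ TensorProduct.map (H.leftSlice f c) LinearMap.id)
    (TensorProduct.map (H.leftSlice f c) LinearMap.id ∘ₗ H.G₁) (fun a b => ?_) u
  have : H.G₁ ∘ₗ TensorProduct.map (H.leftSlice f c) LinearMap.id ∘ₗ
      (TensorProduct.mk ℂ A A).flip b = TensorProduct.map (H.leftSlice f c) LinearMap.id ∘ₗ H.G₁ ∘ₗ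
      (TensorProduct.mk ℂ A A).flip b := by
    apply rightSlice_hom_ext (H := H)
    intro h d a
    simp only [LinearMap.comp_apply, LinearMap.flip_apply, TensorProduct.mk_apply,
      TensorProduct.map_tmul, LinearMap.id_apply]
    rw [← leftSlice_rightSlice, G₁_rightSlice, G₁_rightSlice]
    refine tensor_hom_congr (H.sliceTensor h (H.leftSlice f c a))
      (TensorProduct.map (H.leftSlice f c) LinearMap.id ∘ₗ H.sliceTensor h a) (fun x y => ?_) _
    simp [sliceTensor_tmul, leftSlice_rightSlice]
  exact LinearMap.congr_fun this a

end WeakMultiplierHopfAlgebra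

theorem evalSnd_mulRight_ext {X : Type*} [NonUnitalRing X] [Module ℂ X] [IsScalarTower ℂ X X]
    [SMulCommClass ℂ X X] (hX : NondegenerateProduct X) {W : Type*} [AddCommGroup W]
    [Module ℂ W] {u v : W ⊗[ℂ] X} (h : ∀ (f : X →ₗ[ℂ] ℂ) (c : X),
      evalSnd (f ∘ₗ LinearMap.mulRight ℂ c) u = evalSnd (f ∘ₗ LinearMap.mulRight ℂ c) v) :
    u = v := by
  apply evalFst_ext
  intro g
  refine hX.left_ext fun c => ?_
  rw [← sub_eq_zero, ← Module.forall_dual_apply_eq_zero_iff ℂ]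
  intro f
  have := congrArg g (h f c)
  rw [← eval_comm, ← eval_comm] at this
  simpa [sub_eq_zero] using this

/-! ### Multipliers that behave like elements of the source and target algebras -/

namespace WeakMultiplierHopfAlgebra

variable {A : Type*} [NonUnitalRing A] [Module ℂ A] [IsScalarTower ℂ A A] [SMulCommClass ℂ A A]
variable (H : WeakMultiplierHopfAlgebra A)

theorem Δ_injective : Function.Injective H.Δ := by
  intro a a' h
  refine H.nondegenerate.left_ext fun b => ?_
  rw [← H.counit_left, ← H.counit_left]
  congr 1
  apply incl_injective H.nondegenerate₂
  rw [T₁_spec, T₁_spec, h]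

theorem E_right_Δ_right (a : A) (u : A ⊗[ℂ] A) : (H.Δ a).right (H.E.right u) = (H.Δ a).right u := by
  rw [← right_mul, E_mul_Δ]

/-- Multipliers `y` with `Δ(yb) = (1 ⊗ y)Δ(b)` and `Δ(by) = Δ(b)(1 ⊗ y)` for all `b`. -/
structure IsSourceLike (y : MultiplierAlgebra A) : Prop where
  left : ∀ b, H.Δ (y.left b) = tmul 1 y * H.Δ b
  right : ∀ b, H.Δ (y.right b) = H.Δ b * tmul 1 y

/-- Multipliers `x` with `Δ(xb) = (x ⊗ 1)Δ(b)` and `Δ(bx) = Δ(b)(x ⊗ 1)` for all `b`. -/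
structure IsTargetLike (x : MultiplierAlgebra A) : Prop where
  left : ∀ b, H.Δ (x.left b) = tmul x 1 * H.Δ b
  right : ∀ b, H.Δ (x.right b) = H.Δ b * tmul x 1

variable {H}

theorem IsSourceLike.T₁_left {y : MultiplierAlgebra A} (hy : H.IsSourceLike y) (b c : A) :
    H.T₁ (y.left b ⊗ₜ c) = (tmul 1 y).left (H.T₁ (b ⊗ₜ c)) := by
  apply incl_injective H.nondegenerate₂
  rw [incl_left H.nondegenerate₂, T₁_spec, T₁_spec, hy.left, mul_assoc]

theorem IsSourceLike.leftSlice_left {y : MultiplierAlgebra A} (hy : H.IsSourceLike y)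
    (f : A →ₗ[ℂ] ℂ) (c b : A) : H.leftSlice f c (y.left b) = y.left (H.leftSlice f c b) := by
  refine H.nondegenerate.left_ext fun d => ?_
  rw [← evalFst_T₁, hy.T₁_left, evalFst_left, ← left_mul_right H.nondegenerate, ← evalFst_T₁]
  rfl

theorem IsTargetLike.T₁_right {x : MultiplierAlgebra A} (hx : H.IsTargetLike x) (b c : A) :
    H.T₁ (x.right b ⊗ₜ c) = (tmul x 1).right (H.T₁ (b ⊗ₜ c)) := by
  apply incl_injective H.nondegenerate₂
  rw [incl_right H.nondegenerate₂, T₁_spec, T₁_spec, hx.right, mul_assoc, mul_assoc, ← tmul_mul,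
    ← tmul_mul, one_mul, mul_one, mul_one, one_mul]

/-- The factor 1 ⊗ y does not see the first leg, so both required identities can be checked after
slicing that leg. -/
theorem isSourceLike_of_leftSlice {y : MultiplierAlgebra A}
    (hl : ∀ f c b, H.leftSlice f c (y.left b) = y.left (H.leftSlice f c b))
    (hr : ∀ f c b, H.leftSlice f c (y.right b) = y.right (H.leftSlice f c b)) :
    H.IsSourceLike y where
  left b := by
    have h : ∀ c, H.T₁ (y.left b ⊗ₜ c) = (tmul 1 y).left (H.T₁ (b ⊗ₜ c)) := fun c => by
      apply evalFst_mulLeft_ext H.nondegenerate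
      intro f d
      rw [evalFst_T₁, evalFst_left, left_one_eq, LinearMap.comp_id, evalFst_T₁, hl,
        left_mul_right H.nondegenerate]
    apply ext_left H.nondegenerate₂
    refine tensor_hom_congr _ _ fun c d => ?_
    rw [left_mul, Δ_left_tmul, Δ_left_tmul, h, left_right H.nondegenerate₂]
  right b := by
    have h : ∀ c, H.T₂ (c ⊗ₜ y.right b) = (tmul 1 y).right (H.T₂ (c ⊗ₜ b)) := fun c => by
      apply evalFst_ext
      intro f
      rw [evalFst_right, right_one_eq, LinearMap.comp_id, ← leftSlice_apply, ← leftSlice_apply, hr]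
    apply ext_right H.nondegenerate₂
    refine tensor_hom_congr _ _ fun c d => ?_
    rw [right_mul, Δ_right_tmul, Δ_right_tmul, h, left_right H.nondegenerate₂]

theorem isTargetLike_of_rightSlice {x : MultiplierAlgebra A}
    (hl : ∀ g c b, H.rightSlice g c (x.left b) = x.left (H.rightSlice g c b))
    (hr : ∀ g c b, H.rightSlice g c (x.right b) = x.right (H.rightSlice g c b)) :
    H.IsTargetLike x where
  left b := by
    have h : ∀ c, H.T₁ (x.left b ⊗ₜ c) = (tmul x 1).left (H.T₁ (b ⊗ₜ c)) := fun c => by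
      apply evalSnd_ext
      intro f
      rw [evalSnd_left, left_one_eq, LinearMap.comp_id, ← rightSlice_apply, ← rightSlice_apply, hl]
    apply ext_left H.nondegenerate₂
    refine tensor_hom_congr _ _ fun c d => ?_
    rw [left_mul, Δ_left_tmul, Δ_left_tmul, h, left_right H.nondegenerate₂]
  right b := by
    have h : ∀ c, H.T₂ (c ⊗ₜ x.right b) = (tmul x 1).right (H.T₂ (c ⊗ₜ b)) := fun c => by
      apply evalSnd_mulRight_ext H.nondegenerate
      intro f d
      rw [evalSnd_T₂, evalSnd_right, right_one_eq, LinearMap.comp_id, evalSnd_T₂, hr,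
        right_mul_left H.nondegenerate]
    apply ext_right H.nondegenerate₂
    refine tensor_hom_congr _ _ fun c d => ?_
    rw [right_mul, Δ_right_tmul, Δ_right_tmul, h, left_right H.nondegenerate₂]

/-- Under the injective map Δ the two multipliers become x ⊗ 1 and 1 ⊗ y, which commute. -/
theorem IsTargetLike.mul_comm {x y : MultiplierAlgebra A} (hx : H.IsTargetLike x)
    (hy : H.IsSourceLike y) : x * y = y * x := by
  apply ext_left H.nondegenerate
  intro b
  apply H.Δ_injective
  rw [left_mul, left_mul, hx.left, hy.left, hy.left, hx.left, ← mul_assoc, ← mul_assoc, ← tmul_mul,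
    ← tmul_mul, mul_one, one_mul, mul_one, one_mul]

end WeakMultiplierHopfAlgebra

/-! ### The source and target maps expressed through E -/

namespace RegularWeakMultiplierHopfAlgebra

open WeakMultiplierHopfAlgebra

variable {A : Type*} [NonUnitalRing A] [Module ℂ A] [IsScalarTower ℂ A A] [SMulCommClass ℂ A A]
variable (H : RegularWeakMultiplierHopfAlgebra A)

/-- The map `a ⊗ b ↦ S(a)b`. -/
noncomputable def antipodeMul : A ⊗[ℂ] A →ₗ[ℂ] A :=
  LinearMap.mul' ℂ A ∘ₗ TensorProduct.map H.S.toLinearMap LinearMap.id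

/-- The map `a ⊗ b ↦ aS(b)`. -/
noncomputable def mulAntipode : A ⊗[ℂ] A →ₗ[ℂ] A :=
  LinearMap.mul' ℂ A ∘ₗ TensorProduct.map LinearMap.id H.S.toLinearMap

@[simp] theorem antipodeMul_tmul (a b : A) : H.antipodeMul (a ⊗ₜ b) = H.S a * b := by
  simp [antipodeMul]

@[simp] theorem mulAntipode_tmul (a b : A) : H.mulAntipode (a ⊗ₜ b) = a * H.S b := by
  simp [mulAntipode]

theorem targetMap_left (a b : A) : (H.targetMap a).left b = LinearMap.mul' ℂ A (H.R₁ (a ⊗ₜ b)) := rfl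
theorem targetMap_right (a c : A) : (H.targetMap a).right c = H.mulAntipode (H.T₂ (c ⊗ₜ a)) := rfl
theorem sourceMap_left (a c : A) : (H.sourceMap a).left c = H.antipodeMul (H.T₁ (a ⊗ₜ c)) := rfl
theorem sourceMap_right (a b : A) : (H.sourceMap a).right b = LinearMap.mul' ℂ A (H.R₂ (b ⊗ₜ a)) :=
  rfl

/-- The map `p ↦ ε_s(p)b`. -/
noncomputable def sourceLeft (b : A) : A →ₗ[ℂ] A :=
  H.antipodeMul ∘ₗ H.T₁ ∘ₗ (TensorProduct.mk ℂ A A).flip b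

/-- The map `p ↦ bε_s(p)`. -/
noncomputable def sourceRight (b : A) : A →ₗ[ℂ] A :=
  LinearMap.mul' ℂ A ∘ₗ H.R₂ ∘ₗ TensorProduct.mk ℂ A A b

@[simp] theorem sourceLeft_apply (b p : A) : H.sourceLeft b p = (H.sourceMap p).left b := rfl
@[simp] theorem sourceRight_apply (b p : A) : H.sourceRight b p = (H.sourceMap p).right b := rfl

theorem T₁_R₁ (u : A ⊗[ℂ] A) : H.T₁ (H.R₁ u) = H.E.left u := LinearMap.congr_fun H.T₁_comp_R₁ u
theorem R₁_T₁ (u : A ⊗[ℂ] A) : H.R₁ (H.T₁ u) = H.G₁ u := LinearMap.congr_fun H.R₁_comp_T₁ u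
theorem R₁_E (u : A ⊗[ℂ] A) : H.R₁ (H.E.left u) = H.R₁ u := by
  rw [← T₁_R₁]; exact LinearMap.congr_fun H.R₁_T₁_R₁ u
theorem T₂_R₂ (u : A ⊗[ℂ] A) : H.T₂ (H.R₂ u) = H.E.right u := LinearMap.congr_fun H.T₂_comp_R₂ u

/-- R₁ = R₁E, every element of the range of E is some T₁(v), and R₁T₁ = G₁; each of E, T₁ and G₁
commutes with the slice map. -/
theorem R₁_map_leftSlice (f : A →ₗ[ℂ] ℂ) (c : A) (u : A ⊗[ℂ] A) :
    H.R₁ (TensorProduct.map (H.leftSlice f c) LinearMap.id u) =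
      TensorProduct.map (H.leftSlice f c) LinearMap.id (H.R₁ u) := by
  rw [← R₁_E, E_left_map_leftSlice, ← T₁_R₁, ← T₁_map_leftSlice, R₁_T₁, G₁_map_leftSlice, ← R₁_T₁,
    T₁_R₁, R₁_E]

theorem R₁_leftSlice (f : A →ₗ[ℂ] ℂ) (c a b : A) : H.R₁ (H.leftSlice f c a ⊗ₜ b) =
    TensorProduct.map (H.leftSlice f c) LinearMap.id (H.R₁ (a ⊗ₜ b)) := by
  rw [← R₁_map_leftSlice, TensorProduct.map_tmul, LinearMap.id_apply]

theorem E_left_leftSlice (f : A →ₗ[ℂ] ℂ) (c a b : A) : H.E.left (H.leftSlice f c a ⊗ₜ b) =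
    TensorProduct.map (H.leftSlice f c) LinearMap.id (H.E.left (a ⊗ₜ b)) := by
  rw [← E_left_map_leftSlice, TensorProduct.map_tmul, LinearMap.id_apply]

theorem evalFst_R₁ (f : A →ₗ[ℂ] ℂ) (c a b : A) :
    evalFst (f ∘ₗ LinearMap.mulLeft ℂ c) (H.R₁ (a ⊗ₜ b)) = H.S (H.leftSlice f c a) * b := by
  have := congrArg (evalFst f) (H.R₁_spec a b c)
  rw [evalFst_left, evalFst_right, evalFst_map] at this
  exact this

theorem evalFst_T₁_eq (f : A →ₗ[ℂ] ℂ) (c : A) (u : A ⊗[ℂ] A) :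
    evalFst (f ∘ₗ LinearMap.mulLeft ℂ c) (H.T₁ u) =
      LinearMap.mul' ℂ A (TensorProduct.map (H.leftSlice f c) LinearMap.id u) :=
  tensor_hom_congr (evalFst (f ∘ₗ LinearMap.mulLeft ℂ c) ∘ₗ H.T₁)
    (LinearMap.mul' ℂ A ∘ₗ TensorProduct.map (H.leftSlice f c) LinearMap.id)
    (fun a b => by simp [evalFst_T₁]) u

theorem evalFst_R₁_eq (f : A →ₗ[ℂ] ℂ) (c : A) (u : A ⊗[ℂ] A) :
    evalFst (f ∘ₗ LinearMap.mulLeft ℂ c) (H.R₁ u) =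
      H.antipodeMul (TensorProduct.map (H.leftSlice f c) LinearMap.id u) :=
  tensor_hom_congr (evalFst (f ∘ₗ LinearMap.mulLeft ℂ c) ∘ₗ H.R₁)
    (H.antipodeMul ∘ₗ TensorProduct.map (H.leftSlice f c) LinearMap.id)
    (fun a b => by simp [evalFst_R₁]) u

/-- In Sweedler notation, E(a ⊗ b) = ∑ a₍₁₎ ⊗ a₍₂₎S(a₍₃₎)b = ∑ a₍₁₎ ⊗ ε_t(a₍₂₎)b, read off from E =
T₁R₁. -/
theorem evalFst_E_left (f : A →ₗ[ℂ] ℂ) (c a b : A) :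
    evalFst (f ∘ₗ LinearMap.mulLeft ℂ c) (H.E.left (a ⊗ₜ b)) =
      (H.targetMap (H.leftSlice f c a)).left b := by
  rw [← T₁_R₁, evalFst_T₁_eq, ← R₁_leftSlice, targetMap_left]

/-- The counterpart for R₁T₁: G₁(a ⊗ b) = ∑ a₍₁₎ ⊗ S(a₍₂₎)a₍₃₎b = ∑ a₍₁₎ ⊗ ε_s(a₍₂₎)b. -/
theorem evalFst_G₁ (f : A →ₗ[ℂ] ℂ) (c a b : A) :
    evalFst (f ∘ₗ LinearMap.mulLeft ℂ c) (H.G₁ (a ⊗ₜ b)) =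
      (H.sourceMap (H.leftSlice f c a)).left b := by
  rw [← R₁_T₁, evalFst_R₁_eq, ← T₁_leftSlice, sourceMap_left]

/-- `(1 ⊗ a)E(b ⊗ c) = ∑ ε_s(a₍₁₎)b ⊗ a₍₂₎c`. -/
theorem tmul_E_left (a b c : A) : (tmul 1 (incl a)).left (H.E.left (b ⊗ₜ c)) =
    TensorProduct.map (H.sourceLeft b) LinearMap.id (H.T₁ (a ⊗ₜ c)) := by
  let L : A →ₗ[ℂ] A ⊗[ℂ] A :=
    { toFun := fun a => (tmul 1 (incl a)).left (H.E.left (b ⊗ₜ c))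
      map_add' := fun x y => by simp only [map_add, left_add, LinearMap.add_apply]
      map_smul' := fun r x => by
        simp only [map_smul, left_smul, LinearMap.smul_apply, RingHom.id_apply] }
  have hL : L = TensorProduct.map (H.sourceLeft b) LinearMap.id ∘ₗ H.T₁ ∘ₗ
      (TensorProduct.mk ℂ A A).flip c := by
    -- On slices both sides are computed from E: the right one because ε_s of a slice is a slice of
    -- G₁, and G₁ on right slices is given by E.
    apply leftSlice_hom_ext (H := H.toWeakMultiplierHopfAlgebra)
    intro f k a
    apply evalSnd_ext
    intro h
    simp only [LinearMap.comp_apply, LinearMap.flip_apply, TensorProduct.mk_apply]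
    rw [evalSnd_map, LinearMap.comp_id, ← rightSlice_apply, leftSlice_rightSlice, sourceLeft_apply,
      ← evalFst_G₁, G₁_rightSlice]
    change evalSnd h ((tmul 1 (incl _)).left _) = _
    rw [evalSnd_left, left_one]
    refine tensor_hom_congr (evalSnd (h ∘ₗ (incl (H.leftSlice f k a)).left))
      (evalFst (f ∘ₗ LinearMap.mulLeft ℂ k) ∘ₗ H.sliceTensor h a) (fun x y => ?_) _
    simp [sliceTensor_tmul, eval_leftSlice]
  exact LinearMap.congr_fun hL a

/-- `(k ⊗ a)E(1 ⊗ c) = ∑ kε_s(a₍₁₎) ⊗ a₍₂₎c`. -/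
theorem tmul_E_right (k a c : A) : (tmul 1 (incl c)).right (H.E.right (k ⊗ₜ a)) =
    TensorProduct.map (H.sourceRight k) LinearMap.id (H.T₁ (a ⊗ₜ c)) := by
  apply evalFst_mulRight_ext H.nondegenerate
  intro f b
  have h1 : (tmul (incl b) 1).right ((tmul 1 (incl c)).right (H.E.right (k ⊗ₜ a))) =
      (tmul (incl k) 1).left ((tmul 1 (incl a)).left (H.E.left (b ⊗ₜ c))) := by
    apply incl_injective H.nondegenerate₂
    simp only [incl_left H.nondegenerate₂, incl_right H.nondegenerate₂]
    rw [mul_assoc, mul_assoc, ← tmul_mul, one_mul, mul_one, ← tmul_incl, ← tmul_incl, ← mul_assoc,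
      ← mul_assoc, ← tmul_mul, one_mul, mul_one, mul_assoc]
  have h2 := congrArg (evalFst f) h1
  rw [evalFst_right, right_one, tmul_E_left] at h2
  refine h2.trans ?_
  refine tensor_hom_congr (evalFst f ∘ₗ (tmul (incl k) 1).left ∘ₗ
    TensorProduct.map (H.sourceLeft b) LinearMap.id) (evalFst (f ∘ₗ LinearMap.mulRight ℂ b) ∘ₗ
    TensorProduct.map (H.sourceRight k) LinearMap.id) (fun x y => ?_) _
  simp [compat]

/-- For p running over right slices, ε_s(p)b is a slice of (1 ⊗ p)E(b ⊗ c), and E commutes with the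
slice map acting on b. -/
theorem leftSlice_sourceMap_left (p b : A) (f : A →ₗ[ℂ] ℂ) (k : A) :
    H.leftSlice f k ((H.sourceMap p).left b) = (H.sourceMap p).left (H.leftSlice f k b) := by
  have : H.leftSlice f k ∘ₗ H.sourceLeft b = H.sourceLeft (H.leftSlice f k b) := by
    apply rightSlice_hom_ext (H := H.toWeakMultiplierHopfAlgebra)
    intro h c p
    have h1 : ∀ b, H.sourceLeft b (H.rightSlice h c p) =
        evalSnd h ((tmul 1 (incl p)).left (H.E.left (b ⊗ₜ c))) := fun b => by
      rw [tmul_E_left, evalSnd_map, LinearMap.comp_id, rightSlice_apply]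
    rw [LinearMap.comp_apply, h1, h1, E_left_leftSlice, evalSnd_left, evalSnd_left, evalSnd_map,
      LinearMap.comp_id]
    rfl
  exact LinearMap.congr_fun this p

theorem leftSlice_sourceMap_right (p b : A) (f : A →ₗ[ℂ] ℂ) (k : A) :
    H.leftSlice f k ((H.sourceMap p).right b) = (H.sourceMap p).right (H.leftSlice f k b) := by
  have : H.leftSlice f k ∘ₗ H.sourceRight b = H.sourceRight (H.leftSlice f k b) := by
    apply rightSlice_hom_ext (H := H.toWeakMultiplierHopfAlgebra)
    intro h c p
    have h1 : ∀ b, H.sourceRight b (H.rightSlice h c p) =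
        evalSnd h ((tmul 1 (incl c)).right (H.E.right (b ⊗ₜ p))) := fun b => by
      rw [tmul_E_right, evalSnd_map, LinearMap.comp_id, rightSlice_apply]
    have h2 : H.leftSlice f k b ⊗ₜ[ℂ] p =
      TensorProduct.map (H.leftSlice f k) LinearMap.id (b ⊗ₜ[ℂ] p) := by simp
    rw [LinearMap.comp_apply, h1, h1, h2, E_right_map_leftSlice, evalSnd_right, evalSnd_right,
      evalSnd_map, LinearMap.comp_id]
    rfl
  exact LinearMap.congr_fun this p

theorem isSourceLike_sourceMap (p : A) : H.IsSourceLike (H.sourceMap p) :=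
  isSourceLike_of_leftSlice (fun f c b => H.leftSlice_sourceMap_left p b f c)
    (fun f c b => H.leftSlice_sourceMap_right p b f c)

/-- The map `a ↦ ε_t(a)b`. -/
noncomputable def targetLeft (b : A) : A →ₗ[ℂ] A :=
  LinearMap.mul' ℂ A ∘ₗ H.R₁ ∘ₗ (TensorProduct.mk ℂ A A).flip b

/-- The map `a ↦ bε_t(a)`. -/
noncomputable def targetRight (b : A) : A →ₗ[ℂ] A :=
  H.mulAntipode ∘ₗ H.T₂ ∘ₗ TensorProduct.mk ℂ A A b

@[simp] theorem targetLeft_apply (b p : A) : H.targetLeft b p = (H.targetMap p).left b := rfl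
@[simp] theorem targetRight_apply (b p : A) : H.targetRight b p = (H.targetMap p).right b := rfl

theorem evalFst_E_right (f : A →ₗ[ℂ] ℂ) (k a b : A) :
    evalFst (f ∘ₗ LinearMap.mulRight ℂ a) (H.E.right (k ⊗ₜ b)) =
      (H.targetMap (H.leftSlice f k a)).right b := by
  refine H.nondegenerate.left_ext fun d => ?_
  rw [← evalFst_mul_tmul, ← compat, ← compat, evalFst_tmul_mul, evalFst_E_left]

/-- The products ε_t(a)b and bε_t(a), for a running over slices, are first-leg slices of E(a ⊗ b)
and of (k ⊗ b)E. Right slicing acts on the other leg, where it commutes with E. -/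
theorem isTargetLike_targetMap (p : A) : H.IsTargetLike (H.targetMap p) := by
  apply isTargetLike_of_rightSlice
  · intro g c b
    have : H.rightSlice g c ∘ₗ H.targetLeft b = H.targetLeft (H.rightSlice g c b) := by
      apply leftSlice_hom_ext (H := H.toWeakMultiplierHopfAlgebra)
      intro f k a
      have h2 : a ⊗ₜ[ℂ] H.rightSlice g c b =
        TensorProduct.map LinearMap.id (H.rightSlice g c) (a ⊗ₜ[ℂ] b) := by simp
      rw [LinearMap.comp_apply, targetLeft_apply, targetLeft_apply, ← evalFst_E_left,
        ← evalFst_E_left, h2, E_left_map_rightSlice, evalFst_map, LinearMap.comp_id]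
    exact LinearMap.congr_fun this p
  · intro g c b
    have : H.rightSlice g c ∘ₗ H.targetRight b = H.targetRight (H.rightSlice g c b) := by
      apply leftSlice_hom_ext (H := H.toWeakMultiplierHopfAlgebra)
      intro f k a
      have h2 : k ⊗ₜ[ℂ] H.rightSlice g c b =
        TensorProduct.map LinearMap.id (H.rightSlice g c) (k ⊗ₜ[ℂ] b) := by simp
      rw [LinearMap.comp_apply, targetRight_apply, targetRight_apply, ← evalFst_E_right,
        ← evalFst_E_right, h2, E_right_map_rightSlice, evalFst_map, LinearMap.comp_id]
    exact LinearMap.congr_fun this p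

/-- Such an n preserves E(A ⊗ A) = Δ(A)(1 ⊗ A) from the left and (A ⊗ A)E = (A ⊗ 1)Δ(A) from the
right, so nE = EnE = En. -/
theorem E_mul_comm_of_Δ (n : MultiplierAlgebra (A ⊗[ℂ] A))
    (hl : ∀ b, ∃ b', n * H.Δ b = H.Δ b') (hr : ∀ b, ∃ b', H.Δ b * n = H.Δ b') :
    H.E * n = n * H.E := by
  have h1 : n * H.E = H.E * n * H.E := by
    apply ext_left H.nondegenerate₂
    intro u
    simp only [left_mul]
    rw [← T₁_R₁]
    refine tensor_hom_congr (n.left ∘ₗ H.T₁) (H.E.left ∘ₗ n.left ∘ₗ H.T₁) (fun a b => ?_) _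
    obtain ⟨b', hb'⟩ := hl a
    have : n.left (H.T₁ (a ⊗ₜ b)) = H.T₁ (b' ⊗ₜ b) := by
      apply incl_injective H.nondegenerate₂
      rw [incl_left H.nondegenerate₂, T₁_spec, T₁_spec, ← mul_assoc, hb']
    simp only [LinearMap.comp_apply]
    rw [this, E_left_T₁]
  have h2 : H.E * n = H.E * n * H.E := by
    apply ext_right H.nondegenerate₂
    intro u
    simp only [right_mul]
    rw [← T₂_R₂]
    refine tensor_hom_congr (n.right ∘ₗ H.T₂) (H.E.right ∘ₗ n.right ∘ₗ H.T₂) (fun a b => ?_) _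
    obtain ⟨b', hb'⟩ := hr b
    have : n.right (H.T₂ (a ⊗ₜ b)) = H.T₂ (a ⊗ₜ b') := by
      apply incl_injective H.nondegenerate₂
      rw [incl_right H.nondegenerate₂, T₂_spec, T₂_spec, mul_assoc, hb']
    simp only [LinearMap.comp_apply]
    rw [this, E_right_T₂]
  rw [h2, ← h1]

theorem E_mul_tmul_source {y : MultiplierAlgebra A} (hy : H.IsSourceLike y) :
    H.E * tmul 1 y = tmul 1 y * H.E :=
  H.E_mul_comm_of_Δ _ (fun b => ⟨_, (hy.left b).symm⟩) (fun b => ⟨_, (hy.right b).symm⟩)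

end RegularWeakMultiplierHopfAlgebra

/-! ### Extending anti-isomorphisms to multipliers -/

namespace MultiplierAlgebra

variable {X : Type*} [NonUnitalRing X] [Module ℂ X] [IsScalarTower ℂ X X] [SMulCommClass ℂ X X]
variable {Y : Type*} [NonUnitalRing Y] [Module ℂ Y] [IsScalarTower ℂ Y Y] [SMulCommClass ℂ Y Y]

/-- The anti-homomorphism `M(X) → M(Y)` induced by a bijective anti-homomorphism `e : X → Y`. -/
def antiMap (e : X ≃ₗ[ℂ] Y) (he : ∀ x y, e (x * y) = e y * e x) :
    MultiplierAlgebra X →ₗ[ℂ] MultiplierAlgebra Y where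
  toFun m := ofPair (e.toLinearMap ∘ₗ m.right ∘ₗ e.symm.toLinearMap)
    (e.toLinearMap ∘ₗ m.left ∘ₗ e.symm.toLinearMap) (fun x y => by
      apply e.symm.injective
      have he' : ∀ x y, e.symm (x * y) = e.symm y * e.symm x := fun x y => by
        apply e.injective; simp [he]
      simp [he', compat])
  map_add' m n := by ext <;> simp
  map_smul' c m := by ext <;> simp

variable (e : X ≃ₗ[ℂ] Y) (he : ∀ x y, e (x * y) = e y * e x)

@[simp] theorem antiMap_left (m : MultiplierAlgebra X) (x : X) :
    (antiMap e he m).left (e x) = e (m.right x) := by simp [antiMap]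

@[simp] theorem antiMap_right (m : MultiplierAlgebra X) (x : X) :
    (antiMap e he m).right (e x) = e (m.left x) := by simp [antiMap]

theorem antiMap_mul (m n : MultiplierAlgebra X) :
    antiMap e he (m * n) = antiMap e he n * antiMap e he m := by
  ext x <;> simp [antiMap]

theorem antiMap_incl (a : X) : antiMap e he (incl a) = incl (e a) := by
  ext x
  · obtain ⟨x, rfl⟩ := e.surjective x
    rw [antiMap_left, right_incl, he, left_incl]
  · obtain ⟨x, rfl⟩ := e.surjective x
    rw [antiMap_right, left_incl, he, right_incl]

theorem antiMap_one : antiMap e he 1 = 1 := by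
  ext x <;> simp [antiMap]

theorem antiMap_symm_apply (he' : ∀ x y, e.symm (x * y) = e.symm y * e.symm x)
    (m : MultiplierAlgebra X) : antiMap e.symm he' (antiMap e he m) = m := by
  ext x <;> simp [antiMap]

theorem antiMap_apply_symm (he' : ∀ x y, e.symm (x * y) = e.symm y * e.symm x)
    (m : MultiplierAlgebra Y) : antiMap e he (antiMap e.symm he' m) = m := by
  ext x <;> simp [antiMap]

end MultiplierAlgebra

/-! ### The antipode reverses products; consequences of regularity -/

namespace RegularWeakMultiplierHopfAlgebra

open WeakMultiplierHopfAlgebra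

variable {A : Type*} [NonUnitalRing A] [Module ℂ A] [IsScalarTower ℂ A A] [SMulCommClass ℂ A A]
variable (H : RegularWeakMultiplierHopfAlgebra A)

/-- R₁E = R₁ seen through slices, since a first-leg slice of R₁(a ⊗ c) is S(a')c with a' the slice
of a. -/
theorem antipodeMul_E (u : A ⊗[ℂ] A) : H.antipodeMul (H.E.left u) = H.antipodeMul u := by
  refine tensor_hom_congr (H.antipodeMul ∘ₗ H.E.left) H.antipodeMul (fun a c => ?_) u
  have : H.antipodeMul ∘ₗ H.E.left ∘ₗ (TensorProduct.mk ℂ A A).flip c =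
      H.antipodeMul ∘ₗ (TensorProduct.mk ℂ A A).flip c := by
    apply leftSlice_hom_ext (H := H.toWeakMultiplierHopfAlgebra)
    intro f k a
    simp only [LinearMap.comp_apply, LinearMap.flip_apply, TensorProduct.mk_apply]
    rw [E_left_leftSlice, ← evalFst_R₁_eq, R₁_E, evalFst_R₁, antipodeMul_tmul]
  exact LinearMap.congr_fun this a

theorem antipodeMul_T₁_R₁ (u : A ⊗[ℂ] A) : H.antipodeMul (H.T₁ (H.R₁ u)) = H.antipodeMul u := by
  rw [T₁_R₁, antipodeMul_E]

theorem map_sourceLeft_Δ_left (a c : A) (v : A ⊗[ℂ] A) :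
    TensorProduct.map (H.sourceLeft c) LinearMap.id ((H.Δ a).left (H.T₁ v)) =
      (tmul 1 (incl a)).left (TensorProduct.map (H.sourceLeft c) LinearMap.id (H.T₁ v)) := by
  refine tensor_hom_congr (TensorProduct.map (H.sourceLeft c) LinearMap.id ∘ₗ (H.Δ a).left ∘ₗ H.T₁)
    ((tmul 1 (incl a)).left ∘ₗ TensorProduct.map (H.sourceLeft c) LinearMap.id ∘ₗ H.T₁)
    (fun p q => ?_) v
  simp only [LinearMap.comp_apply]
  have h : tmul 1 (incl a * incl p) = tmul (1 : MultiplierAlgebra A) (incl a) * tmul 1 (incl p) := by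
    rw [← tmul_mul, one_mul]
  rw [Δ_left_T₁, ← tmul_E_left, ← tmul_E_left, incl_mul, h, left_mul]

/-- The first leg of Δ(a)(b ⊗ d) = Δ(a)E(b ⊗ d) is fed to ε_s. Under ε_s the factor Δ(a) may be
replaced by 1 ⊗ a, and (1 ⊗ a)E(b ⊗ d) = ∑ ε_s(a₍₁₎)b ⊗ a₍₂₎d. -/
theorem sourceMap_mul (a b : A) : H.sourceMap (a * b) = H.sourceMap ((H.sourceMap a).left b) := by
  apply ext_left H.nondegenerate
  intro c
  have : H.sourceLeft c ∘ₗ LinearMap.mulRight ℂ b = H.sourceLeft c ∘ₗ H.sourceLeft b := by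
    apply rightSlice_hom_ext (H := H.toWeakMultiplierHopfAlgebra)
    intro h d a
    have h1 : TensorProduct.map (H.sourceLeft c) LinearMap.id ((H.Δ a).left (b ⊗ₜ d)) =
        TensorProduct.map (H.sourceLeft c) LinearMap.id
          (TensorProduct.map (H.sourceLeft b) LinearMap.id (H.T₁ (a ⊗ₜ d))) := by
      rw [← Δ_left_E_left, ← T₁_R₁, map_sourceLeft_Δ_left, T₁_R₁, ← tmul_E_left]
      refine tensor_hom_congr
        ((tmul 1 (incl a)).left ∘ₗ TensorProduct.map (H.sourceLeft c) LinearMap.id)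
        (TensorProduct.map (H.sourceLeft c) LinearMap.id ∘ₗ (tmul 1 (incl a)).left)
        (fun p q => ?_) _
      simp
    have h2 := congrArg (evalSnd h) h1
    rw [Δ_left_tmul, evalSnd_map, evalSnd_map, evalSnd_map, LinearMap.comp_id, evalSnd_right] at h2
    exact h2
  exact LinearMap.congr_fun this a

theorem antipodeMul_T₁_left (p : A) (v : A ⊗[ℂ] A) :
    H.antipodeMul (H.T₁ ((tmul (incl p) 1).left v)) =
      H.antipodeMul ((tmul 1 (H.sourceMap p)).left (H.T₁ v)) := by
  refine tensor_hom_congr (H.antipodeMul ∘ₗ H.T₁ ∘ₗ (tmul (incl p) 1).left)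
    (H.antipodeMul ∘ₗ (tmul 1 (H.sourceMap p)).left ∘ₗ H.T₁) (fun a b => ?_) v
  simp only [LinearMap.comp_apply, left_tmul, TensorProduct.map_tmul, left_incl, left_one]
  rw [← sourceMap_left, sourceMap_mul, sourceMap_left, (H.isSourceLike_sourceMap p).T₁_left]
  rfl

/-- This is ∑ S(p₍₁₎b)p₍₂₎q = S(b)ε_s(p)q, obtained before S is known to reverse products: Δ(p)(b ⊗
q) = T₁((p ⊗ 1)R₁(b ⊗ q)). By `sourceMap_mul` the factor p becomes ε_s(p) on the second leg, where
it commutes with E. -/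
theorem antipodeMul_right_T₁ (b : A) (v : A ⊗[ℂ] A) :
    H.antipodeMul ((tmul (incl b) 1).right (H.T₁ v)) = H.S b * H.antipodeMul (H.T₁ v) := by
  refine tensor_hom_congr (H.antipodeMul ∘ₗ (tmul (incl b) 1).right ∘ₗ H.T₁)
    (LinearMap.mulLeft ℂ (H.S b) ∘ₗ H.antipodeMul ∘ₗ H.T₁) (fun p q => ?_) v
  have h1 : (H.Δ p).left (H.T₁ (H.R₁ (b ⊗ₜ q))) =
      H.T₁ ((tmul (incl p) 1).left (H.R₁ (b ⊗ₜ q))) :=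
    tensor_hom_congr ((H.Δ p).left ∘ₗ H.T₁) (H.T₁ ∘ₗ (tmul (incl p) 1).left)
      (fun x y => by simp [Δ_left_T₁]) _
  simp only [LinearMap.comp_apply, LinearMap.mulLeft_apply]
  rw [← Δ_left_tmul, ← Δ_left_E_left, ← T₁_R₁, h1, antipodeMul_T₁_left, T₁_R₁, ← left_mul,
    ← H.E_mul_tmul_source (H.isSourceLike_sourceMap p), left_mul, antipodeMul_E, ← sourceMap_left]
  simp

/-- S(ab)c is unchanged when ab ⊗ c is replaced by E(ab ⊗ c) = (T₁R₁(a ⊗ c))(b ⊗ 1), and there the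
factor b comes out as S(b) on the left. -/
theorem S_mul (a b : A) : H.S (a * b) = H.S b * H.S a := by
  refine H.nondegenerate.left_ext fun c => ?_
  have h : (a * b) ⊗ₜ[ℂ] c = (tmul (incl b) 1).right (a ⊗ₜ[ℂ] c) := by simp
  rw [← antipodeMul_tmul, ← antipodeMul_E, h, left_right H.nondegenerate₂, ← T₁_R₁,
    antipodeMul_right_T₁, antipodeMul_T₁_R₁, antipodeMul_tmul, mul_assoc]

theorem S_symm_mul (a b : A) : H.S.symm (a * b) = H.S.symm b * H.S.symm a := by
  apply H.S.injective
  simp [S_mul]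

/-- The map `a ⊗ c ↦ Δ(a)(c ⊗ 1)`. -/
noncomputable def T₃ : A ⊗[ℂ] A →ₗ[ℂ] A ⊗[ℂ] A :=
  TensorProduct.map H.S.symm.toLinearMap LinearMap.id ∘ₗ H.R₂ ∘ₗ
    TensorProduct.map H.S.toLinearMap LinearMap.id ∘ₗ (TensorProduct.comm ℂ A A).toLinearMap

/-- The map `a ⊗ b ↦ (1 ⊗ b)Δ(a)`. -/
noncomputable def T₄ : A ⊗[ℂ] A →ₗ[ℂ] A ⊗[ℂ] A :=
  TensorProduct.map LinearMap.id H.S.symm.toLinearMap ∘ₗ H.R₁ ∘ₗ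
    TensorProduct.map LinearMap.id H.S.toLinearMap

theorem T₃_tmul (a c : A) : H.T₃ (a ⊗ₜ c) =
    TensorProduct.map H.S.symm.toLinearMap LinearMap.id (H.R₂ (H.S c ⊗ₜ a)) := by simp [T₃]

theorem T₄_tmul (a b : A) : H.T₄ (a ⊗ₜ b) =
    TensorProduct.map LinearMap.id H.S.symm.toLinearMap (H.R₁ (a ⊗ₜ H.S b)) := by simp [T₄]

theorem R₂_tmul (a c : A) : H.R₂ (H.S c ⊗ₜ a) =
    TensorProduct.map H.S.toLinearMap LinearMap.id (H.T₃ (a ⊗ₜ c)) := by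
  rw [T₃_tmul, ← LinearMap.comp_apply, ← TensorProduct.map_comp]
  simp

theorem R₁_tmul (a b : A) : H.R₁ (a ⊗ₜ H.S b) =
    TensorProduct.map LinearMap.id H.S.toLinearMap (H.T₄ (a ⊗ₜ b)) := by
  rw [T₄_tmul, ← LinearMap.comp_apply, ← TensorProduct.map_comp]
  simp

/-- R₁(a ⊗ S(b)) = ∑ a₍₁₎ ⊗ S(ba₍₂₎), so removing S from the second leg leaves (1 ⊗ b)Δ(a).
Bijectivity of S thus puts (1 ⊗ b)Δ(a) in A ⊗ A; the same holds for Δ(a)(c ⊗ 1) with R₂. -/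
theorem T₄_left (a b c : A) : (tmul (incl c) 1).left (H.T₄ (a ⊗ₜ b)) =
    (tmul 1 (incl b)).left (H.T₂ (c ⊗ₜ a)) := by
  have h1 : ∀ w, (tmul (incl c) 1).left (TensorProduct.map LinearMap.id H.S.symm.toLinearMap w) =
      TensorProduct.map LinearMap.id H.S.symm.toLinearMap ((tmul (incl c) 1).left w) := fun w =>
    tensor_hom_congr ((tmul (incl c) 1).left ∘ₗ TensorProduct.map LinearMap.id H.S.symm.toLinearMap)
      (TensorProduct.map LinearMap.id H.S.symm.toLinearMap ∘ₗ (tmul (incl c) 1).left)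
      (fun x y => by simp) w
  rw [T₄_tmul, h1, R₁_spec]
  refine tensor_hom_congr (TensorProduct.map LinearMap.id H.S.symm.toLinearMap ∘ₗ
    (tmul 1 (incl (H.S b))).right ∘ₗ TensorProduct.map LinearMap.id H.S.toLinearMap)
    (tmul 1 (incl b)).left (fun x y => ?_) _
  simp [S_symm_mul]

theorem T₃_right (a c d : A) : (tmul 1 (incl d)).right (H.T₃ (a ⊗ₜ c)) =
    (tmul (incl c) 1).right (H.T₁ (a ⊗ₜ d)) := by
  have h1 : ∀ w, (tmul 1 (incl d)).right (TensorProduct.map H.S.symm.toLinearMap LinearMap.id w) =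
      TensorProduct.map H.S.symm.toLinearMap LinearMap.id ((tmul 1 (incl d)).right w) := fun w =>
    tensor_hom_congr ((tmul 1 (incl d)).right ∘ₗ
        TensorProduct.map H.S.symm.toLinearMap LinearMap.id)
      (TensorProduct.map H.S.symm.toLinearMap LinearMap.id ∘ₗ (tmul 1 (incl d)).right)
      (fun x y => by simp) w
  rw [T₃_tmul, h1, R₂_spec]
  refine tensor_hom_congr (TensorProduct.map H.S.symm.toLinearMap LinearMap.id ∘ₗ
    (tmul (incl (H.S c)) 1).left ∘ₗ TensorProduct.map H.S.toLinearMap LinearMap.id)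
    (tmul (incl c) 1).right (fun x y => ?_) _
  simp [S_symm_mul]

theorem incl_T₄ (a b : A) : incl (H.T₄ (a ⊗ₜ b)) = tmul 1 (incl b) * H.Δ a := by
  apply ext_right H.nondegenerate₂
  refine tensor_hom_congr _ _ fun c d => ?_
  have h : c ⊗ₜ[ℂ] d * H.T₄ (a ⊗ₜ b) =
      (tmul 1 (incl d)).left ((tmul (incl c) 1).left (H.T₄ (a ⊗ₜ b))) := by
    rw [← left_mul, ← tmul_mul, one_mul, mul_one, tmul_incl, left_incl]
  rw [right_incl, h, T₄_left, right_mul, right_tmul, TensorProduct.map_tmul, right_one, right_incl,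
    Δ_right_tmul, incl_mul, ← left_mul, ← tmul_mul, one_mul]

theorem incl_T₃ (a c : A) : incl (H.T₃ (a ⊗ₜ c)) = H.Δ a * tmul (incl c) 1 := by
  apply ext_left H.nondegenerate₂
  refine tensor_hom_congr _ _ fun b d => ?_
  have h : H.T₃ (a ⊗ₜ c) * b ⊗ₜ[ℂ] d =
      (tmul (incl b) 1).right ((tmul 1 (incl d)).right (H.T₃ (a ⊗ₜ c))) := by
    rw [← right_mul, ← tmul_mul, one_mul, mul_one, tmul_incl, right_incl]
  rw [left_incl, h, T₃_right, left_mul, left_tmul, TensorProduct.map_tmul, left_one, left_incl,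
    Δ_left_tmul, incl_mul, ← right_mul, ← tmul_mul, one_mul]

theorem tmul_left_T₃ (k a e : A) : (tmul (incl k) 1).left (H.T₃ (a ⊗ₜ e)) =
    (tmul (incl e) 1).right (H.T₂ (k ⊗ₜ a)) := by
  apply incl_injective H.nondegenerate₂
  rw [incl_left H.nondegenerate₂, incl_right H.nondegenerate₂, incl_T₃, T₂_spec, mul_assoc]

/-- The map `r ⊗ s ↦ r ⊗ ε_t(s)`. -/
noncomputable def targetTensor : A ⊗[ℂ] A →ₗ[ℂ] MultiplierAlgebra (A ⊗[ℂ] A) :=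
  TensorProduct.lift (tmul.compl₁₂ incl H.targetMap)

/-- The map `p ⊗ q ↦ ε_s(p) ⊗ q`. -/
noncomputable def sourceTensor : A ⊗[ℂ] A →ₗ[ℂ] MultiplierAlgebra (A ⊗[ℂ] A) :=
  TensorProduct.lift (tmul.compl₁₂ H.sourceMap incl)

@[simp] theorem targetTensor_tmul (r s : A) :
    H.targetTensor (r ⊗ₜ s) = tmul (incl r) (H.targetMap s) := rfl

@[simp] theorem sourceTensor_tmul (p q : A) :
    H.sourceTensor (p ⊗ₜ q) = tmul (H.sourceMap p) (incl q) := rfl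

theorem targetTensor_left (w : A ⊗[ℂ] A) (b c : A) : (H.targetTensor w).left (b ⊗ₜ c) =
    TensorProduct.map (LinearMap.mulRight ℂ b) (H.targetLeft c) w := by
  induction w with
  | zero => simp
  | add x y hx hy => simp only [map_add, left_add, LinearMap.add_apply, hx, hy]
  | tmul r s => simp

theorem targetTensor_right (w : A ⊗[ℂ] A) (b c : A) : (H.targetTensor w).right (b ⊗ₜ c) =
    TensorProduct.map (LinearMap.mulLeft ℂ b) (H.targetRight c) w := by
  induction w with
  | zero => simp
  | add x y hx hy => simp only [map_add, right_add, LinearMap.add_apply, hx, hy]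
  | tmul r s => simp

theorem sourceTensor_right (w : A ⊗[ℂ] A) (b c : A) : (H.sourceTensor w).right (b ⊗ₜ c) =
    TensorProduct.map (H.sourceRight b) (LinearMap.mulLeft ℂ c) w := by
  induction w with
  | zero => simp
  | add x y hx hy => simp only [map_add, right_add, LinearMap.add_apply, hx, hy]
  | tmul r s => simp

/-- `E(ae ⊗ 1) = ∑ a₍₁₎e ⊗ ε_t(a₍₂₎)`. -/
theorem E_mul_tmul_one (a e : A) :
    H.E * tmul (incl (a * e)) 1 = H.targetTensor (H.T₃ (a ⊗ₜ e)) := by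
  apply ext_left H.nondegenerate₂
  refine tensor_hom_congr _ _ fun b c => ?_
  apply evalFst_mulLeft_ext H.nondegenerate
  intro f k
  have h1 : (tmul (incl (a * e)) 1).left (b ⊗ₜ[ℂ] c) = (tmul (incl (e * b)) 1).right (a ⊗ₜ c) := by
    simp [mul_assoc]
  have h2 : (f ∘ₗ LinearMap.mulLeft ℂ k) ∘ₗ (incl (e * b)).right =
      (f ∘ₗ LinearMap.mulRight ℂ (e * b)) ∘ₗ LinearMap.mulLeft ℂ k := by
    ext x; simp [mul_assoc]
  have h4 := congrArg (evalFst (f ∘ₗ LinearMap.mulRight ℂ b)) (H.tmul_left_T₃ k a e)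
  rw [evalFst_left, evalFst_right, left_one, right_one] at h4
  rw [left_mul, h1, left_right H.nondegenerate₂, evalFst_right, right_one, h2, evalFst_E_left,
    leftSlice_apply, targetTensor_left, evalFst_map, targetLeft_apply]
  congr 2
  have h5 : (f ∘ₗ LinearMap.mulLeft ℂ k) ∘ₗ LinearMap.mulRight ℂ b =
      (f ∘ₗ LinearMap.mulRight ℂ b) ∘ₗ (incl k).left := by ext x; simp [mul_assoc]
  have h6 : f ∘ₗ LinearMap.mulRight ℂ (e * b) =
      (f ∘ₗ LinearMap.mulRight ℂ b) ∘ₗ (incl e).right := by ext x; simp [mul_assoc]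
  rw [h5, h6, h4]

/-- `(1 ⊗ da)E = ∑ ε_s(a₍₁₎) ⊗ da₍₂₎`. -/
theorem tmul_one_mul_E (a d : A) :
    tmul 1 (incl (d * a)) * H.E = H.sourceTensor (H.T₄ (a ⊗ₜ d)) := by
  apply ext_right H.nondegenerate₂
  refine tensor_hom_congr _ _ fun k e => ?_
  apply evalSnd_mulRight_ext H.nondegenerate
  intro f c
  have h1 : (tmul 1 (incl (d * a))).right (k ⊗ₜ[ℂ] e) = (tmul 1 (incl (e * d))).left (k ⊗ₜ a) := by
    simp [mul_assoc]
  have h3 : (tmul 1 (incl c)).right (H.T₄ (a ⊗ₜ d)) = (tmul 1 (incl d)).left (H.T₁ (a ⊗ₜ c)) := by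
    apply incl_injective H.nondegenerate₂
    rw [incl_left H.nondegenerate₂, incl_right H.nondegenerate₂, incl_T₄, T₁_spec, mul_assoc]
  have key : (tmul 1 (incl c)).right ((tmul 1 (incl (d * a)) * H.E).right (k ⊗ₜ e)) =
      (tmul 1 (incl c)).right ((H.sourceTensor (H.T₄ (a ⊗ₜ d))).right (k ⊗ₜ e)) := by
    rw [right_mul, h1, ← left_right H.nondegenerate₂, ← left_right H.nondegenerate₂, tmul_E_right,
      sourceTensor_right]
    have h4 : ∀ w, (tmul 1 (incl c)).right (TensorProduct.map (H.sourceRight k)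
        (LinearMap.mulLeft ℂ e) w) = TensorProduct.map (H.sourceRight k) (LinearMap.mulLeft ℂ e)
          ((tmul 1 (incl c)).right w) := fun w =>
      tensor_hom_congr ((tmul 1 (incl c)).right ∘ₗ TensorProduct.map (H.sourceRight k)
        (LinearMap.mulLeft ℂ e)) (TensorProduct.map (H.sourceRight k) (LinearMap.mulLeft ℂ e) ∘ₗ
          (tmul 1 (incl c)).right) (fun x y => by simp [mul_assoc]) w
    rw [h4, h3]
    refine tensor_hom_congr ((tmul 1 (incl (e * d))).left ∘ₗ
      TensorProduct.map (H.sourceRight k) LinearMap.id) (TensorProduct.map (H.sourceRight k)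
      (LinearMap.mulLeft ℂ e) ∘ₗ (tmul 1 (incl d)).left) (fun x y => ?_) _
    simp [mul_assoc]
  have key2 := congrArg (evalSnd f) key
  rw [evalSnd_right, evalSnd_right, right_one, right_one] at key2
  exact key2

/-- `∑ ε_s(a₍₁₎)S(da₍₂₎) = S(da)`. -/
theorem antipodeMul_T₁_T₄ (a d : A) : H.antipodeMul (H.T₁
    (TensorProduct.map LinearMap.id H.S.toLinearMap (H.T₄ (a ⊗ₜ d)))) = H.S (d * a) := by
  rw [← R₁_tmul, antipodeMul_T₁_R₁, antipodeMul_tmul, S_mul]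

/-- The map `r ⊗ s ↦ S(r)ε_t(s)`. -/
noncomputable def antipodeMulTarget : A ⊗[ℂ] A →ₗ[ℂ] A :=
  TensorProduct.lift (LinearMap.mk₂ ℂ (fun r s => (H.targetMap s).right (H.S r))
    (fun _ _ _ => by simp) (fun _ _ _ => by simp) (fun _ _ _ => by simp) (fun _ _ _ => by simp))

@[simp] theorem antipodeMulTarget_tmul (r s : A) :
    H.antipodeMulTarget (r ⊗ₜ s) = (H.targetMap s).right (H.S r) := rfl

/-- This is ∑ S(a₍₁₎e)ε_t(a₍₂₎) = S(ae). It results from applying x ⊗ z ↦ S(x)z, which ignores E, to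
E(ae ⊗ 1)(b ⊗ c) and cancelling S(b) and c. -/
theorem antipodeMulTarget_T₃ (a e : A) : H.antipodeMulTarget (H.T₃ (a ⊗ₜ e)) = H.S (a * e) := by
  refine H.nondegenerate.left_ext fun c => H.nondegenerate.right_ext fun b => ?_
  obtain ⟨b, rfl⟩ := H.S.surjective b
  have h := congrArg (fun m => H.antipodeMul (left m (b ⊗ₜ[ℂ] c))) (H.E_mul_tmul_one a e)
  beta_reduce at h
  rw [left_mul, antipodeMul_E, targetTensor_left, left_tmul, TensorProduct.map_tmul, left_incl,
    left_one, antipodeMul_tmul, S_mul] at h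
  rw [← mul_assoc (H.S b) (H.S (a * e)) c, h]
  refine tensor_hom_congr (LinearMap.mulLeft ℂ (H.S b) ∘ₗ LinearMap.mulRight ℂ c ∘ₗ
    H.antipodeMulTarget) (H.antipodeMul ∘ₗ TensorProduct.map (LinearMap.mulRight ℂ b)
    (H.targetLeft c)) (fun x y => ?_) _
  simp [S_mul, mul_assoc, compat, right_mul_left H.nondegenerate]

/-- The extension of the antipode to the multiplier algebra. -/
noncomputable def SM : MultiplierAlgebra A →ₗ[ℂ] MultiplierAlgebra A := antiMap H.S H.S_mul

/-- The flip composed with `S ⊗ S`. -/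
noncomputable def flipS : A ⊗[ℂ] A ≃ₗ[ℂ] A ⊗[ℂ] A :=
  TensorProduct.comm ℂ A A ≪≫ₗ TensorProduct.congr H.S H.S

@[simp] theorem flipS_tmul (a b : A) : H.flipS (a ⊗ₜ b) = H.S b ⊗ₜ H.S a := by simp [flipS]

theorem flipS_mul (u v : A ⊗[ℂ] A) : H.flipS (u * v) = H.flipS v * H.flipS u := by
  induction u with
  | zero => simp
  | add x y hx hy => simp only [add_mul, mul_add, map_add, hx, hy]
  | tmul a b =>
    induction v with
    | zero => simp
    | add x y hx hy => simp only [add_mul, mul_add, map_add, hx, hy]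
    | tmul c d => simp [S_mul]

theorem flipS_symm_mul (u v : A ⊗[ℂ] A) :
    H.flipS.symm (u * v) = H.flipS.symm v * H.flipS.symm u := by
  apply H.flipS.injective
  simp [flipS_mul]

/-- The extension of the flip composed with `S ⊗ S` to the multiplier algebra. -/
noncomputable def flipSM : MultiplierAlgebra (A ⊗[ℂ] A) →ₗ[ℂ] MultiplierAlgebra (A ⊗[ℂ] A) :=
  antiMap H.flipS H.flipS_mul

theorem SM_left (m : MultiplierAlgebra A) (a : A) : (H.SM m).left (H.S a) = H.S (m.right a) :=
  antiMap_left _ _ _ _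
theorem SM_right (m : MultiplierAlgebra A) (a : A) : (H.SM m).right (H.S a) = H.S (m.left a) :=
  antiMap_right _ _ _ _
theorem SM_mul (m n : MultiplierAlgebra A) : H.SM (m * n) = H.SM n * H.SM m := antiMap_mul _ _ _ _
theorem SM_incl (a : A) : H.SM (incl a) = incl (H.S a) := antiMap_incl _ _ _
theorem SM_one : H.SM 1 = 1 := antiMap_one _ _
theorem SM_injective : Function.Injective H.SM :=
  Function.LeftInverse.injective (antiMap_symm_apply H.S H.S_mul H.S_symm_mul)
theorem SM_surjective : Function.Surjective H.SM :=
  Function.RightInverse.surjective (antiMap_apply_symm H.S H.S_mul H.S_symm_mul)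
theorem flipSM_left (m : MultiplierAlgebra (A ⊗[ℂ] A)) (u : A ⊗[ℂ] A) :
    (H.flipSM m).left (H.flipS u) = H.flipS (m.right u) := antiMap_left _ _ _ _
theorem flipSM_right (m : MultiplierAlgebra (A ⊗[ℂ] A)) (u : A ⊗[ℂ] A) :
    (H.flipSM m).right (H.flipS u) = H.flipS (m.left u) := antiMap_right _ _ _ _
theorem flipSM_mul (m n : MultiplierAlgebra (A ⊗[ℂ] A)) :
    H.flipSM (m * n) = H.flipSM n * H.flipSM m := antiMap_mul _ _ _ _
theorem flipSM_incl (u : A ⊗[ℂ] A) : H.flipSM (incl u) = incl (H.flipS u) := antiMap_incl _ _ _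
theorem flipSM_injective : Function.Injective H.flipSM :=
  Function.LeftInverse.injective (antiMap_symm_apply H.flipS H.flipS_mul H.flipS_symm_mul)

theorem flipSM_tmul (m n : MultiplierAlgebra A) :
    H.flipSM (tmul m n) = tmul (H.SM n) (H.SM m) := by
  ext x
  · obtain ⟨x, rfl⟩ := H.flipS.surjective x
    rw [flipSM_left]
    refine tensor_hom_congr (H.flipS.toLinearMap ∘ₗ (tmul m n).right)
      ((tmul (H.SM n) (H.SM m)).left ∘ₗ H.flipS.toLinearMap) (fun a b => ?_) x
    simp [SM_left]
  · obtain ⟨x, rfl⟩ := H.flipS.surjective x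
    rw [flipSM_right]
    refine tensor_hom_congr (H.flipS.toLinearMap ∘ₗ (tmul m n).left)
      ((tmul (H.SM n) (H.SM m)).right ∘ₗ H.flipS.toLinearMap) (fun a b => ?_) x
    simp [SM_right]

/-- Slicing the first leg gives S(ya')c = S(a')S(y)c, with a' a slice of b, since y commutes with
slices. -/
theorem R₁_source_left {y : MultiplierAlgebra A} (hy : H.IsSourceLike y) (b c : A) :
    H.R₁ (y.left b ⊗ₜ c) = H.R₁ (b ⊗ₜ (H.SM y).left c) := by
  apply evalFst_mulLeft_ext H.nondegenerate
  intro f k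
  rw [evalFst_R₁, evalFst_R₁, hy.leftSlice_left, ← SM_right, compat]

/-- `E(y ⊗ 1) = E(1 ⊗ S(y))`. -/
theorem E_mul_source {y : MultiplierAlgebra A} (hy : H.IsSourceLike y) :
    H.E * tmul y 1 = H.E * tmul 1 (H.SM y) := by
  apply ext_left H.nondegenerate₂
  refine tensor_hom_congr _ _ fun b c => ?_
  simp only [left_mul, left_tmul, TensorProduct.map_tmul, left_one]
  rw [← T₁_R₁, ← T₁_R₁, R₁_source_left _ hy]

theorem targetMap_source_left {y : MultiplierAlgebra A} (hy : H.IsSourceLike y) (b : A) :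
    H.targetMap (y.left b) = H.targetMap b * H.SM y := by
  apply ext_left H.nondegenerate
  intro c
  rw [left_mul, targetMap_left, targetMap_left, R₁_source_left _ hy]

theorem sourceMap_target_right {x : MultiplierAlgebra A} (hx : H.IsTargetLike x) (b : A) :
    H.sourceMap (x.right b) = H.SM x * H.sourceMap b := by
  apply ext_left H.nondegenerate
  intro c
  rw [left_mul, sourceMap_left, sourceMap_left, hx.T₁_right]
  refine tensor_hom_congr (H.antipodeMul ∘ₗ (tmul x 1).right)
    ((H.SM x).left ∘ₗ H.antipodeMul) (fun a d => ?_) _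
  simp [← SM_left, left_mul_right H.nondegenerate]

/-- `(1 ⊗ x)E = (S(x) ⊗ 1)E`. -/
theorem target_mul_E {x : MultiplierAlgebra A} (hx : H.IsTargetLike x) :
    tmul 1 x * H.E = tmul (H.SM x) 1 * H.E := by
  apply ext_right H.nondegenerate₂
  refine tensor_hom_congr _ _ fun c b => ?_
  apply evalSnd_mulRight_ext H.nondegenerate
  intro f d
  simp only [right_mul, right_tmul, TensorProduct.map_tmul, right_one]
  have key : (tmul 1 (incl d)).right (H.E.right (c ⊗ₜ x.right b)) =
      (tmul 1 (incl d)).right (H.E.right ((H.SM x).right c ⊗ₜ b)) := by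
    rw [tmul_E_right, tmul_E_right, hx.T₁_right]
    refine tensor_hom_congr (TensorProduct.map (H.sourceRight c) LinearMap.id ∘ₗ
      (tmul x 1).right) (TensorProduct.map (H.sourceRight ((H.SM x).right c)) LinearMap.id)
      (fun p q => ?_) _
    simp [sourceMap_target_right _ hx]
  have key2 := congrArg (evalSnd f) key
  rw [evalSnd_right, evalSnd_right, right_one, right_one] at key2
  exact key2

end RegularWeakMultiplierHopfAlgebra

/-! ### The antipode reverses the coproduct, up to E -/

namespace RegularWeakMultiplierHopfAlgebra

open WeakMultiplierHopfAlgebra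

variable {A : Type*} [NonUnitalRing A] [Module ℂ A] [IsScalarTower ℂ A A] [SMulCommClass ℂ A A]
variable (H : RegularWeakMultiplierHopfAlgebra A)

theorem linear_ext_mul {X : Type*} [AddCommGroup X] [Module ℂ X]
    (H : WeakMultiplierHopfAlgebra A) {f g : A →ₗ[ℂ] X} (h : ∀ a b, f (a * b) = g (a * b)) :
    f = g := by
  ext x
  obtain ⟨u, rfl⟩ : x ∈ LinearMap.range (LinearMap.mul' ℂ A) := H.idempotent ▸ Submodule.mem_top
  exact tensor_hom_congr (f ∘ₗ LinearMap.mul' ℂ A) (g ∘ₗ LinearMap.mul' ℂ A) (by simpa using h) u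

theorem linear_ext_mul_mul {X : Type*} [AddCommGroup X] [Module ℂ X]
    (H : WeakMultiplierHopfAlgebra A) {f g : A →ₗ[ℂ] X}
    (h : ∀ a b c, f (a * b * c) = g (a * b * c)) : f = g := by
  apply linear_ext_mul H
  intro a c
  exact LinearMap.congr_fun (linear_ext_mul H (f := f ∘ₗ LinearMap.mulRight ℂ c)
    (g := g ∘ₗ LinearMap.mulRight ℂ c) (fun a b => h a b c)) a

/-- The map `p ⊗ z ↦ ∑ p₍₁₎ ⊗ Δ(p₍₂₎)z` on `A ⊗ (A ⊗ A)`. -/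
noncomputable def iteratedT₁ : A ⊗[ℂ] (A ⊗[ℂ] A) →ₗ[ℂ] A ⊗[ℂ] (A ⊗[ℂ] A) :=
  TensorProduct.map LinearMap.id H.T₁ ∘ₗ (TensorProduct.assoc ℂ A A A).toLinearMap ∘ₗ
    TensorProduct.map H.T₁ LinearMap.id ∘ₗ (TensorProduct.assoc ℂ A A A).symm.toLinearMap ∘ₗ
      TensorProduct.map LinearMap.id H.R₁

/-- The map `p ⊗ z ↦ Δ(L(p))z` on `A ⊗ (A ⊗ A)`. -/
noncomputable def actΔ (L : A →ₗ[ℂ] A) : A ⊗[ℂ] (A ⊗[ℂ] A) →ₗ[ℂ] A ⊗[ℂ] A :=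
  TensorProduct.lift (LinearMap.mk₂ ℂ (fun p z => (H.Δ (L p)).left z)
    (fun _ _ _ => by simp) (fun _ _ _ => by simp) (fun _ _ _ => by simp) (fun _ _ _ => by simp))

@[simp] theorem actΔ_tmul (L : A →ₗ[ℂ] A) (p : A) (z : A ⊗[ℂ] A) :
    H.actΔ L (p ⊗ₜ z) = (H.Δ (L p)).left z := rfl

/-- ∑ Δ(S(p₍₁₎))Δ(p₍₂₎)z = ∑ Δ(S(p₍₁₎)p₍₂₎)z, and ε_s(p) passes through Δ as 1 ⊗ ε_s(p). -/
theorem actΔ_iteratedT₁ (p : A) (z : A ⊗[ℂ] A) :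
    H.actΔ H.S.toLinearMap (H.iteratedT₁ (p ⊗ₜ z)) =
      (tmul 1 (H.sourceMap p)).left (H.E.left z) := by
  rw [← T₁_R₁]
  simp only [iteratedT₁, LinearMap.comp_apply, TensorProduct.map_tmul, LinearMap.id_apply,
    LinearEquiv.coe_coe]
  refine tensor_hom_congr (H.actΔ H.S.toLinearMap ∘ₗ TensorProduct.map LinearMap.id H.T₁ ∘ₗ
    (TensorProduct.assoc ℂ A A A).toLinearMap ∘ₗ TensorProduct.map H.T₁ LinearMap.id ∘ₗ
    (TensorProduct.assoc ℂ A A A).symm.toLinearMap ∘ₗ TensorProduct.mk ℂ A (A ⊗[ℂ] A) p)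
    ((tmul 1 (H.sourceMap p)).left ∘ₗ H.T₁) (fun x y => ?_) (H.R₁ z)
  simp only [LinearMap.comp_apply, TensorProduct.mk_apply, LinearEquiv.coe_coe,
    TensorProduct.assoc_symm_tmul, TensorProduct.map_tmul, LinearMap.id_apply]
  rw [← (H.isSourceLike_sourceMap p).T₁_left, sourceMap_left]
  refine tensor_hom_congr (H.actΔ H.S.toLinearMap ∘ₗ TensorProduct.map LinearMap.id H.T₁ ∘ₗ
    (TensorProduct.assoc ℂ A A A).toLinearMap ∘ₗ (TensorProduct.mk ℂ (A ⊗[ℂ] A) A).flip y)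
    (H.T₁ ∘ₗ (TensorProduct.mk ℂ A A).flip y ∘ₗ H.antipodeMul) (fun s t => ?_) _
  simp [Δ_left_T₁]

theorem evalFst_iteratedT₁ (f : A →ₗ[ℂ] ℂ) (k : A) (w : A ⊗[ℂ] (A ⊗[ℂ] A)) :
    evalFst (f ∘ₗ LinearMap.mulLeft ℂ k) (H.iteratedT₁ w) = H.actΔ (H.leftSlice f k) w := by
  refine tensor_hom_congr (evalFst (f ∘ₗ LinearMap.mulLeft ℂ k) ∘ₗ H.iteratedT₁)
    (H.actΔ (H.leftSlice f k)) (fun p z => ?_) w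
  rw [actΔ_tmul, ← Δ_left_E_left, ← T₁_R₁]
  simp only [iteratedT₁, LinearMap.comp_apply, TensorProduct.map_tmul, LinearMap.id_apply,
    LinearEquiv.coe_coe]
  refine tensor_hom_congr (evalFst (f ∘ₗ LinearMap.mulLeft ℂ k) ∘ₗ
    TensorProduct.map LinearMap.id H.T₁ ∘ₗ
    (TensorProduct.assoc ℂ A A A).toLinearMap ∘ₗ TensorProduct.map H.T₁ LinearMap.id ∘ₗ
    (TensorProduct.assoc ℂ A A A).symm.toLinearMap ∘ₗ TensorProduct.mk ℂ A (A ⊗[ℂ] A) p)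
    ((H.Δ (H.leftSlice f k p)).left ∘ₗ H.T₁) (fun x y => ?_) (H.R₁ z)
  simp only [LinearMap.comp_apply, TensorProduct.mk_apply, LinearEquiv.coe_coe,
    TensorProduct.assoc_symm_tmul, TensorProduct.map_tmul, LinearMap.id_apply]
  rw [Δ_left_T₁, ← evalFst_T₁]
  refine tensor_hom_congr (evalFst (f ∘ₗ LinearMap.mulLeft ℂ k) ∘ₗ
    TensorProduct.map LinearMap.id H.T₁ ∘ₗ
    (TensorProduct.assoc ℂ A A A).toLinearMap ∘ₗ (TensorProduct.mk ℂ (A ⊗[ℂ] A) A).flip y)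
    (H.T₁ ∘ₗ (TensorProduct.mk ℂ A A).flip y ∘ₗ evalFst (f ∘ₗ LinearMap.mulLeft ℂ k))
    (fun s t => ?_) _
  simp [← TensorProduct.smul_tmul']

/-- The map `p ⊗ q ↦ ∑ p₍₁₎ ⊗ (q ⊗ S(p₍₂₎)d)`. -/
noncomputable def insertR₁ (d : A) : A ⊗[ℂ] A →ₗ[ℂ] A ⊗[ℂ] (A ⊗[ℂ] A) :=
  (TensorProduct.leftComm ℂ A A A).toLinearMap ∘ₗ
    TensorProduct.map LinearMap.id (H.R₁ ∘ₗ (TensorProduct.mk ℂ A A).flip d) ∘ₗ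
      (TensorProduct.comm ℂ A A).toLinearMap

theorem insertR₁_tmul (d p q : A) : H.insertR₁ d (p ⊗ₜ q) =
    TensorProduct.leftComm ℂ A A A (q ⊗ₜ H.R₁ (p ⊗ₜ d)) := by simp [insertR₁]

/-- In Sweedler notation, ∑ a₍₁₎ ⊗ Δ(a₍₂₎)(S(a₍₄₎)c ⊗ S(a₍₃₎)d) = ∑ a₍₁₎ ⊗ E(a₍₂₎S(a₍₃₎)c ⊗ d),
because ∑ Δ(p₍₁₎)(1 ⊗ S(p₍₂₎)d) = E(p ⊗ d). -/
theorem iteratedT₁_insertR₁ (a c d : A) : H.iteratedT₁ (H.insertR₁ d (H.R₁ (a ⊗ₜ c))) =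
    TensorProduct.map LinearMap.id (H.E.left ∘ₗ (TensorProduct.mk ℂ A A).flip d)
      (H.E.left (a ⊗ₜ c)) := by
  apply evalFst_mulLeft_ext H.nondegenerate
  intro f k
  rw [evalFst_iteratedT₁, evalFst_map, LinearMap.comp_id, evalFst_E_left, targetMap_left,
    R₁_leftSlice]
  refine tensor_hom_congr (H.actΔ (H.leftSlice f k) ∘ₗ H.insertR₁ d)
    ((H.E.left ∘ₗ (TensorProduct.mk ℂ A A).flip d) ∘ₗ LinearMap.mul' ℂ A ∘ₗ
      TensorProduct.map (H.leftSlice f k) LinearMap.id) (fun p q => ?_) _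
  simp only [LinearMap.comp_apply, TensorProduct.map_tmul, LinearMap.id_apply, LinearMap.flip_apply,
    TensorProduct.mk_apply, LinearMap.mul'_apply, insertR₁_tmul]
  have h : (H.leftSlice f k p * q) ⊗ₜ[ℂ] d =
      (tmul (incl q) 1).right (H.leftSlice f k p ⊗ₜ d) := by simp
  rw [h, left_right H.nondegenerate₂, ← T₁_R₁, R₁_leftSlice]
  refine tensor_hom_congr (H.actΔ (H.leftSlice f k) ∘ₗ
    (TensorProduct.leftComm ℂ A A A).toLinearMap ∘ₗ TensorProduct.mk ℂ A (A ⊗[ℂ] A) q)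
    ((tmul (incl q) 1).right ∘ₗ H.T₁ ∘ₗ TensorProduct.map (H.leftSlice f k) LinearMap.id)
    (fun x y => ?_) _
  simp [Δ_left_tmul]

theorem flipSM_Δ_left (a c d : A) : (H.flipSM (H.Δ a)).left (c ⊗ₜ d) =
    TensorProduct.map LinearMap.id (LinearMap.mulRight ℂ d ∘ₗ H.S.toLinearMap)
      (TensorProduct.comm ℂ A A (H.R₁ (a ⊗ₜ c))) := by
  obtain ⟨c, rfl⟩ := H.S.surjective c
  obtain ⟨d, rfl⟩ := H.S.surjective d
  rw [← flipS_tmul, flipSM_left, R₁_tmul, Δ_right_tmul, ← T₄_left]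
  refine tensor_hom_congr (H.flipS.toLinearMap ∘ₗ (tmul (incl d) 1).left)
    (TensorProduct.map LinearMap.id (LinearMap.mulRight ℂ (H.S d) ∘ₗ H.S.toLinearMap) ∘ₗ
      (TensorProduct.comm ℂ A A).toLinearMap ∘ₗ TensorProduct.map LinearMap.id H.S.toLinearMap)
    (fun x y => ?_) _
  simp [S_mul]

/-- With E(a ⊗ c) expanded by `iteratedT₁_insertR₁`, the left side becomes ∑
Δ(S(a₍₁₎))Δ(a₍₂₎)(S(a₍₄₎)c ⊗ S(a₍₃₎)d) = ∑ E(S(a₍₃₎)c ⊗ ε_s(a₍₁₎)S(a₍₂₎)d), and ∑ ε_s(a₍₁₎)S(a₍₂₎)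
collapses to S(a). -/
theorem actΔ_E_left (a c d : A) :
    H.actΔ H.S.toLinearMap (TensorProduct.map LinearMap.id ((TensorProduct.mk ℂ A A).flip d)
      (H.E.left (a ⊗ₜ c))) = (H.E * H.flipSM (H.Δ a)).left (c ⊗ₜ d) := by
  have h1 : H.actΔ H.S.toLinearMap (TensorProduct.map LinearMap.id
      ((TensorProduct.mk ℂ A A).flip d) (H.E.left (a ⊗ₜ c))) = H.actΔ H.S.toLinearMap
      (TensorProduct.map LinearMap.id (H.E.left ∘ₗ (TensorProduct.mk ℂ A A).flip d)
      (H.E.left (a ⊗ₜ c))) :=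
    tensor_hom_congr (H.actΔ H.S.toLinearMap ∘ₗ TensorProduct.map LinearMap.id
      ((TensorProduct.mk ℂ A A).flip d)) (H.actΔ H.S.toLinearMap ∘ₗ
      TensorProduct.map LinearMap.id (H.E.left ∘ₗ (TensorProduct.mk ℂ A A).flip d))
      (fun x y => by simp [Δ_left_E_left]) _
  rw [h1, ← iteratedT₁_insertR₁, left_mul, flipSM_Δ_left]
  refine tensor_hom_congr (H.actΔ H.S.toLinearMap ∘ₗ H.iteratedT₁ ∘ₗ H.insertR₁ d)
    (H.E.left ∘ₗ TensorProduct.map LinearMap.id (LinearMap.mulRight ℂ d ∘ₗ H.S.toLinearMap) ∘ₗ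
      (TensorProduct.comm ℂ A A).toLinearMap) (fun p q => ?_) _
  simp only [LinearMap.comp_apply, insertR₁_tmul, LinearEquiv.coe_coe, TensorProduct.comm_tmul,
    TensorProduct.map_tmul, LinearMap.id_apply, LinearMap.mulRight_apply]
  rw [← antipodeMul_tmul, ← antipodeMul_T₁_R₁]
  refine tensor_hom_congr (H.actΔ H.S.toLinearMap ∘ₗ H.iteratedT₁ ∘ₗ
    (TensorProduct.leftComm ℂ A A A).toLinearMap ∘ₗ TensorProduct.mk ℂ A (A ⊗[ℂ] A) q)
    (H.E.left ∘ₗ TensorProduct.mk ℂ A A q ∘ₗ H.antipodeMul ∘ₗ H.T₁) (fun r s => ?_) _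
  simp only [LinearMap.comp_apply, LinearEquiv.coe_coe, TensorProduct.mk_apply,
    TensorProduct.leftComm_tmul]
  rw [actΔ_iteratedT₁, ← left_mul, ← E_mul_tmul_source _ (H.isSourceLike_sourceMap r),
    ← sourceMap_left]
  simp

/-- `Δ(S(a)) = E (S ⊗ S)Δ(a)^{op}`. -/
theorem Δ_S_eq_E_mul (a : A) : H.Δ (H.S a) = H.E * H.flipSM (H.Δ a) := by
  have key : (H.Δ : A →ₗ[ℂ] MultiplierAlgebra (A ⊗[ℂ] A)) ∘ₗ H.S.toLinearMap =
      LinearMap.mulLeft ℂ H.E ∘ₗ H.flipSM ∘ₗ (H.Δ : A →ₗ[ℂ] MultiplierAlgebra (A ⊗[ℂ] A)) := by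
    -- A = A³ allows the argument to be written aeb. Then E(aeb ⊗ c) = ∑ a₍₁₎eb ⊗ ε_t(a₍₂₎)c, and ∑
    -- Δ(S(a₍₁₎eb))(ε_t(a₍₂₎)c ⊗ d) = Δ(S(b))Δ(∑ S(a₍₁₎e)ε_t(a₍₂₎))(c ⊗ d).
    apply linear_ext_mul_mul H.toWeakMultiplierHopfAlgebra
    intro a e b
    change H.Δ (H.S (a * e * b)) = H.E * H.flipSM (H.Δ (a * e * b))
    apply ext_left H.nondegenerate₂
    refine tensor_hom_congr _ _ fun c d => ?_
    rw [← actΔ_E_left]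
    have h := congrArg (fun m => left m (b ⊗ₜ[ℂ] c)) (H.E_mul_tmul_one a e)
    beta_reduce at h
    rw [left_mul, targetTensor_left, left_tmul, TensorProduct.map_tmul, left_incl, left_one] at h
    rw [h, S_mul, ← antipodeMulTarget_T₃, map_mul, left_mul]
    refine tensor_hom_congr ((H.Δ (H.S b)).left ∘ₗ
      H.actΔ LinearMap.id ∘ₗ (TensorProduct.mk ℂ A (A ⊗[ℂ] A)).flip (c ⊗ₜ d) ∘ₗ
        H.antipodeMulTarget)
      (H.actΔ H.S.toLinearMap ∘ₗ (TensorProduct.map LinearMap.id ((TensorProduct.mk ℂ A A).flip d))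
        ∘ₗ (TensorProduct.map (LinearMap.mulRight ℂ b) (H.targetLeft c))) (fun r s => ?_) _
    simp only [LinearMap.comp_apply, LinearMap.flip_apply, TensorProduct.mk_apply, actΔ_tmul,
      LinearMap.id_apply, antipodeMulTarget_tmul, TensorProduct.map_tmul, LinearMap.mulRight_apply,
      targetLeft_apply, LinearEquiv.coe_coe, S_mul, map_mul,
      (H.isTargetLike_targetMap s).right, left_mul, left_tmul, left_one]
  exact LinearMap.congr_fun key a

end RegularWeakMultiplierHopfAlgebra

/-! ### S exchanges ε_s and ε_t, and the flip of S ⊗ S fixes E -/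

namespace RegularWeakMultiplierHopfAlgebra

open WeakMultiplierHopfAlgebra

variable {A : Type*} [NonUnitalRing A] [Module ℂ A] [IsScalarTower ℂ A A] [SMulCommClass ℂ A A]
variable (H : RegularWeakMultiplierHopfAlgebra A)

theorem antipodeMul_flipS (u : A ⊗[ℂ] A) : H.antipodeMul (H.flipS u) = H.S (H.mulAntipode u) :=
  tensor_hom_congr (H.antipodeMul ∘ₗ H.flipS.toLinearMap) (H.S.toLinearMap ∘ₗ H.mulAntipode)
    (fun a b => by simp [S_mul]) u

theorem mulAntipode_flipS (u : A ⊗[ℂ] A) : H.mulAntipode (H.flipS u) = H.S (H.antipodeMul u) :=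
  tensor_hom_congr (H.mulAntipode ∘ₗ H.flipS.toLinearMap) (H.S.toLinearMap ∘ₗ H.antipodeMul)
    (fun a b => by simp [S_mul]) u

theorem mulAntipode_Δ_right (a c d : A) : H.mulAntipode ((H.Δ a).right (c ⊗ₜ d)) =
    (H.targetMap a).right c * H.S d := by
  rw [Δ_right_tmul, targetMap_right]
  refine tensor_hom_congr (H.mulAntipode ∘ₗ (tmul 1 (incl d)).left)
    (LinearMap.mulRight ℂ (H.S d) ∘ₗ H.mulAntipode) (fun x y => ?_) _
  simp [S_mul, mul_assoc]

theorem antipodeMul_Δ_left (a c d : A) : H.antipodeMul ((H.Δ a).left (c ⊗ₜ d)) =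
    H.S c * (H.sourceMap a).left d := by
  rw [Δ_left_tmul, antipodeMul_right_T₁, sourceMap_left]

/-- `S(ε_t(a)) = ε_s(S(a))`. -/
theorem SM_targetMap (a : A) : H.SM (H.targetMap a) = H.sourceMap (H.S a) := by
  apply ext_left H.nondegenerate
  intro c
  refine H.nondegenerate.right_ext fun b => ?_
  obtain ⟨b, rfl⟩ := H.S.surjective b
  obtain ⟨c, rfl⟩ := H.S.surjective c
  obtain ⟨b, rfl⟩ := H.S.surjective b
  rw [← antipodeMul_Δ_left, Δ_S_eq_E_mul, left_mul, antipodeMul_E, ← flipS_tmul, flipSM_left,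
    antipodeMul_flipS, mulAntipode_Δ_right, S_mul, SM_left]

theorem mulAntipode_flipSM_Δ_right (a x y : A) :
    H.mulAntipode ((H.flipSM (H.Δ a)).right (x ⊗ₜ y)) = (H.SM (H.sourceMap a)).right x * H.S y := by
  obtain ⟨x, rfl⟩ := H.S.surjective x
  obtain ⟨y, rfl⟩ := H.S.surjective y
  rw [← flipS_tmul, flipSM_right, mulAntipode_flipS, antipodeMul_Δ_left, S_mul, SM_right]

/-- The hypothesis says E(b ⊗ c) = 0 for all b. Hence R₁(b ⊗ c) = 0, whose slices are the S(a')c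
with a' a slice of b; these a' span A and S is onto. -/
theorem left_eq_zero_of_targetMap (c : A) (h : ∀ b, (H.targetMap b).left c = 0) : c = 0 := by
  have h1 : ∀ b, H.R₁ (b ⊗ₜ c) = 0 := fun b => by
    rw [← R₁_E]
    have : H.E.left (b ⊗ₜ c) = 0 := by
      apply evalFst_mulLeft_ext H.nondegenerate
      intro f k
      rw [evalFst_E_left, h, map_zero]
    rw [this, map_zero]
  have h2 : H.S.toLinearMap.range ≤ (LinearMap.mulRight ℂ c).ker := by
    have : LinearMap.mulRight ℂ c ∘ₗ H.S.toLinearMap = 0 := by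
      apply leftSlice_hom_ext (H := H.toWeakMultiplierHopfAlgebra)
      intro f k a
      simp [← evalFst_R₁, h1]
    rintro _ ⟨x, rfl⟩
    exact LinearMap.congr_fun this x
  refine H.nondegenerate_right c fun b => ?_
  exact h2 (by simp : b ∈ _)

/-- At this stage S(y) is not known to be target-like. However ε_t(b)S(y) = ε_t(yb) commutes with z,
and the factor ε_t(b) can be cancelled. -/
theorem SM_source_mul_comm {y z : MultiplierAlgebra A} (hy : H.IsSourceLike y)
    (hz : H.IsSourceLike z) : H.SM y * z = z * H.SM y := by
  apply ext_left H.nondegenerate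
  intro c
  rw [← sub_eq_zero]
  apply H.left_eq_zero_of_targetMap
  intro b
  have h : H.targetMap b * (H.SM y * z) = H.targetMap b * (z * H.SM y) := by
    rw [← mul_assoc, ← targetMap_source_left _ hy, (H.isTargetLike_targetMap _).mul_comm hz,
      targetMap_source_left _ hy, ← mul_assoc, ← mul_assoc, (H.isTargetLike_targetMap _).mul_comm hz]
  have h' := congrArg (fun m => left m c) h
  simpa [sub_eq_zero] using h'

/-- `S(ε_s(a)) = ε_t(S(a))`. -/
theorem SM_sourceMap (a : A) : H.SM (H.sourceMap a) = H.targetMap (H.S a) := by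
  apply ext_right H.nondegenerate
  intro c
  refine H.nondegenerate.left_ext fun s => ?_
  obtain ⟨s, rfl⟩ := H.S.surjective s
  have key : LinearMap.mulLeft ℂ ((H.SM (H.sourceMap a)).right c) ∘ₗ H.S.toLinearMap =
      LinearMap.mulLeft ℂ ((H.targetMap (H.S a)).right c) ∘ₗ H.S.toLinearMap := by
    -- The argument eda' is chosen so that (1 ⊗ da')E = ∑ ε_s(a'₍₁₎) ⊗ da'₍₂₎ absorbs the E of
    -- `Δ_S_eq_E_mul`. Once S(ε_s(a)) has been commuted past ε_s(a'₍₁₎), the sum ∑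
    -- ε_s(a'₍₁₎)S(da'₍₂₎) is S(da').
    apply linear_ext_mul_mul H.toWeakMultiplierHopfAlgebra
    intro e d a'
    simp only [LinearMap.comp_apply, LinearMap.mulLeft_apply, LinearEquiv.coe_coe]
    rw [← mulAntipode_Δ_right, Δ_S_eq_E_mul, right_mul]
    have h := congrArg (fun m => right m (c ⊗ₜ[ℂ] e)) (H.tmul_one_mul_E a' d)
    beta_reduce at h
    rw [right_mul, sourceTensor_right, right_tmul, TensorProduct.map_tmul, right_incl, right_one,
      ← mul_assoc] at h
    rw [h, mul_assoc e d a', S_mul, ← antipodeMul_T₁_T₄, ← mul_assoc]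
    refine tensor_hom_congr (LinearMap.mulRight ℂ (H.S e) ∘ₗ
      LinearMap.mulLeft ℂ ((H.SM (H.sourceMap a)).right c) ∘ₗ H.antipodeMul ∘ₗ H.T₁ ∘ₗ
      TensorProduct.map LinearMap.id H.S.toLinearMap) (H.mulAntipode ∘ₗ
      (H.flipSM (H.Δ a)).right ∘ₗ TensorProduct.map (H.sourceRight c) (LinearMap.mulLeft ℂ e))
      (fun p q => ?_) _
    simp only [LinearMap.comp_apply, LinearMap.mulLeft_apply, LinearMap.mulRight_apply,
      TensorProduct.map_tmul, LinearMap.id_apply, LinearEquiv.coe_coe]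
    rw [mulAntipode_flipSM_Δ_right, ← sourceMap_left, compat, ← right_mul,
      H.SM_source_mul_comm (H.isSourceLike_sourceMap a) (H.isSourceLike_sourceMap p), S_mul,
      mul_assoc]
    rfl
  exact LinearMap.congr_fun key s

theorem SM_targetMap_symm (a : A) : H.SM (H.targetMap (H.S.symm a)) = H.sourceMap a := by
  rw [SM_targetMap, LinearEquiv.apply_symm_apply]

theorem SM_sourceMap_symm (a : A) : H.SM (H.sourceMap (H.S.symm a)) = H.targetMap a := by
  rw [SM_sourceMap, LinearEquiv.apply_symm_apply]

theorem sourceMap_left_S (a b : A) :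
    (H.sourceMap a).left (H.S b) = H.S ((H.targetMap (H.S.symm a)).right b) := by
  rw [← SM_targetMap_symm, SM_left]

theorem E_right_tmul_source (n x b : A) :
    H.E.right (x ⊗ₜ H.S.symm ((H.sourceMap n).left (H.S b))) =
      H.E.right ((H.sourceMap n).right x ⊗ₜ b) := by
  have h := congrArg (fun m => right m (x ⊗ₜ[ℂ] b))
    (H.target_mul_E (H.isTargetLike_targetMap (H.S.symm n)))
  beta_reduce at h
  rw [SM_targetMap_symm] at h
  simpa [sourceMap_left_S] using h

theorem G₁_left (a b c : A) : (tmul (incl c) 1).left (H.G₁ (a ⊗ₜ b)) =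
    TensorProduct.map LinearMap.id (H.sourceLeft b) (H.T₂ (c ⊗ₜ a)) := by
  apply evalFst_ext
  intro f
  rw [evalFst_left, evalFst_map, LinearMap.comp_id, left_one]
  exact H.evalFst_G₁ f c a b

/-- ∑ ca₍₁₎S(a₍₂₎)a₍₃₎ = ca: multiplication is (ι ⊗ ε)T₂, and T₂R₂T₂ = T₂. -/
theorem mul_R₂_T₂ (c a : A) : LinearMap.mul' ℂ A (H.R₂ (H.T₂ (c ⊗ₜ a))) = c * a := by
  have h : ∀ u, LinearMap.mul' ℂ A u = evalSnd H.ε (H.T₂ u) := fun u =>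
    tensor_hom_congr (LinearMap.mul' ℂ A) (evalSnd H.ε ∘ₗ H.T₂)
      (fun x y => (H.counit_right x y).symm) u
  rw [h, T₂_R₂, E_right_T₂, ← h, LinearMap.mul'_apply]

theorem E_right_T₄ (u : A ⊗[ℂ] A) : H.E.right (H.T₄ u) = H.T₄ u := by
  refine tensor_hom_congr (H.E.right ∘ₗ H.T₄) H.T₄ (fun a b => ?_) u
  apply incl_injective H.nondegenerate₂
  rw [LinearMap.comp_apply, incl_right H.nondegenerate₂, incl_T₄, mul_assoc, Δ_mul_E]

theorem map_S_E_right_R₁ (u : A ⊗[ℂ] A) : TensorProduct.map LinearMap.id H.S.toLinearMap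
    (H.E.right (TensorProduct.map LinearMap.id H.S.symm.toLinearMap (H.R₁ u))) = H.R₁ u := by
  refine tensor_hom_congr (TensorProduct.map LinearMap.id H.S.toLinearMap ∘ₗ H.E.right ∘ₗ
    TensorProduct.map LinearMap.id H.S.symm.toLinearMap ∘ₗ H.R₁) H.R₁ (fun a b => ?_) u
  obtain ⟨b, rfl⟩ := H.S.surjective b
  simp only [LinearMap.comp_apply]
  rw [← T₄_tmul, E_right_T₄, R₁_tmul]

theorem map_S_symm_left (c : A) (u : A ⊗[ℂ] A) :
    TensorProduct.map LinearMap.id H.S.symm.toLinearMap ((tmul (incl c) 1).left u) =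
      (tmul (incl c) 1).left (TensorProduct.map LinearMap.id H.S.symm.toLinearMap u) :=
  tensor_hom_congr (TensorProduct.map LinearMap.id H.S.symm.toLinearMap ∘ₗ (tmul (incl c) 1).left)
    ((tmul (incl c) 1).left ∘ₗ TensorProduct.map LinearMap.id H.S.symm.toLinearMap)
    (fun x y => by simp) u

theorem map_S_left (c : A) (u : A ⊗[ℂ] A) :
    TensorProduct.map LinearMap.id H.S.toLinearMap ((tmul (incl c) 1).left u) =
      (tmul (incl c) 1).left (TensorProduct.map LinearMap.id H.S.toLinearMap u) :=
  tensor_hom_congr (TensorProduct.map LinearMap.id H.S.toLinearMap ∘ₗ (tmul (incl c) 1).left)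
    ((tmul (incl c) 1).left ∘ₗ TensorProduct.map LinearMap.id H.S.toLinearMap)
    (fun x y => by simp) u

/-- `G₁ (ι ⊗ S) = (ι ⊗ S)(·E)`. -/
theorem G₁_tmul_S (a b : A) : H.G₁ (a ⊗ₜ H.S b) =
    TensorProduct.map LinearMap.id H.S.toLinearMap (H.E.right (a ⊗ₜ b)) := by
  have h1 : ∀ c, (tmul (incl c) 1).left (H.G₁ (a ⊗ₜ H.S b)) = (tmul (incl c) 1).left
      (TensorProduct.map LinearMap.id H.S.toLinearMap (H.E.right (a ⊗ₜ b))) := fun c => by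
    -- G₁ = R₁T₁ takes values in the range of R₁, where (ι ⊗ S)(·E)(ι ⊗ S⁻¹) is the identity. In
    -- front of E the element ε_s(a₍₂₎) moves from the second leg to the first, and ∑ ca₍₁₎ε_s(a₍₂₎)
    -- = ca.
    rw [← R₁_T₁, ← map_S_E_right_R₁, R₁_T₁, ← map_S_left, ← map_S_left,
      left_right H.nondegenerate₂, left_right H.nondegenerate₂, ← map_S_symm_left, G₁_left]
    congr 1
    simp only [left_tmul, TensorProduct.map_tmul, left_incl, left_one]
    rw [← mul_R₂_T₂]
    refine tensor_hom_congr (H.E.right ∘ₗ TensorProduct.map LinearMap.id H.S.symm.toLinearMap ∘ₗ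
      TensorProduct.map LinearMap.id (H.sourceLeft (H.S b)))
      (H.E.right ∘ₗ (TensorProduct.mk ℂ A A).flip b ∘ₗ LinearMap.mul' ℂ A ∘ₗ H.R₂)
      (fun p q => ?_) _
    simp only [LinearMap.comp_apply, TensorProduct.map_tmul, LinearMap.id_apply,
      LinearEquiv.coe_coe, sourceLeft_apply, LinearMap.flip_apply, TensorProduct.mk_apply]
    rw [E_right_tmul_source, sourceMap_right]
  apply evalFst_mulLeft_ext H.nondegenerate
  intro f c
  have := congrArg (evalFst f) (h1 c)
  rw [evalFst_left, evalFst_left] at this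
  exact this

/-- `(ea ⊗ 1)E = ∑ ea₍₁₎ ⊗ ε_t(S⁻¹(a₍₂₎))`. -/
theorem tmul_mul_E (e a : A) : tmul (incl (e * a)) 1 * H.E = H.targetTensor
    (TensorProduct.map LinearMap.id H.S.symm.toLinearMap (H.T₂ (e ⊗ₜ a))) := by
  apply ext_right H.nondegenerate₂
  refine tensor_hom_congr _ _ fun k b => ?_
  have hinj : Function.Injective (TensorProduct.map (LinearMap.id : A →ₗ[ℂ] A) H.S.toLinearMap) :=
    (TensorProduct.congr (LinearEquiv.refl ℂ A) H.S).injective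
  -- Applying ι ⊗ S turns right multiplication by E into G₁, whose Sweedler form is known.
  apply hinj
  have h1 : (k * (e * a)) ⊗ₜ[ℂ] b = (tmul (incl k) 1).left ((tmul (incl e) 1).left (a ⊗ₜ b)) := by
    simp
  rw [right_mul, right_tmul, TensorProduct.map_tmul, right_incl, right_one, h1,
    ← left_right H.nondegenerate₂, ← left_right H.nondegenerate₂, map_S_left, map_S_left,
    ← G₁_tmul_S, G₁_left, targetTensor_right]
  refine tensor_hom_congr ((tmul (incl k) 1).left ∘ₗ
    TensorProduct.map LinearMap.id (H.sourceLeft (H.S b)))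
    (TensorProduct.map LinearMap.id H.S.toLinearMap ∘ₗ
      TensorProduct.map (LinearMap.mulLeft ℂ k) (H.targetRight b) ∘ₗ
      TensorProduct.map LinearMap.id H.S.symm.toLinearMap) (fun p q => ?_) _
  simp [sourceMap_left_S]

/-- (A ⊗ A)E is spanned by the (c ⊗ 1)Δ(a). -/
theorem eq_of_Δ_mul {m n : MultiplierAlgebra (A ⊗[ℂ] A)} (h : ∀ a, H.Δ a * m = H.Δ a * n) :
    H.E * m = H.E * n := by
  apply ext_right H.nondegenerate₂
  intro u
  simp only [right_mul]
  rw [← T₂_R₂]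
  refine tensor_hom_congr (m.right ∘ₗ H.T₂) (n.right ∘ₗ H.T₂) (fun c a => ?_) _
  apply incl_injective H.nondegenerate₂
  simp only [LinearMap.comp_apply]
  rw [incl_right H.nondegenerate₂, incl_right H.nondegenerate₂, T₂_spec, mul_assoc, h, mul_assoc]

/-- Every Δ(S(a)) = E·`flipSM (Δ a)` is fixed under right multiplication by `flipSM E`, since EΔ(a)
= Δ(a); and S is onto. -/
theorem E_mul_flipSM_E : H.E * H.flipSM H.E = H.E := by
  have := H.eq_of_Δ_mul (m := H.flipSM H.E) (n := 1) fun a => by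
    obtain ⟨a, rfl⟩ := H.S.surjective a
    rw [Δ_S_eq_E_mul, mul_assoc, ← flipSM_mul, E_mul_Δ, mul_one]
  rwa [mul_one] at this

theorem source_mul_flipSM_E (p : A) : tmul (H.sourceMap p) 1 * H.flipSM H.E =
    tmul 1 (H.targetMap (H.S.symm p)) * H.flipSM H.E := by
  have h := congrArg H.flipSM (H.E_mul_source (H.isSourceLike_sourceMap (H.S.symm (H.S.symm p))))
  rw [flipSM_mul, flipSM_mul, flipSM_tmul, flipSM_tmul, SM_sourceMap_symm, SM_targetMap_symm,
    SM_one] at h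
  exact h.symm

/-- Multiplied by 1 ⊗ da, the first factor becomes ∑ ε_s(a₍₁₎) ⊗ da₍₂₎. In front of `flipSM E` the
element ε_s(a₍₁₎) may be moved to the second leg as ε_t(S⁻¹(a₍₁₎)), and ∑ da₍₂₎ε_t(S⁻¹(a₍₁₎)) = da
is S⁻¹ applied to `antipodeMul_T₁_T₄`. -/
theorem E_mul_flipSM_E' : H.E * H.flipSM H.E = H.flipSM H.E := by
  have h1 : ∀ a d, tmul 1 (incl (d * a)) * H.E * H.flipSM H.E =
      tmul 1 (incl (d * a)) * H.flipSM H.E := fun a d => by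
    rw [tmul_one_mul_E]
    let R : A ⊗[ℂ] A →ₗ[ℂ] A := TensorProduct.lift (LinearMap.mk₂ ℂ
      (fun p q => (H.targetMap (H.S.symm p)).right q)
      (fun _ _ _ => by simp) (fun _ _ _ => by simp) (fun _ _ _ => by simp) (fun _ _ _ => by simp))
    have hR : ∀ w, H.S (R w) = H.antipodeMul (H.T₁
        (TensorProduct.map LinearMap.id H.S.toLinearMap w)) := fun w =>
      tensor_hom_congr (H.S.toLinearMap ∘ₗ R) (H.antipodeMul ∘ₗ H.T₁ ∘ₗ
        TensorProduct.map LinearMap.id H.S.toLinearMap) (fun p q => by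
          simp [R, ← sourceMap_left_S, sourceMap_left]) w
    have h2 : R (H.T₄ (a ⊗ₜ d)) = d * a := by
      apply H.S.injective
      rw [hR, antipodeMul_T₁_T₄]
    rw [← h2]
    refine tensor_hom_congr (LinearMap.mulRight ℂ (H.flipSM H.E) ∘ₗ H.sourceTensor)
      (LinearMap.mulRight ℂ (H.flipSM H.E) ∘ₗ tmul 1 ∘ₗ incl ∘ₗ R) (fun p q => ?_) _
    have h3 : tmul (H.sourceMap p) (incl q) = tmul 1 (incl q) * tmul (H.sourceMap p) 1 := by
      rw [← tmul_mul, one_mul, mul_one]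
    simp only [LinearMap.comp_apply, LinearMap.mulRight_apply, sourceTensor_tmul]
    rw [h3, mul_assoc, source_mul_flipSM_E, ← mul_assoc, ← tmul_mul, one_mul,
      ← incl_right H.nondegenerate]
    rfl
  have h2 : LinearMap.mulRight ℂ (H.E * H.flipSM H.E) ∘ₗ tmul 1 ∘ₗ incl =
      LinearMap.mulRight ℂ (H.flipSM H.E) ∘ₗ tmul 1 ∘ₗ incl := by
    apply linear_ext_mul H.toWeakMultiplierHopfAlgebra
    intro d a
    simpa [mul_assoc] using h1 a d
  apply ext_right H.nondegenerate₂
  refine tensor_hom_congr _ _ fun c d => ?_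
  apply incl_injective H.nondegenerate₂
  have h3 : incl (c ⊗ₜ[ℂ] d) = tmul (incl c) 1 * tmul 1 (incl d) := by
    rw [← tmul_mul, one_mul, mul_one, tmul_incl]
  rw [incl_right H.nondegenerate₂, incl_right H.nondegenerate₂, h3, mul_assoc, mul_assoc]
  congr 1
  exact LinearMap.congr_fun h2 d

theorem flipSM_E : H.flipSM H.E = H.E := by
  rw [← E_mul_flipSM_E', E_mul_flipSM_E]

/-- `Δ(S(a)) = (S ⊗ S)Δ(a)^{op}`. -/
theorem Δ_S (a : A) : H.Δ (H.S a) = H.flipSM (H.Δ a) := by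
  conv_lhs => rw [Δ_S_eq_E_mul, ← flipSM_E, ← flipSM_mul, Δ_mul_E]

theorem T₁_S (a b : A) : H.T₁ (H.S a ⊗ₜ H.S b) = H.flipS (H.T₂ (b ⊗ₜ a)) := by
  apply incl_injective H.nondegenerate₂
  rw [T₁_spec, ← flipSM_incl, T₂_spec, flipSM_mul, flipSM_tmul, SM_one, SM_incl, Δ_S]

theorem T₂_S (a b : A) : H.T₂ (H.S b ⊗ₜ H.S a) = H.flipS (H.T₁ (a ⊗ₜ b)) := by
  apply incl_injective H.nondegenerate₂
  rw [T₂_spec, ← flipSM_incl, T₁_spec, flipSM_mul, flipSM_tmul, SM_one, SM_incl, Δ_S]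

theorem evalFst_flipS (f : A →ₗ[ℂ] ℂ) (u : A ⊗[ℂ] A) :
    evalFst f (H.flipS u) = H.S (evalSnd (f ∘ₗ H.S.toLinearMap) u) :=
  tensor_hom_congr (evalFst f ∘ₗ H.flipS.toLinearMap)
    (H.S.toLinearMap ∘ₗ evalSnd (f ∘ₗ H.S.toLinearMap)) (fun a b => by simp) u

theorem evalSnd_flipS (f : A →ₗ[ℂ] ℂ) (u : A ⊗[ℂ] A) :
    evalSnd f (H.flipS u) = H.S (evalFst (f ∘ₗ H.S.toLinearMap) u) :=
  tensor_hom_congr (evalSnd f ∘ₗ H.flipS.toLinearMap)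
    (H.S.toLinearMap ∘ₗ evalFst (f ∘ₗ H.S.toLinearMap)) (fun a b => by simp) u

theorem ε_comp_S : H.ε ∘ₗ H.S.toLinearMap = H.ε := by
  apply leftSlice_hom_ext (H := H.toWeakMultiplierHopfAlgebra)
  intro f c a
  rw [leftSlice_apply, eval_comm, eval_comm]
  congr 1
  apply H.S.injective
  rw [← evalFst_flipS, ← T₁_S]
  refine (H.counit_left _ _).trans ?_
  rw [← S_mul]
  exact congrArg _ (H.counit_right _ _).symm

theorem ε_S (a : A) : H.ε (H.S a) = H.ε a := LinearMap.congr_fun H.ε_comp_S a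

end RegularWeakMultiplierHopfAlgebra

/-! ### Slices of E, and filling by faithful functionals -/

/-- If a family of functionals separates points, then its evaluations of a tensor are all the
evaluations of that tensor. -/
theorem exists_evalFst_eq {K V W : Type*} [AddCommGroup K] [Module ℂ K] [AddCommGroup V]
    [Module ℂ V] [AddCommGroup W] [Module ℂ W] (Φ : K →ₗ[ℂ] V →ₗ[ℂ] ℂ)
    (hΦ : ∀ v, (∀ k, Φ k v = 0) → v = 0) (u : V ⊗[ℂ] W) (g : V →ₗ[ℂ] ℂ) :
    ∃ k, evalFst (Φ k) u = evalFst g u := by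
  let L : K →ₗ[ℂ] W :=
    { toFun := fun k => evalFst (Φ k) u
      map_add' := fun k l => tensor_hom_congr (evalFst (Φ (k + l))) (evalFst (Φ k) + evalFst (Φ l))
        (fun v w => by simp [add_smul]) u
      map_smul' := fun c k => tensor_hom_congr (evalFst (Φ (c • k))) (c • evalFst (Φ k))
        (fun v w => by simp [mul_smul]) u }
  by_contra hne
  have hmem : evalFst g u ∉ LinearMap.range L := hne
  -- A functional `h` vanishing on all the available evaluations but not on this one gives a vector
  -- `evalSnd h u` that every `Φ k` kills, so it is zero, a contradiction.
  obtain ⟨h, h1, h2⟩ := Submodule.exists_le_ker_of_notMem hmem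
  apply h1
  rw [eval_comm]
  have : evalSnd h u = 0 := hΦ _ fun k => by
    rw [← eval_comm]
    exact h2 ⟨k, rfl⟩
  rw [this, map_zero]

namespace WeakMultiplierHopfAlgebra

variable {A : Type*} [NonUnitalRing A] [Module ℂ A] [IsScalarTower ℂ A A] [SMulCommClass ℂ A A]
variable (H : WeakMultiplierHopfAlgebra A)

include H in
theorem isSliceFst_unique {f : A →ₗ[ℂ] ℂ} {m : MultiplierAlgebra (A ⊗[ℂ] A)}
    {x y : MultiplierAlgebra A} (hx : IsSliceFst f m x) (hy : IsSliceFst f m y) : x = y := by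
  apply ext_left H.nondegenerate
  intro b
  obtain ⟨u, hu, hxu⟩ := (hx b).1
  obtain ⟨v, hv, hyv⟩ := (hy b).1
  rw [hxu, hyv, incl_injective H.nondegenerate₂ (hu.trans hv.symm)]

include H in
theorem isSliceSnd_unique {f : A →ₗ[ℂ] ℂ} {m : MultiplierAlgebra (A ⊗[ℂ] A)}
    {x y : MultiplierAlgebra A} (hx : IsSliceSnd f m x) (hy : IsSliceSnd f m y) : x = y := by
  apply ext_left H.nondegenerate
  intro b
  obtain ⟨u, hu, hxu⟩ := (hx b).1
  obtain ⟨v, hv, hyv⟩ := (hy b).1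
  rw [hxu, hyv, incl_injective H.nondegenerate₂ (hu.trans hv.symm)]

include H in
theorem exists_mul'_eq (a : A) : ∃ u, LinearMap.mul' ℂ A u = a :=
  (H.idempotent ▸ Submodule.mem_top : a ∈ LinearMap.range (LinearMap.mul' ℂ A))

end WeakMultiplierHopfAlgebra

namespace RegularWeakMultiplierHopfAlgebra

open WeakMultiplierHopfAlgebra

variable {A : Type*} [NonUnitalRing A] [Module ℂ A] [IsScalarTower ℂ A A] [SMulCommClass ℂ A A]
variable (H : RegularWeakMultiplierHopfAlgebra A)

/-- Writing (a ⊗ 1)E and E(a ⊗ 1) as elements of A ⊗ ε_t(A) makes their slices well defined and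
places them in ε_t(A). -/
theorem isSliceFst_targetTensor (f : A →ₗ[ℂ] ℂ) (w : A ⊗[ℂ] A) :
    IsSliceFst f (H.targetTensor w) (H.targetMap (evalFst f w)) := by
  intro b
  refine ⟨⟨TensorProduct.map LinearMap.id (H.targetLeft b) w, ?_, ?_⟩,
    ⟨TensorProduct.map LinearMap.id (H.targetRight b) w, ?_, ?_⟩⟩
  · refine tensor_hom_congr (incl ∘ₗ TensorProduct.map LinearMap.id (H.targetLeft b))
      (LinearMap.mulRight ℂ (tmul 1 (incl b)) ∘ₗ H.targetTensor) (fun r s => ?_) w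
    simp [← tmul_mul, ← incl_left H.nondegenerate, tmul_incl]
  · exact (evalFst_map f LinearMap.id (H.targetLeft b) w).symm
  · refine tensor_hom_congr (incl ∘ₗ TensorProduct.map LinearMap.id (H.targetRight b))
      (LinearMap.mulLeft ℂ (tmul 1 (incl b)) ∘ₗ H.targetTensor) (fun r s => ?_) w
    simp [← tmul_mul, ← incl_right H.nondegenerate, tmul_incl]
  · exact (evalFst_map f LinearMap.id (H.targetRight b) w).symm

theorem tmul_mul_E_eq (u : A ⊗[ℂ] A) : tmul (incl (LinearMap.mul' ℂ A u)) 1 * H.E =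
    H.targetTensor (TensorProduct.map LinearMap.id H.S.symm.toLinearMap (H.T₂ u)) := by
  refine tensor_hom_congr (LinearMap.mulRight ℂ H.E ∘ₗ tmul.flip 1 ∘ₗ incl ∘ₗ LinearMap.mul' ℂ A)
    (H.targetTensor ∘ₗ TensorProduct.map LinearMap.id H.S.symm.toLinearMap ∘ₗ H.T₂)
    (fun e a => ?_) u
  simpa using H.tmul_mul_E e a

theorem E_mul_tmul_eq (u : A ⊗[ℂ] A) : H.E * tmul (incl (LinearMap.mul' ℂ A u)) 1 =
    H.targetTensor (H.T₃ u) := by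
  refine tensor_hom_congr (LinearMap.mulLeft ℂ H.E ∘ₗ tmul.flip 1 ∘ₗ incl ∘ₗ LinearMap.mul' ℂ A)
    (H.targetTensor ∘ₗ H.T₃) (fun e a => ?_) u
  simpa using H.E_mul_tmul_one e a

theorem exists_tmul_mul_E (a : A) : ∃ w, tmul (incl a) 1 * H.E = H.targetTensor w := by
  obtain ⟨u, rfl⟩ := H.exists_mul'_eq a
  exact ⟨_, H.tmul_mul_E_eq u⟩

theorem exists_E_mul_tmul (a : A) : ∃ w, H.E * tmul (incl a) 1 = H.targetTensor w := by
  obtain ⟨u, rfl⟩ := H.exists_mul'_eq a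
  exact ⟨_, H.E_mul_tmul_eq u⟩

theorem existsUnique_isSliceFst_tmul_mul_E (f : A →ₗ[ℂ] ℂ) (a : A) :
    ∃! x, IsSliceFst f (tmul (incl a) 1 * H.E) x := by
  obtain ⟨w, hw⟩ := H.exists_tmul_mul_E a
  rw [hw]
  exact ⟨_, H.isSliceFst_targetTensor f w, fun y hy =>
    H.isSliceFst_unique hy (H.isSliceFst_targetTensor f w)⟩

theorem existsUnique_isSliceFst_E_mul_tmul (f : A →ₗ[ℂ] ℂ) (a : A) :
    ∃! x, IsSliceFst f (H.E * tmul (incl a) 1) x := by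
  obtain ⟨w, hw⟩ := H.exists_E_mul_tmul a
  rw [hw]
  exact ⟨_, H.isSliceFst_targetTensor f w, fun y hy =>
    H.isSliceFst_unique hy (H.isSliceFst_targetTensor f w)⟩

/-- Slices of Δ(a)(e ⊗ 1) only involve functionals of the form f(· e). Non-degeneracy makes these
sufficient. -/
theorem leftSlice_mulRight_hom_ext {X : Type*} [AddCommGroup X] [Module ℂ X] {L₁ L₂ : A →ₗ[ℂ] X}
    (h : ∀ f e c a, L₁ (H.leftSlice (f ∘ₗ LinearMap.mulRight ℂ e) c a) =
      L₂ (H.leftSlice (f ∘ₗ LinearMap.mulRight ℂ e) c a)) : L₁ = L₂ := by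
  apply leftSlice_hom_ext (H := H.toWeakMultiplierHopfAlgebra)
  intro f c a
  have key : TensorProduct.map LinearMap.id L₁ (H.T₂ (c ⊗ₜ a)) =
      TensorProduct.map LinearMap.id L₂ (H.T₂ (c ⊗ₜ a)) := by
    apply evalFst_mulRight_ext H.nondegenerate
    intro f e
    rw [evalFst_map, evalFst_map]
    exact h f e c a
  have := congrArg (evalFst f) key
  rwa [evalFst_map, evalFst_map] at this

theorem evalFst_T₃ (f : A →ₗ[ℂ] ℂ) (k a e : A) :
    evalFst (f ∘ₗ LinearMap.mulLeft ℂ k) (H.T₃ (a ⊗ₜ e)) =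
      H.leftSlice (f ∘ₗ LinearMap.mulRight ℂ e) k a := by
  have := congrArg (evalFst f) (H.tmul_left_T₃ k a e)
  rw [evalFst_left, evalFst_right] at this
  exact this

theorem slicesFillTarget_of_isFaithful {φ : A →ₗ[ℂ] ℂ} (hφ : IsFaithfulFunctional φ) :
    H.SlicesFillTarget φ := by
  constructor
  · apply Set.Subset.antisymm
    · rintro x ⟨a, hx⟩
      obtain ⟨w, hw⟩ := H.exists_tmul_mul_E a
      rw [hw] at hx
      exact ⟨_, (H.isSliceFst_unique hx (H.isSliceFst_targetTensor φ w)).symm⟩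
    · let L : A ⊗[ℂ] A →ₗ[ℂ] MultiplierAlgebra A := H.targetMap ∘ₗ evalFst φ ∘ₗ
        TensorProduct.map LinearMap.id H.S.symm.toLinearMap ∘ₗ H.T₂
      have hL : ∀ x ∈ LinearMap.range L, ∃ a, IsSliceFst φ (tmul (incl a) 1 * H.E) x := by
        rintro _ ⟨u, rfl⟩
        refine ⟨LinearMap.mul' ℂ A u, ?_⟩
        rw [tmul_mul_E_eq]
        exact H.isSliceFst_targetTensor _ _
      have key : (LinearMap.range L).mkQ ∘ₗ H.targetMap ∘ₗ H.S.symm.toLinearMap = 0 := by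
        apply leftSlice_hom_ext (H := H.toWeakMultiplierHopfAlgebra)
        intro f c a
        obtain ⟨k, hk⟩ := exists_evalFst_eq ((LinearMap.mul ℂ A).compr₂ φ)
          (fun v hv => hφ.2 v hv) (H.T₂ (c ⊗ₜ a)) f
        simp only [LinearMap.comp_apply, LinearMap.zero_apply]
        rw [Submodule.mkQ_apply, Submodule.Quotient.mk_eq_zero]
        -- φ(k ·) agrees with f on (c ⊗ 1)Δ(a), and the factor k is absorbed into c.
        refine ⟨(k * c) ⊗ₜ a, ?_⟩
        have h1 : H.T₂ ((k * c) ⊗ₜ a) = (tmul (incl k) 1).left (H.T₂ (c ⊗ₜ a)) := by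
          apply incl_injective H.nondegenerate₂
          rw [incl_left H.nondegenerate₂, T₂_spec, T₂_spec, ← mul_assoc, ← tmul_mul, mul_one,
            incl_mul]
        simp only [L, LinearMap.comp_apply]
        rw [evalFst_map, LinearMap.comp_id, h1, evalFst_left, left_one, leftSlice_apply, ← hk]
        rfl
      rintro _ ⟨b, rfl⟩
      apply hL
      have := LinearMap.congr_fun key (H.S b)
      simpa [Submodule.Quotient.mk_eq_zero] using this
  · apply Set.Subset.antisymm
    · rintro x ⟨a, hx⟩
      obtain ⟨w, hw⟩ := H.exists_E_mul_tmul a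
      rw [hw] at hx
      exact ⟨_, (H.isSliceFst_unique hx (H.isSliceFst_targetTensor φ w)).symm⟩
    · let L : A ⊗[ℂ] A →ₗ[ℂ] MultiplierAlgebra A := H.targetMap ∘ₗ evalFst φ ∘ₗ H.T₃
      have hL : ∀ x ∈ LinearMap.range L, ∃ a, IsSliceFst φ (H.E * tmul (incl a) 1) x := by
        rintro _ ⟨u, rfl⟩
        refine ⟨LinearMap.mul' ℂ A u, ?_⟩
        rw [E_mul_tmul_eq]
        exact H.isSliceFst_targetTensor _ _
      have key : (LinearMap.range L).mkQ ∘ₗ H.targetMap = 0 := by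
        apply H.leftSlice_mulRight_hom_ext
        intro f e c a
        obtain ⟨k, hk⟩ := exists_evalFst_eq ((LinearMap.mul ℂ A).flip.compr₂ φ)
          (fun v hv => hφ.1 v hv) (H.T₃ (a ⊗ₜ e)) (f ∘ₗ LinearMap.mulLeft ℂ c)
        simp only [LinearMap.comp_apply, LinearMap.zero_apply]
        rw [Submodule.mkQ_apply, Submodule.Quotient.mk_eq_zero]
        refine ⟨a ⊗ₜ (e * k), ?_⟩
        have h1 : H.T₃ (a ⊗ₜ (e * k)) = (tmul (incl k) 1).right (H.T₃ (a ⊗ₜ e)) := by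
          apply incl_injective H.nondegenerate₂
          rw [incl_right H.nondegenerate₂, incl_T₃, incl_T₃, mul_assoc, ← tmul_mul, mul_one,
            incl_mul]
        simp only [L, LinearMap.comp_apply]
        rw [h1, evalFst_right, right_one, ← evalFst_T₃, ← hk]
        rfl
      rintro _ ⟨b, rfl⟩
      apply hL
      have := LinearMap.congr_fun key b
      simpa [Submodule.Quotient.mk_eq_zero] using this

/-! ### Left-right symmetry through the antipode -/

theorem isSliceSnd_flipSM_iff {f : A →ₗ[ℂ] ℂ} {m : MultiplierAlgebra (A ⊗[ℂ] A)}
    {x : MultiplierAlgebra A} : IsSliceSnd f (H.flipSM m) (H.SM x) ↔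
      IsSliceFst (f ∘ₗ H.S.toLinearMap) m x := by
  have h1 : ∀ b u, incl (H.flipS u) = H.flipSM m * tmul (incl (H.S b)) 1 ↔
      incl u = tmul 1 (incl b) * m := fun b u => by
    rw [← flipSM_incl, ← H.flipSM_injective.eq_iff (a := incl u), flipSM_mul, flipSM_tmul, SM_incl,
      SM_one]
  have h2 : ∀ b u, incl (H.flipS u) = tmul (incl (H.S b)) 1 * H.flipSM m ↔
      incl u = m * tmul 1 (incl b) := fun b u => by
    rw [← flipSM_incl, ← H.flipSM_injective.eq_iff (a := incl u), flipSM_mul, flipSM_tmul, SM_incl,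
      SM_one]
  have h3 : ∀ u, sliceSnd f (H.flipS u) = H.S (sliceFst (f ∘ₗ H.S.toLinearMap) u) :=
    H.evalSnd_flipS f
  unfold IsSliceSnd IsSliceFst
  rw [H.S.surjective.forall]
  -- S reverses products, so the left and right actions of the slice trade places.
  refine forall_congr' fun b => and_comm.trans (and_congr ?_ ?_)
  · rw [H.flipS.surjective.exists]
    simp only [h1, h2, h3, SM_left, SM_right, H.S.injective.eq_iff]
  · rw [H.flipS.surjective.exists]
    simp only [h1, h2, h3, SM_left, SM_right, H.S.injective.eq_iff]

theorem isSliceFst_flipSM_iff {f : A →ₗ[ℂ] ℂ} {m : MultiplierAlgebra (A ⊗[ℂ] A)}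
    {x : MultiplierAlgebra A} : IsSliceFst f (H.flipSM m) (H.SM x) ↔
      IsSliceSnd (f ∘ₗ H.S.toLinearMap) m x := by
  have h1 : ∀ b u, incl (H.flipS u) = H.flipSM m * tmul 1 (incl (H.S b)) ↔
      incl u = tmul (incl b) 1 * m := fun b u => by
    rw [← flipSM_incl, ← H.flipSM_injective.eq_iff (a := incl u), flipSM_mul, flipSM_tmul, SM_incl,
      SM_one]
  have h2 : ∀ b u, incl (H.flipS u) = tmul 1 (incl (H.S b)) * H.flipSM m ↔
      incl u = m * tmul (incl b) 1 := fun b u => by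
    rw [← flipSM_incl, ← H.flipSM_injective.eq_iff (a := incl u), flipSM_mul, flipSM_tmul, SM_incl,
      SM_one]
  have h3 : ∀ u, sliceFst f (H.flipS u) = H.S (sliceSnd (f ∘ₗ H.S.toLinearMap) u) :=
    H.evalFst_flipS f
  unfold IsSliceSnd IsSliceFst
  rw [H.S.surjective.forall]
  refine forall_congr' fun b => and_comm.trans (and_congr ?_ ?_)
  · rw [H.flipS.surjective.exists]
    simp only [h1, h2, h3, SM_left, SM_right, H.S.injective.eq_iff]
  · rw [H.flipS.surjective.exists]
    simp only [h1, h2, h3, SM_left, SM_right, H.S.injective.eq_iff]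

theorem flipSM_tmul_mul_E (a : A) :
    H.flipSM (tmul (incl a) 1 * H.E) = H.E * tmul 1 (incl (H.S a)) := by
  rw [flipSM_mul, flipSM_E, flipSM_tmul, SM_one, SM_incl]

theorem flipSM_E_mul_tmul (a : A) :
    H.flipSM (H.E * tmul (incl a) 1) = tmul 1 (incl (H.S a)) * H.E := by
  rw [flipSM_mul, flipSM_E, flipSM_tmul, SM_one, SM_incl]

theorem SM_bijective : Function.Bijective H.SM := ⟨H.SM_injective, H.SM_surjective⟩

theorem existsUnique_isSliceSnd_tmul_mul_E (f : A →ₗ[ℂ] ℂ) (a : A) :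
    ∃! x, IsSliceSnd f (tmul 1 (incl a) * H.E) x := by
  obtain ⟨a, rfl⟩ := H.S.surjective a
  rw [H.SM_bijective.existsUnique_iff, ← flipSM_E_mul_tmul]
  simp only [isSliceSnd_flipSM_iff]
  exact H.existsUnique_isSliceFst_E_mul_tmul _ _

theorem existsUnique_isSliceSnd_E_mul_tmul (f : A →ₗ[ℂ] ℂ) (a : A) :
    ∃! x, IsSliceSnd f (H.E * tmul 1 (incl a)) x := by
  obtain ⟨a, rfl⟩ := H.S.surjective a
  rw [H.SM_bijective.existsUnique_iff, ← flipSM_tmul_mul_E]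
  simp only [isSliceSnd_flipSM_iff]
  exact H.existsUnique_isSliceFst_tmul_mul_E _ _

theorem SM_mem_sourceAlgebra_iff {x : MultiplierAlgebra A} :
    H.SM x ∈ H.sourceAlgebra ↔ x ∈ H.targetAlgebra := by
  simp only [sourceAlgebra, targetAlgebra, LinearMap.mem_range]
  rw [H.S.surjective.exists]
  simp only [← SM_targetMap, H.SM_injective.eq_iff]

theorem SM_mem_targetAlgebra_iff {x : MultiplierAlgebra A} :
    H.SM x ∈ H.targetAlgebra ↔ x ∈ H.sourceAlgebra := by
  simp only [sourceAlgebra, targetAlgebra, LinearMap.mem_range]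
  rw [H.S.surjective.exists]
  simp only [← SM_sourceMap, H.SM_injective.eq_iff]

theorem SM_mem_sourceMultipliers_iff {x : MultiplierAlgebra A} :
    H.SM x ∈ H.sourceMultipliers ↔ x ∈ H.targetMultipliers := by
  simp only [sourceMultipliers, targetMultipliers, Set.mem_ofPred_eq]
  rw [H.SM_surjective.forall]
  simp only [SM_mem_sourceAlgebra_iff, ← SM_mul, and_comm]

/-- The flip of S ⊗ S fixes E but reverses products, so the two halves of the condition are
interchanged. -/
theorem slicesFillSource_iff {ψ : A →ₗ[ℂ] ℂ} :
    H.SlicesFillSource ψ ↔ H.SlicesFillTarget (ψ ∘ₗ H.S.toLinearMap) := by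
  have h1 : ∀ x, (∃ a, IsSliceSnd ψ (tmul 1 (incl a) * H.E) (H.SM x)) ↔
      ∃ a, IsSliceFst (ψ ∘ₗ H.S.toLinearMap) (H.E * tmul (incl a) 1) x := fun x => by
    rw [H.S.surjective.exists]
    simp only [← flipSM_E_mul_tmul, isSliceSnd_flipSM_iff]
  have h2 : ∀ x, (∃ a, IsSliceSnd ψ (H.E * tmul 1 (incl a)) (H.SM x)) ↔
      ∃ a, IsSliceFst (ψ ∘ₗ H.S.toLinearMap) (tmul (incl a) 1 * H.E) x := fun x => by
    rw [H.S.surjective.exists]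
    simp only [← flipSM_tmul_mul_E, isSliceSnd_flipSM_iff]
  unfold SlicesFillSource SlicesFillTarget
  rw [and_comm]
  simp only [Set.ext_iff, Set.mem_ofPred_eq, SetLike.mem_coe]
  refine and_congr ?_ ?_
  · rw [H.SM_surjective.forall]
    simp only [h2, SM_mem_sourceAlgebra_iff]
  · rw [H.SM_surjective.forall]
    simp only [h1, SM_mem_sourceAlgebra_iff]

theorem comp_S_eq_zero_iff {ψ : A →ₗ[ℂ] ℂ} : ψ ∘ₗ H.S.toLinearMap = 0 ↔ ψ = 0 := by
  constructor
  · intro h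
    ext a
    obtain ⟨a, rfl⟩ := H.S.surjective a
    exact LinearMap.congr_fun h a
  · rintro rfl
    exact LinearMap.zero_comp _

theorem isRightIntegral_iff {ψ : A →ₗ[ℂ] ℂ} :
    H.IsRightIntegral ψ ↔ H.IsLeftIntegral (ψ ∘ₗ H.S.toLinearMap) := by
  unfold IsRightIntegral IsLeftIntegral
  rw [Ne, Ne, comp_S_eq_zero_iff, H.S.surjective.forall]
  refine and_congr Iff.rfl (forall_congr' fun a => ?_)
  rw [H.SM_surjective.exists]
  simp only [SM_mem_sourceMultipliers_iff, Δ_S, isSliceFst_flipSM_iff]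

theorem isFaithfulFunctional_comp_S_iff {ψ : A →ₗ[ℂ] ℂ} :
    IsFaithfulFunctional ψ ↔ IsFaithfulFunctional (ψ ∘ₗ H.S.toLinearMap) := by
  have h1 : ∀ a, (∀ b, ψ (H.S a * b) = 0) ↔ ∀ b, ψ (H.S (b * a)) = 0 := fun a => by
    rw [H.S.surjective.forall]
    simp only [S_mul]
  have h2 : ∀ a, (∀ b, ψ (b * H.S a) = 0) ↔ ∀ b, ψ (H.S (a * b)) = 0 := fun a => by
    rw [H.S.surjective.forall]
    simp only [S_mul]
  unfold IsFaithfulFunctional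
  rw [H.S.surjective.forall, and_comm, H.S.surjective.forall]
  simp only [h1, h2, LinearMap.comp_apply, LinearEquiv.coe_coe, LinearEquiv.map_eq_zero_iff]

theorem isTimmermannRightIntegral_iff {ψ : A →ₗ[ℂ] ℂ} :
    H.IsTimmermannRightIntegral ψ ↔ H.IsTimmermannLeftIntegral (ψ ∘ₗ H.S.toLinearMap) := by
  unfold IsTimmermannRightIntegral IsTimmermannLeftIntegral
  rw [Ne, Ne, comp_S_eq_zero_iff]
  refine and_congr Iff.rfl ?_
  rw [H.S.surjective.forall]
  refine forall_congr' fun a => ?_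
  rw [H.S.surjective.forall]
  refine forall_congr' fun d => ?_
  have h1 : sliceFst ψ (H.T₁ (H.S a ⊗ₜ H.S (H.S d))) =
      H.S (sliceSnd (ψ ∘ₗ H.S.toLinearMap) (H.T₂ (H.S d ⊗ₜ a))) := by
    rw [T₁_S]
    exact H.evalFst_flipS _ _
  have h2 : sliceFst ψ (TensorProduct.map LinearMap.id H.S.toLinearMap
      (H.E.right (H.S a ⊗ₜ H.S d))) = H.S (sliceSnd (ψ ∘ₗ H.S.toLinearMap)
        (TensorProduct.map H.S.toLinearMap LinearMap.id (H.E.left (d ⊗ₜ a)))) := by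
    rw [← flipS_tmul]
    conv_lhs => rw [← flipSM_E, flipSM_right]
    refine (congrArg _ ?_).trans (H.evalFst_flipS _ _)
    exact tensor_hom_congr (TensorProduct.map LinearMap.id H.S.toLinearMap ∘ₗ H.flipS.toLinearMap)
      (H.flipS.toLinearMap ∘ₗ TensorProduct.map H.S.toLinearMap LinearMap.id)
      (fun x y => by simp) _
  rw [h1, h2, H.S.injective.eq_iff]

end RegularWeakMultiplierHopfAlgebra

/-! ### Counit identities and Timmermann's form of invariance -/

namespace RegularWeakMultiplierHopfAlgebra

open WeakMultiplierHopfAlgebra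

variable {A : Type*} [NonUnitalRing A] [Module ℂ A] [IsScalarTower ℂ A A] [SMulCommClass ℂ A A]
variable (H : RegularWeakMultiplierHopfAlgebra A)

theorem evalFst_ε_T₁ (u : A ⊗[ℂ] A) : evalFst H.ε (H.T₁ u) = LinearMap.mul' ℂ A u :=
  tensor_hom_congr (evalFst H.ε ∘ₗ H.T₁) (LinearMap.mul' ℂ A) (fun a b => H.counit_left a b) u

theorem evalSnd_ε_T₂ (u : A ⊗[ℂ] A) : evalSnd H.ε (H.T₂ u) = LinearMap.mul' ℂ A u :=
  tensor_hom_congr (evalSnd H.ε ∘ₗ H.T₂) (LinearMap.mul' ℂ A) (fun a b => H.counit_right a b) u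

theorem evalFst_ε_E (a b : A) : evalFst H.ε (H.E.left (a ⊗ₜ b)) = (H.targetMap a).left b := by
  rw [← T₁_R₁, evalFst_ε_T₁, targetMap_left]

theorem evalSnd_ε_E (a b : A) : evalSnd H.ε (H.E.right (a ⊗ₜ b)) = (H.sourceMap b).right a := by
  rw [← T₂_R₂, evalSnd_ε_T₂, sourceMap_right]

theorem ε_leftSlice (f : A →ₗ[ℂ] ℂ) (c a : A) : H.ε (H.leftSlice f c a) = f (c * a) := by
  rw [leftSlice_apply, eval_comm, evalSnd_ε_T₂, LinearMap.mul'_apply]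

theorem ε_rightSlice (f : A →ₗ[ℂ] ℂ) (c a : A) : H.ε (H.rightSlice f c a) = f (a * c) := by
  rw [rightSlice_apply, ← eval_comm, evalFst_ε_T₁, LinearMap.mul'_apply]

/-- `ε(ab) = ε(aε_t(b))`. -/
theorem ε_targetMap_right (a b : A) : H.ε ((H.targetMap b).right a) = H.ε (a * b) := by
  have : H.ε ∘ₗ (H.targetMap b).right = H.ε ∘ₗ LinearMap.mulRight ℂ b := by
    apply rightSlice_hom_ext (H := H.toWeakMultiplierHopfAlgebra)
    intro h c a
    have h1 : (H.targetMap b).right (H.rightSlice h c a) =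
        H.rightSlice h c ((H.targetMap b).right a) := by
      rw [rightSlice_apply, rightSlice_apply, (H.isTargetLike_targetMap b).T₁_right, evalSnd_right,
        right_one_eq, LinearMap.comp_id]
    have h2 : H.rightSlice h c a * b = evalSnd h ((H.Δ a).left (b ⊗ₜ c)) := by
      rw [Δ_left_tmul, evalSnd_right, right_one_eq, LinearMap.comp_id]
      rfl
    have h3 : evalFst H.ε ((H.Δ a).left (b ⊗ₜ c)) = a * (H.targetMap b).left c := by
      rw [← Δ_left_E_left, ← T₁_R₁, targetMap_left]
      refine tensor_hom_congr (evalFst H.ε ∘ₗ (H.Δ a).left ∘ₗ H.T₁)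
        (LinearMap.mulLeft ℂ a ∘ₗ LinearMap.mul' ℂ A) (fun x y => ?_) _
      simp [Δ_left_T₁, evalFst_ε_T₁, mul_assoc]
    simp only [LinearMap.comp_apply, LinearMap.mulRight_apply]
    rw [h1, ε_rightSlice, h2, ← eval_comm, h3, compat]
  exact LinearMap.congr_fun this a

/-- T₂(u) absorbs E on the right, and E(1 ⊗ S(y)) = E(y ⊗ 1). -/
theorem right_one_tmul_SM_T₂ {y : MultiplierAlgebra A} (hy : H.IsSourceLike y) (u : A ⊗[ℂ] A) :
    (tmul 1 (H.SM y)).right (H.T₂ u) = (tmul y 1).right (H.T₂ u) := by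
  rw [← E_right_T₂, ← right_mul, ← right_mul, E_mul_source _ hy]

/-- If `ε((ω ⊗ ι)((c ⊗ 1)Δ(n))S(y)) = 0` for all functionals `ω`, then `cny = 0`. -/
theorem right_eq_zero_of_ε {y : MultiplierAlgebra A} (hy : H.IsSourceLike y) {n : A} {c : A}
    (h : ∀ f, H.ε ((H.SM y).right (H.leftSlice f c n)) = 0) : y.right (c * n) = 0 := by
  have h1 := congrArg (evalSnd H.ε) (H.right_one_tmul_SM_T₂ hy (c ⊗ₜ n))
  rw [evalSnd_right, evalSnd_right, right_one, right_one_eq, LinearMap.comp_id, evalSnd_ε_T₂,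
    LinearMap.mul'_apply] at h1
  rw [← h1, ← Module.forall_dual_apply_eq_zero_iff ℂ]
  intro f
  rw [← eval_comm]
  exact h f

/-- ∑ a₍₁₎ε(a₍₂₎d) is rewritten with ε(xd) = ε(xε_t(d)) and ε_t(d) = S(ε_s(S⁻¹(d))); the source
element then crosses to the first leg. -/
theorem evalSnd_ε_T₁ (a d : A) :
    evalSnd H.ε (H.T₁ (a ⊗ₜ d)) = (H.sourceMap (H.S.symm d)).right a := by
  refine H.nondegenerate.right_ext fun k => ?_
  have h1 : H.ε ∘ₗ LinearMap.mulRight ℂ d = H.ε ∘ₗ (H.targetMap d).right := by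
    ext x
    exact (H.ε_targetMap_right x d).symm
  have h2 := congrArg (evalSnd H.ε)
    (H.right_one_tmul_SM_T₂ (H.isSourceLike_sourceMap (H.S.symm d)) (k ⊗ₜ a))
  rw [evalSnd_right, evalSnd_right, right_one, right_one_eq, LinearMap.comp_id, evalSnd_ε_T₂,
    SM_sourceMap_symm, ← h1, evalSnd_T₂, LinearMap.mul'_apply,
    right_mul_left H.nondegenerate] at h2
  exact h2

/-- The multiplier `(ι ⊗ φ)Δ(a)`. -/
noncomputable def sliceΔ (φ : A →ₗ[ℂ] ℂ) (a : A) : MultiplierAlgebra A :=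
  ofPair (evalSnd φ ∘ₗ H.T₃ ∘ₗ TensorProduct.mk ℂ A A a)
    (evalSnd φ ∘ₗ H.T₂ ∘ₗ (TensorProduct.mk ℂ A A).flip a) (fun c b => by
      have := congrArg (evalSnd φ) (H.tmul_left_T₃ c a b)
      rw [evalSnd_left, evalSnd_right] at this
      exact this)

theorem sliceΔ_left (φ : A →ₗ[ℂ] ℂ) (a b : A) :
    (H.sliceΔ φ a).left b = evalSnd φ (H.T₃ (a ⊗ₜ b)) := rfl

theorem sliceΔ_right (φ : A →ₗ[ℂ] ℂ) (a b : A) :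
    (H.sliceΔ φ a).right b = evalSnd φ (H.T₂ (b ⊗ₜ a)) := rfl

theorem isSliceSnd_sliceΔ (φ : A →ₗ[ℂ] ℂ) (a : A) : IsSliceSnd φ (H.Δ a) (H.sliceΔ φ a) :=
  fun _ => ⟨⟨_, H.incl_T₃ _ _, rfl⟩, ⟨_, H.T₂_spec _ _, rfl⟩⟩

theorem isLeftIntegral_iff_sliceΔ {φ : A →ₗ[ℂ] ℂ} :
    H.IsLeftIntegral φ ↔ φ ≠ 0 ∧ ∀ a, H.sliceΔ φ a ∈ H.targetMultipliers := by
  refine and_congr Iff.rfl (forall_congr' fun a => ⟨?_, fun h => ⟨_, h, H.isSliceSnd_sliceΔ φ a⟩⟩)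
  rintro ⟨x, hx, hs⟩
  rwa [H.isSliceSnd_unique (H.isSliceSnd_sliceΔ φ a) hs]

theorem sliceΔ_target_left (φ : A →ₗ[ℂ] ℂ) {x : MultiplierAlgebra A} (hx : H.IsTargetLike x)
    (a : A) : H.sliceΔ φ (x.left a) = x * H.sliceΔ φ a := by
  apply ext_right H.nondegenerate
  intro c
  rw [right_mul, sliceΔ_right, sliceΔ_right]
  congr 1
  apply incl_injective H.nondegenerate₂
  rw [T₂_spec, T₂_spec, hx.left, ← mul_assoc, ← tmul_mul, mul_one, incl_right H.nondegenerate]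

/-- A is spanned by ε_t(A)A: ab = (ε ⊗ ι)(E T₁(a ⊗ b)), and (ε ⊗ ι)(E(x ⊗ y)) = ε_t(x)y. -/
theorem targetMap_left_hom_ext {X : Type*} [AddCommGroup X] [Module ℂ X] {L₁ L₂ : A →ₗ[ℂ] X}
    (h : ∀ a b, L₁ ((H.targetMap a).left b) = L₂ ((H.targetMap a).left b)) : L₁ = L₂ := by
  apply linear_ext_mul H.toWeakMultiplierHopfAlgebra
  intro a b
  have h1 : a * b = evalFst H.ε (H.E.left (H.T₁ (a ⊗ₜ b))) := by
    rw [E_left_T₁, evalFst_ε_T₁, LinearMap.mul'_apply]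
  rw [h1]
  refine tensor_hom_congr (L₁ ∘ₗ evalFst H.ε ∘ₗ H.E.left) (L₂ ∘ₗ evalFst H.ε ∘ₗ H.E.left)
    (fun x y => ?_) _
  simp only [LinearMap.comp_apply, evalFst_ε_E, h]

theorem target_mul_mem {x y : MultiplierAlgebra A} (hx : x ∈ H.targetAlgebra)
    (hy : y ∈ H.targetAlgebra) : x * y ∈ H.targetAlgebra := by
  obtain ⟨a, rfl⟩ := hx
  obtain ⟨b, rfl⟩ := hy
  rw [← SM_sourceMap_symm _ b, ← targetMap_source_left _ (H.isSourceLike_sourceMap _)]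
  exact ⟨_, rfl⟩

theorem targetAlgebra_subset_targetMultipliers {x : MultiplierAlgebra A}
    (hx : x ∈ H.targetAlgebra) : x ∈ H.targetMultipliers :=
  fun _ hy => ⟨H.target_mul_mem hx hy, H.target_mul_mem hy hx⟩

/-- Membership in A_t improves to membership in ε_t(A): A is spanned by ε_t(A)A, and a factor x from
ε_t(A) comes out of the slice, where xA_t ⊆ ε_t(A). -/
theorem sliceΔ_mem_targetAlgebra {φ : A →ₗ[ℂ] ℂ} (hφ : ∀ a, H.sliceΔ φ a ∈ H.targetMultipliers)
    (a : A) : H.sliceΔ φ a ∈ H.targetAlgebra := by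
  let L : A →ₗ[ℂ] MultiplierAlgebra A :=
    { toFun := H.sliceΔ φ
      map_add' := fun a b => by
        ext c <;> simp [sliceΔ_left, sliceΔ_right, TensorProduct.add_tmul, TensorProduct.tmul_add]
      map_smul' := fun r a => by
        ext c <;> simp [sliceΔ_left, sliceΔ_right, ← TensorProduct.smul_tmul'] }
  have key : H.targetAlgebra.mkQ ∘ₗ L = 0 := by
    apply H.targetMap_left_hom_ext
    intro b c
    simp only [LinearMap.comp_apply, LinearMap.zero_apply]
    rw [Submodule.mkQ_apply, Submodule.Quotient.mk_eq_zero]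
    change H.sliceΔ φ _ ∈ _
    rw [sliceΔ_target_left _ _ (H.isTargetLike_targetMap b)]
    exact (hφ c _ ⟨b, rfl⟩).2
  exact (Submodule.Quotient.mk_eq_zero _).1 (LinearMap.congr_fun key a)

/-- With x = S(ε_s(a)), the vanishing of all ε(bx) gives cnε_s(a) = 0 for all c, n by
`right_eq_zero_of_ε`, and A² = A. -/
theorem eq_zero_of_ε_target {x : MultiplierAlgebra A} (hx : x ∈ H.targetAlgebra)
    (h : ∀ b, H.ε (x.right b) = 0) : x = 0 := by
  obtain ⟨y, rfl⟩ := H.SM_surjective x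
  rw [SM_mem_targetAlgebra_iff] at hx
  obtain ⟨a, rfl⟩ := hx
  have h1 : H.sourceMap a = 0 := by
    apply ext_right H.nondegenerate
    intro b
    have : (H.sourceMap a).right = 0 := by
      apply linear_ext_mul H.toWeakMultiplierHopfAlgebra
      intro c n
      exact H.right_eq_zero_of_ε (H.isSourceLike_sourceMap a) fun f => h _
    rw [this]
    rfl
  rw [h1, map_zero]

/-- `(ι ⊗ φ)(F₂(1 ⊗ a))` is an element of the target algebra. -/
theorem exists_target_F₂ (φ : A →ₗ[ℂ] ℂ) (a : A) : ∃ x ∈ H.targetAlgebra, ∀ d,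
    x.right (H.S d) = H.S (evalSnd φ (H.E.left (d ⊗ₜ a))) := by
  obtain ⟨a, rfl⟩ := H.S.surjective a
  obtain ⟨w, hw⟩ := H.exists_tmul_mul_E a
  obtain ⟨d', hd'⟩ : ∃ d', d' = evalFst (φ ∘ₗ H.S.toLinearMap) w := ⟨_, rfl⟩
  -- S² appears because E(S(d) ⊗ S(a)) is the flipped S ⊗ S image of (a ⊗ d)E, which has second legs
  -- dε_t(s), and the statement applies S once more.
  refine ⟨H.SM (H.SM (H.targetMap d')), ?_, fun d => ?_⟩
  · rw [SM_targetMap, SM_sourceMap]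
    exact ⟨_, rfl⟩
  · obtain ⟨d, rfl⟩ := H.S.surjective d
    have h1 : H.E.left (H.S d ⊗ₜ H.S a) = H.flipS (H.E.right (a ⊗ₜ d)) := by
      conv_lhs => rw [← flipS_tmul, ← flipSM_E, flipSM_left]
    have h2 : H.E.right (a ⊗ₜ d) = TensorProduct.map LinearMap.id (H.targetRight d) w := by
      apply incl_injective H.nondegenerate₂
      have h3 : incl (a ⊗ₜ[ℂ] d) = tmul 1 (incl d) * tmul (incl a) 1 := by
        rw [← tmul_mul, one_mul, mul_one, tmul_incl]
      rw [incl_right H.nondegenerate₂, h3, mul_assoc, hw]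
      refine tensor_hom_congr (LinearMap.mulLeft ℂ (tmul 1 (incl d)) ∘ₗ H.targetTensor)
        (incl ∘ₗ TensorProduct.map LinearMap.id (H.targetRight d)) (fun r s => ?_) w
      simp [← tmul_mul, ← incl_right H.nondegenerate, tmul_incl]
    rw [SM_right, SM_left, h1, evalSnd_flipS, h2, evalFst_map, hd']
    rfl

theorem isTimmermannLeftIntegral_iff {φ : A →ₗ[ℂ] ℂ} :
    H.IsTimmermannLeftIntegral φ ↔ H.IsLeftIntegral φ := by
  rw [isLeftIntegral_iff_sliceΔ]
  refine and_congr Iff.rfl ?_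
  have h0 : ∀ u, sliceSnd φ (TensorProduct.map H.S.toLinearMap LinearMap.id u) =
      H.S (evalSnd φ u) := fun u => evalSnd_map φ H.S.toLinearMap LinearMap.id u
  constructor
  · intro h a
    obtain ⟨x, hx, hxd⟩ := H.exists_target_F₂ φ a
    have : H.sliceΔ φ a = x := by
      apply ext_right H.nondegenerate
      intro b
      obtain ⟨d, rfl⟩ := H.S.surjective b
      rw [hxd, sliceΔ_right]
      exact (h a d).trans (h0 _)
    rw [this]
    exact H.targetAlgebra_subset_targetMultipliers hx
  · intro h a d
    obtain ⟨x, hx, hxd⟩ := H.exists_target_F₂ φ a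
    have h1 : H.sliceΔ φ a - x = 0 := by
      -- Paired with ε, the two elements become φ of (ε ⊗ ι)((S(d) ⊗ 1)Δ(a)) and of (ε ⊗ ι)(E(d ⊗
      -- a)); both tensors slice to ε_t(d)a.
      apply H.eq_zero_of_ε_target (Submodule.sub_mem _ (H.sliceΔ_mem_targetAlgebra h a) hx)
      intro b
      obtain ⟨d, rfl⟩ := H.S.surjective b
      have hsub : (H.sliceΔ φ a - x).right (H.S d) =
          (H.sliceΔ φ a).right (H.S d) - x.right (H.S d) := rfl
      rw [hsub, map_sub, hxd, ε_S, sliceΔ_right, ← eval_comm, ← eval_comm, evalFst_ε_E, sub_eq_zero]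
      congr 1
      obtain ⟨a, rfl⟩ := H.S.surjective a
      rw [T₂_S, evalFst_flipS, ε_comp_S]
      rw [evalSnd_ε_T₁, ← SM_left, SM_sourceMap_symm]
    rw [sub_eq_zero] at h1
    rw [h0, ← hxd, ← h1]
    rfl

end RegularWeakMultiplierHopfAlgebra

/-! ### From filled slices to faithfulness -/

namespace RegularWeakMultiplierHopfAlgebra

open WeakMultiplierHopfAlgebra

variable {A : Type*} [NonUnitalRing A] [Module ℂ A] [IsScalarTower ℂ A A] [SMulCommClass ℂ A A]
variable (H : RegularWeakMultiplierHopfAlgebra A)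

theorem E_left_T₃ (a c : A) : H.E.left (H.T₃ (a ⊗ₜ c)) = H.T₃ (a ⊗ₜ c) := by
  apply incl_injective H.nondegenerate₂
  rw [incl_left H.nondegenerate₂, incl_T₃, ← mul_assoc, E_mul_Δ]

theorem map_S_E_left_R₂ (u : A ⊗[ℂ] A) : TensorProduct.map H.S.toLinearMap LinearMap.id
    (H.E.left (TensorProduct.map H.S.symm.toLinearMap LinearMap.id (H.R₂ u))) = H.R₂ u := by
  refine tensor_hom_congr (TensorProduct.map H.S.toLinearMap LinearMap.id ∘ₗ H.E.left ∘ₗ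
    TensorProduct.map H.S.symm.toLinearMap LinearMap.id ∘ₗ H.R₂) H.R₂ (fun b a => ?_) u
  obtain ⟨b, rfl⟩ := H.S.surjective b
  simp only [LinearMap.comp_apply]
  rw [← T₃_tmul, E_left_T₃, R₂_tmul]

/-- `(ι ⊗ φ)((c' ⊗ c)Δ(a)) = (ι ⊗ φ)(R₂(c' ⊗ c)(1 ⊗ a))` for a left integral `φ`. -/
theorem IsTimmermannLeftIntegral.evalSnd_Δ_right {φ : A →ₗ[ℂ] ℂ}
    (hφ : H.IsTimmermannLeftIntegral φ) (a c c' : A) : evalSnd φ ((H.Δ a).right (c' ⊗ₜ c)) =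
      evalSnd φ ((tmul 1 (incl a)).right (H.R₂ (c' ⊗ₜ c))) := by
  -- (c' ⊗ c)E = T₂R₂(c' ⊗ c), and T₂(x ⊗ y)Δ(a) = (x ⊗ 1)Δ(ya), to which left invariance applies.
  -- The resulting map (S ⊗ ι)(E ·)(S⁻¹ ⊗ ι) is the identity on the range of R₂.
  rw [← E_right_Δ_right, ← T₂_R₂]
  conv_rhs => rw [← map_S_E_left_R₂]
  refine tensor_hom_congr (evalSnd φ ∘ₗ (H.Δ a).right ∘ₗ H.T₂)
    (evalSnd φ ∘ₗ (tmul 1 (incl a)).right ∘ₗ TensorProduct.map H.S.toLinearMap LinearMap.id ∘ₗ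
      H.E.left ∘ₗ TensorProduct.map H.S.symm.toLinearMap LinearMap.id) (fun x y => ?_) _
  obtain ⟨x, rfl⟩ := H.S.surjective x
  simp only [LinearMap.comp_apply, TensorProduct.map_tmul, LinearEquiv.coe_coe,
    LinearEquiv.symm_apply_apply, LinearMap.id_apply]
  rw [Δ_right_T₂]
  refine (hφ.2 (y * a) x).trans ?_
  have h1 : x ⊗ₜ[ℂ] (y * a) = (tmul 1 (incl a)).right (x ⊗ₜ y) := by simp
  rw [h1, left_right H.nondegenerate₂]
  exact tensor_hom_congr (evalSnd φ ∘ₗ TensorProduct.map H.S.toLinearMap LinearMap.id ∘ₗ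
    (tmul 1 (incl a)).right) (evalSnd φ ∘ₗ (tmul 1 (incl a)).right ∘ₗ
      TensorProduct.map H.S.toLinearMap LinearMap.id) (fun p q => by simp) _

variable {H}

/-- Take a = n in `evalSnd_Δ_right`: the right side only contains values φ(· n). -/
theorem IsTimmermannLeftIntegral.mul_leftSlice_eq_zero {φ : A →ₗ[ℂ] ℂ}
    (hφ : H.IsTimmermannLeftIntegral φ) {n : A} (hn : ∀ b, φ (b * n) = 0) (f : A →ₗ[ℂ] ℂ)
    (c b : A) : φ (b * H.leftSlice f c n) = 0 := by
  have h0 : φ ∘ₗ (incl n).right = 0 := LinearMap.ext hn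
  have h1 := hφ.evalSnd_Δ_right H n b c
  have h2 : ∀ u : A ⊗[ℂ] A, evalSnd (0 : A →ₗ[ℂ] ℂ) u = 0 := fun u =>
    tensor_hom_congr (evalSnd 0) 0 (fun _ _ => by simp) u
  rw [evalSnd_right, h0, h2, map_zero, Δ_right_tmul, evalSnd_left, left_one] at h1
  have h3 := congrArg f h1
  rw [← eval_comm, map_zero] at h3
  exact h3

/-- Here n is the second tensor factor in `evalSnd_Δ_right`. The left side vanishes, while the right
side is S applied to (ι ⊗ φ(· b))(Δ(n)(d ⊗ 1)), from which d is cancelled. -/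
theorem IsTimmermannLeftIntegral.leftSlice_mul_eq_zero {φ : A →ₗ[ℂ] ℂ}
    (hφ : H.IsTimmermannLeftIntegral φ) {n : A} (hn : ∀ b, φ (n * b) = 0) (f : A →ₗ[ℂ] ℂ)
    (c b : A) : φ (H.leftSlice f c n * b) = 0 := by
  have h0 : φ ∘ₗ LinearMap.mulLeft ℂ n = 0 := LinearMap.ext hn
  have h2 : ∀ u : A ⊗[ℂ] A, evalSnd (0 : A →ₗ[ℂ] ℂ) u = 0 := fun u =>
    tensor_hom_congr (evalSnd 0) 0 (fun _ _ => by simp) u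
  have h1 : ∀ d, evalSnd (φ ∘ₗ LinearMap.mulRight ℂ b) (H.T₃ (n ⊗ₜ d)) = 0 := fun d => by
    have h3 := hφ.evalSnd_Δ_right H b n (H.S d)
    rw [Δ_right_tmul, evalSnd_left, left_incl_eq, h0, h2, map_zero, evalSnd_right, right_one,
      R₂_tmul, evalSnd_map, LinearMap.comp_id] at h3
    exact (H.S.map_eq_zero_iff.1 h3.symm)
  have h4 : evalSnd (φ ∘ₗ LinearMap.mulRight ℂ b) (H.T₂ (c ⊗ₜ n)) = 0 := by
    refine H.nondegenerate_left _ fun d => ?_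
    have h5 := congrArg (evalSnd (φ ∘ₗ LinearMap.mulRight ℂ b)) (H.tmul_left_T₃ c n d)
    rw [evalSnd_left, evalSnd_right, left_one_eq, right_one_eq, LinearMap.comp_id, h1,
      map_zero] at h5
    exact h5.symm
  have h5 := congrArg f h4
  rw [← eval_comm, map_zero] at h5
  exact h5

/-- The hypothesis gives (n ⊗ b)E = 0, hence (n ⊗ 1)Δ(a) = 0, and the counit yields na = 0. -/
theorem eq_zero_of_right_source {n : A} (h : ∀ b, (H.sourceMap b).right n = 0) : n = 0 := by
  have h1 : ∀ b, H.E.right (n ⊗ₜ b) = 0 := fun b => by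
    have h0 : ∀ u, TensorProduct.map (H.sourceRight n) (LinearMap.id : A →ₗ[ℂ] A) u = 0 := fun u =>
      tensor_hom_congr (TensorProduct.map (H.sourceRight n) LinearMap.id) 0
        (fun x y => by simp [h]) u
    apply evalSnd_mulRight_ext H.nondegenerate
    intro f c
    have := congrArg (evalSnd f) (H.tmul_E_right n b c)
    rw [h0, map_zero, evalSnd_right, right_one] at this
    rw [map_zero]
    exact this
  have h2 : ∀ f a, H.leftSlice f n a = 0 := fun f a => by
    refine H.nondegenerate_left _ fun c => H.nondegenerate_right _ fun b => ?_
    rw [← evalFst_T₁, ← evalFst_tmul_mul, ← E_left_T₁, compat, h1, zero_mul, map_zero]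
  refine H.nondegenerate_left _ fun a => ?_
  rw [← LinearMap.mul'_apply (R := ℂ), ← evalSnd_ε_T₂]
  have h3 : H.T₂ (n ⊗ₜ a) = 0 := evalFst_ext fun f => by
    rw [map_zero, ← leftSlice_apply, h2]
  rw [h3, map_zero]

/-- The hypothesis gives E(n ⊗ c) = 0, hence Δ(a)(n ⊗ c) = 0. Every first leg of Δ thus kills n, and
these legs span A. -/
theorem eq_zero_of_left_source {n : A} (h : ∀ b, (H.sourceMap b).left n = 0) : n = 0 := by
  have h1 : ∀ c, H.E.left (n ⊗ₜ c) = 0 := fun c => by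
    have h0 : ∀ u, TensorProduct.map (H.sourceLeft n) (LinearMap.id : A →ₗ[ℂ] A) u = 0 := fun u =>
      tensor_hom_congr (TensorProduct.map (H.sourceLeft n) LinearMap.id) 0
        (fun x y => by simp [h]) u
    apply evalFst_ext
    intro f
    refine H.nondegenerate.right_ext fun b => ?_
    have := congrArg (evalFst f) (H.tmul_E_left b n c)
    rw [h0, map_zero, evalFst_left, left_one_eq, LinearMap.comp_id] at this
    rw [map_zero, mul_zero]
    exact this
  have h2 : ∀ g a c, H.rightSlice g c a * n = 0 := fun g a c => by
    have h3 := congrArg (evalSnd g) (H.Δ_left_tmul a n c)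
    rw [← Δ_left_E_left, h1, map_zero, map_zero, evalSnd_right, right_one_eq,
      LinearMap.comp_id] at h3
    exact h3.symm
  have h3 : LinearMap.mulRight ℂ n = 0 := by
    apply rightSlice_hom_ext (H := H.toWeakMultiplierHopfAlgebra)
    intro g c a
    exact h2 g a c
  exact H.nondegenerate_right _ fun b => LinearMap.congr_fun h3 b

/-- Both sides are (φ ⊗ ε)((q ⊗ n)E), evaluated in the two possible orders. -/
theorem ε_right_of_isSliceFst_tmul_mul_E {φ : A →ₗ[ℂ] ℂ} {q n : A} {x : MultiplierAlgebra A}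
    (hx : IsSliceFst φ (tmul (incl q) 1 * H.E) x) :
    H.ε (x.right n) = φ ((H.sourceMap n).right q) := by
  obtain ⟨v, hv, hxv⟩ := (hx n).2
  have h1 : v = H.E.right (q ⊗ₜ n) := by
    apply incl_injective H.nondegenerate₂
    rw [hv, incl_right H.nondegenerate₂, ← mul_assoc, ← tmul_mul, one_mul, mul_one, tmul_incl]
  rw [hxv, h1, ← evalSnd_ε_E]
  exact eval_comm φ H.ε _

theorem ε_right_of_isSliceFst_E_mul_tmul {φ : A →ₗ[ℂ] ℂ} {q n : A} {x : MultiplierAlgebra A}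
    (hx : IsSliceFst φ (H.E * tmul (incl q) 1) x) :
    H.ε (x.right n) = φ ((H.sourceMap n).left q) := by
  obtain ⟨v, hv, hxv⟩ := (hx n).2
  have h1 : evalSnd H.ε v = (H.sourceMap n).left q := by
    refine H.nondegenerate.right_ext fun k => ?_
    have h2 : (tmul (incl k) 1).left v = (tmul (incl q) 1).right (H.E.right (k ⊗ₜ n)) := by
      apply incl_injective H.nondegenerate₂
      rw [incl_left H.nondegenerate₂, incl_right H.nondegenerate₂, incl_right H.nondegenerate₂, hv,
        ← mul_assoc, ← tmul_mul, one_mul, mul_one, tmul_incl, mul_assoc]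
    have h3 := congrArg (evalSnd H.ε) h2
    rw [evalSnd_left, evalSnd_right, left_one_eq, right_one_eq, LinearMap.comp_id,
      evalSnd_ε_E] at h3
    rw [compat]
    exact h3
  rw [hxv, ← h1]
  exact eval_comm φ H.ε v

theorem IsTimmermannLeftIntegral.source_right_eq_zero {φ : A →ₗ[ℂ] ℂ}
    (hφ : H.IsTimmermannLeftIntegral φ) {n : A} (hn : ∀ b, φ (b * n) = 0) (q : A) :
    φ ((H.sourceMap n).right q) = 0 := by
  obtain ⟨d, rfl⟩ := H.S.surjective q
  -- π(x) = φ(· x), so that (ι ⊗ π)(Δ(n)(d ⊗ 1)) = 0 expresses that φ kills all left multiples of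
  -- the second legs. With q = S(d), qε_s(n) = ∑ S(n₍₁₎d)n₍₂₎.
  let π : A →ₗ[ℂ] A →ₗ[ℂ] ℂ := (LinearMap.mul ℂ A).flip.compr₂ φ
  have h1 : TensorProduct.map LinearMap.id π (H.T₃ (n ⊗ₜ d)) = 0 := by
    apply evalFst_mulLeft_ext H.nondegenerate
    intro f k
    rw [evalFst_map, LinearMap.comp_id, evalFst_T₃, map_zero]
    ext b
    exact hφ.mul_leftSlice_eq_zero hn _ _ _
  have h2 : ∀ u, φ (LinearMap.mul' ℂ A (TensorProduct.map H.S.toLinearMap LinearMap.id u)) =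
      TensorProduct.lift (LinearMap.applyₗ ∘ₗ H.S.toLinearMap)
        (TensorProduct.map LinearMap.id π u) := fun u =>
    tensor_hom_congr (φ ∘ₗ LinearMap.mul' ℂ A ∘ₗ TensorProduct.map H.S.toLinearMap LinearMap.id)
      (TensorProduct.lift (LinearMap.applyₗ ∘ₗ H.S.toLinearMap) ∘ₗ
        TensorProduct.map LinearMap.id π) (fun x y => by simp [π]) u
  rw [sourceMap_right, R₂_tmul, h2, h1, map_zero]

/-- ε_s(S⁻¹(n))q = S⁻¹(S(q)ε_t(n)) = ∑ n₍₂₎S⁻¹(S(q)n₍₁₎), and φ kills all right multiples of second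
legs of Δ(n). -/
theorem IsTimmermannLeftIntegral.source_left_eq_zero {φ : A →ₗ[ℂ] ℂ}
    (hφ : H.IsTimmermannLeftIntegral φ) {n : A} (hn : ∀ b, φ (n * b) = 0) (q : A) :
    φ ((H.sourceMap (H.S.symm n)).left q) = 0 := by
  let β : A ⊗[ℂ] A →ₗ[ℂ] ℂ := φ ∘ₗ LinearMap.mul' ℂ A ∘ₗ
    (TensorProduct.comm ℂ A A).toLinearMap ∘ₗ
      TensorProduct.map H.S.symm.toLinearMap LinearMap.id
  have h1 : (H.sourceMap (H.S.symm n)).left q = H.S.symm (H.mulAntipode (H.T₂ (H.S q ⊗ₜ n))) := by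
    apply H.S.injective
    rw [← SM_right, SM_sourceMap_symm, targetMap_right, LinearEquiv.apply_symm_apply]
  have h2 : ∀ u, φ (H.S.symm (H.mulAntipode u)) = β u := fun u =>
    tensor_hom_congr (φ ∘ₗ H.S.symm.toLinearMap ∘ₗ H.mulAntipode) β
      (fun x y => by simp [β, S_symm_mul]) u
  rw [h1, h2]
  apply bilin_eq_zero_of_evalFst
  intro v ω
  simp only [β, LinearMap.comp_apply, TensorProduct.map_tmul, LinearEquiv.coe_coe,
    TensorProduct.comm_tmul, LinearMap.mul'_apply, LinearMap.id_apply]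
  exact hφ.leftSlice_mul_eq_zero hn _ _ _

theorem IsTimmermannLeftIntegral.isFaithful {φ : A →ₗ[ℂ] ℂ}
    (hφ : H.IsTimmermannLeftIntegral φ) (hfill : H.SlicesFillTarget φ) :
    IsFaithfulFunctional φ := by
  constructor
  · intro n hn
    have h1 : ∀ n, (∀ b, φ (n * b) = 0) → ∀ b, H.ε ((H.sourceMap b).left n) = 0 := by
      intro n hn b
      obtain ⟨q, hq⟩ : ∃ q, IsSliceFst φ (H.E * tmul (incl q) 1)
          (H.targetMap (H.S.symm b)) := by
        have : H.targetMap (H.S.symm b) ∈ (H.targetAlgebra : Set _) := ⟨_, rfl⟩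
        rw [← hfill.2] at this
        exact this
      -- This gives ε(S⁻¹(n)ε_t(S⁻¹(b))) = φ(ε_s(S⁻¹(n))q) = 0; invariance of ε under S turns it
      -- into ε(ε_s(b)n) = 0.
      have h2 := ε_right_of_isSliceFst_E_mul_tmul (n := H.S.symm n) hq
      rw [hφ.source_left_eq_zero hn, ← ε_S, ← SM_left, SM_targetMap_symm,
        LinearEquiv.apply_symm_apply] at h2
      exact h2
    apply eq_zero_of_left_source (H := H)
    intro b
    refine H.nondegenerate_right _ fun c => ?_
    rw [← Module.forall_dual_apply_eq_zero_iff ℂ]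
    intro f
    -- f(cε_s(b)n) is ε of a slice of ε_s(b)n, that is, of ε_s(b) times a slice of n, and slices of
    -- n satisfy the same hypothesis as n.
    rw [← ε_leftSlice, (H.isSourceLike_sourceMap b).leftSlice_left]
    exact h1 _ (hφ.leftSlice_mul_eq_zero hn f c) b
  · intro n hn
    have h1 : ∀ n, (∀ b, φ (b * n) = 0) → ∀ b, H.ε ((H.targetMap b).right n) = 0 := by
      intro n hn b
      obtain ⟨q, hq⟩ : ∃ q, IsSliceFst φ (tmul (incl q) 1 * H.E) (H.targetMap b) := by
        have : H.targetMap b ∈ (H.targetAlgebra : Set _) := ⟨_, rfl⟩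
        rw [← hfill.1] at this
        exact this
      rw [ε_right_of_isSliceFst_tmul_mul_E hq, hφ.source_right_eq_zero hn]
    apply eq_zero_of_right_source (H := H)
    intro b
    refine H.nondegenerate_right _ fun c => ?_
    rw [← right_mul_left H.nondegenerate]
    -- As S(ε_s(b)) = ε_t(S(b)), what is needed is ε(n'ε_t(S(b))) = 0 for every slice n' of n.
    apply H.right_eq_zero_of_ε (H.isSourceLike_sourceMap b)
    intro f
    rw [SM_sourceMap]
    exact h1 _ (hφ.mul_leftSlice_eq_zero hn f c) _

theorem IsLeftIntegral.isFaithful_iff {φ : A →ₗ[ℂ] ℂ} (hφ : H.IsLeftIntegral φ) :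
    IsFaithfulFunctional φ ↔ H.SlicesFillTarget φ :=
  ⟨H.slicesFillTarget_of_isFaithful, (H.isTimmermannLeftIntegral_iff.2 hφ).isFaithful⟩

theorem IsRightIntegral.isFaithful_iff {ψ : A →ₗ[ℂ] ℂ} (hψ : H.IsRightIntegral ψ) :
    IsFaithfulFunctional ψ ↔ H.SlicesFillSource ψ := by
  rw [H.isFaithfulFunctional_comp_S_iff, H.slicesFillSource_iff]
  exact (H.isRightIntegral_iff.1 hψ).isFaithful_iff

variable (H)

theorem exists_comp_S_iff {P : (A →ₗ[ℂ] ℂ) → Prop} :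
    (∃ ψ : A →ₗ[ℂ] ℂ, P (ψ ∘ₗ H.S.toLinearMap)) ↔ ∃ φ, P φ := by
  constructor
  · rintro ⟨ψ, h⟩
    exact ⟨_, h⟩
  · rintro ⟨φ, h⟩
    refine ⟨φ ∘ₗ H.S.symm.toLinearMap, ?_⟩
    have : (φ ∘ₗ H.S.symm.toLinearMap) ∘ₗ H.S.toLinearMap = φ := by ext; simp
    rwa [this]

end RegularWeakMultiplierHopfAlgebra

/-! ### The criteria and the equivalences -/

theorem mainTheorem9 {A : Type*} [NonUnitalRing A] [Module ℂ A] [IsScalarTower ℂ A A]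
    [SMulCommClass ℂ A A] (H : RegularWeakMultiplierHopfAlgebra A) :
    -- the slices in the criteria are well-defined elements of `M(A)`
    (∀ (f : A →ₗ[ℂ] ℂ) (a : A),
      (∃! x, IsSliceFst f (tmul (incl a) 1 * H.E) x) ∧
      (∃! x, IsSliceFst f (H.E * tmul (incl a) 1) x) ∧
      (∃! x, IsSliceSnd f (tmul 1 (incl a) * H.E) x) ∧
      (∃! x, IsSliceSnd f (H.E * tmul 1 (incl a)) x)) ∧
    -- the criteria for left and for right integrals
    (∀ φ : A →ₗ[ℂ] ℂ, H.IsLeftIntegral φ → (IsFaithfulFunctional φ ↔ H.SlicesFillTarget φ)) ∧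
    (∀ ψ : A →ₗ[ℂ] ℂ, H.IsRightIntegral ψ → (IsFaithfulFunctional ψ ↔ H.SlicesFillSource ψ)) ∧
    -- comparison with the conditions of Timmermann
    List.TFAE [
      ∃ φ : A →ₗ[ℂ] ℂ, H.IsLeftIntegral φ ∧ IsFaithfulFunctional φ,
      ∃ φ : A →ₗ[ℂ] ℂ, H.IsLeftIntegral φ ∧ H.SlicesFillTarget φ,
      ∃ φ : A →ₗ[ℂ] ℂ, H.IsTimmermannLeftIntegral φ ∧ H.SlicesFillTarget φ,
      ∃ ψ : A →ₗ[ℂ] ℂ, H.IsRightIntegral ψ ∧ IsFaithfulFunctional ψ,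
      ∃ ψ : A →ₗ[ℂ] ℂ, H.IsRightIntegral ψ ∧ H.SlicesFillSource ψ,
      ∃ ψ : A →ₗ[ℂ] ℂ, H.IsTimmermannRightIntegral ψ ∧ H.SlicesFillSource ψ] := by

  refine ⟨fun f a => ⟨H.existsUnique_isSliceFst_tmul_mul_E f a,
    H.existsUnique_isSliceFst_E_mul_tmul f a, H.existsUnique_isSliceSnd_tmul_mul_E f a,
    H.existsUnique_isSliceSnd_E_mul_tmul f a⟩, fun φ hφ => hφ.isFaithful_iff,
    fun ψ hψ => hψ.isFaithful_iff, ?_⟩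
  tfae_have 1 ↔ 2 := exists_congr fun φ => and_congr_right fun hφ => hφ.isFaithful_iff
  tfae_have 2 ↔ 3 := exists_congr fun φ => and_congr_left fun _ =>
    H.isTimmermannLeftIntegral_iff.symm
  tfae_have 4 ↔ 1 := (exists_congr fun ψ => and_congr H.isRightIntegral_iff
    H.isFaithfulFunctional_comp_S_iff).trans
      (H.exists_comp_S_iff (P := fun φ => H.IsLeftIntegral φ ∧ IsFaithfulFunctional φ))
  tfae_have 5 ↔ 2 := (exists_congr fun ψ => and_congr H.isRightIntegral_iff
    H.slicesFillSource_iff).trans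
      (H.exists_comp_S_iff (P := fun φ => H.IsLeftIntegral φ ∧ H.SlicesFillTarget φ))
  tfae_have 6 ↔ 3 := (exists_congr fun ψ => and_congr H.isTimmermannRightIntegral_iff
    H.slicesFillSource_iff).trans
      (H.exists_comp_S_iff (P := fun φ => H.IsTimmermannLeftIntegral φ ∧ H.SlicesFillTarget φ))
  tfae_finish
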